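/- A correlation with parameters $(n_A,n_B,m_A,m_B)$ is a family of real numbers $p(a,b|s,t)$, where $s,t$ take $n_A,n_B$ values and $a,b$ take $m_A,m_B$ values (all starting from $0$). Let $\mathcal C_{qs}^{(n_A,n_B,m_A,m_B)}$ be the set of those of the form $p(a,b|s,t)=\langle\psi|P_s^{(a)}\otimes Q_t^{(b)}|\psi\rangle$, where $|\psi\rangle$ is a unit vector in the Hilbert space tensor product $\mathcal H_A\otimes\mathcal H_B$ of separable complex Hilbert spaces and $\{P_s^{(a)}\}_a$, $\{Q_t^{(b)}\}_b$ are projective measurements on $\mathcal H_A$, $\mathcal H_B$. Let $\mathcal C_q^{(n_A,n_B,m_A,m_B)}$ be the subset obtained from finite-dimensional $\mathcal H_A,\mathcal H_B$, and let $\mathcal C_{qa}^{(n_A,n_B,m_A,m_B)}$ be the closure of $\mathcal C_q^{(n_A,n_B,m_A,m_B)}$. **SATWAP correlation ($d=3$).** Let $\omega=e^{2\pi i/3}$, $\omega^x=e^{2\pi i x/3}$, $Z=\sum_{j=0}^2\omega^j|j\rangle\langle j|$, $|J\rangle=\frac1{\sqrt3}(|0\rangle+|1\rangle+|2\rangle)$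 and $|\Phi_3\rangle=\frac1{\sqrt3}(|00\rangle+|11\rangle+|22\rangle)$. Put $M_0=\omega^{-1/4}Z(I-(1-i)|J\rangle\langle J|)$, $M_1=\omega^{1/4}Z(I-(1+i)|J\rangle\langle J|)$, $N_0=Z$, $N_1=\omega^{1/2}(I-2|J\rangle\langle J|)Z$; for a unitary $A$ with $A^3=I$ let $A^{(a)}=\frac13\sum_{\ell=0}^2\omega^{-a\ell}A^\ell$ be its spectral projection for the eigenvalue $\omega^a$. The SATWAP correlation is $\langle\Phi_3|M_s^{(a)}\otimes N_t^{(b)}|\Phi_3\rangle$, $s,t\in\{0,1\}$, $a,b\in\{0,1,2\}$. **Tilted CHSH correlation.** For $\alpha\in(0,1]$ let $\theta=\arctan\alpha$, $\mu=\arctan(\sin2\theta)$, $|\Phi^{(\alpha)}\rangle=\frac1{\sqrt{1+\alpha^2}}(|00\rangle+\alpha|11\rangle)$, $S_0=\sigma_z$, $S_1=\sigma_x$, $T_0=\cos\mu\,\sigma_z+\sin\mu\,\sigma_x$, $T_1=\cos\mu\,\sigma_z-\sin\mu\,\sigma_x$. The tilted CHSH correlation for $\alpha$ is $\langle\Phi^{(\alpha)}|\frac{I+(-1)^aS_s}2\otimes\frac{I+(-1)^bT_t}2|\Phi^{(\alpha)}\rangle$,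 $s,t,a,b\in\{0,1\}$. **The correlations $p_n$.** Let $|\tau\rangle=\frac1{\sqrt2}(|00\rangle+|22\rangle)\in\mathbb C^3\otimes\mathbb C^3$ and, for $n\ge1$, $|\chi_n\rangle=\frac1{\sqrt{C_n}}\sum_{j=1}^n|00\rangle^{\otimes j}\otimes|\tau\rangle^{\otimes(n-j)}\in(\mathbb C^3)^{\otimes n}\otimes(\mathbb C^3)^{\otimes n}$, with $C_n>0$ the normalization factor, and $|\psi_n\rangle=|\Phi_3\rangle\otimes|\chi_n\rangle$. Let $\Gamma_n$ be the unitary on $\mathbb C^3\otimes(\mathbb C^3)^{\otimes n}$ with $\Gamma_n|e_0\rangle|e_1\dots e_n\rangle=|e_1\rangle|e_2\dots e_ne_0\rangle$ if all $e_i\in\{0,2\}$, and $\Gamma_n|e_0\rangle|e_1\dots e_n\rangle=|e_0\rangle|e_1\dots e_n\rangle$ otherwise. For a binary observable $\sigma$ on $\mathbb C^2=\mathrm{span}\{|0\rangle,|1\rangle\}\subset\mathbb C^3$ let $\widetilde\sigma^{(0)},\widetilde\sigma^{(1)}$ be the projections $\frac{I\pm\sigma}2$ on this subspace, extended by $0$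 to $|2\rangle$, and $\widetilde\sigma^{(2)}=|2\rangle\langle2|$. Let $\alpha=1/\sqrt2$. On $\mathbb C^3\otimes(\mathbb C^3)^{\otimes n}$ put $A_s^{(a)}=(M_s\otimes I)^{(a)}$, $B_t^{(b)}=(N_t\otimes I)^{(b)}$ for $s,t\in\{0,1\}$, and $A_{2+s}^{(a)}=\Gamma_n^\dagger(\widetilde S_s^{(a)}\otimes I)\Gamma_n$, $B_{2+t}^{(b)}=\Gamma_n^\dagger(\widetilde T_t^{(b)}\otimes I)\Gamma_n$ for $s,t\in\{0,1\}$. Let $p_n(a,b|s,t)=\langle\psi_n|A_s^{(a)}\otimes B_t^{(b)}|\psi_n\rangle$, $s,t\in\{0,1,2,3\}$, $a,b\in\{0,1,2\}$. **Properties** of a correlation $p$ with parameters $(4,4,3,3)$: (i) $p(a,b|s,t)$ for $s,t\in\{0,1\}$ is the SATWAP correlation for $d=3$; (ii) $p(a,b|s,t)$ for $s,t\in\{2,3\}$ is the tilted CHSH correlation for $\alpha=1/\sqrt2$ (with inputs $s-2,t-2$ and outputs $a,b\in\{0,1\}$; it is $0$ if $a=2$ or $b=2$); (iii) $p(1,1|2,0)=p(a=1|s=2)=p(b=1|t=0)=\frac13$,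 where the marginals are $p(a=1|s=2)=\sum_bp(1,b|2,t)$ for every $t$ and $p(b=1|t=0)=\sum_ap(a,1|s,0)$ for every $s$. **Theorem.** 1. For every $n\ge1$, $|\chi_n\rangle$ is a unit vector and $\big\|(\Gamma_n\otimes\Gamma_n)(|\tau\rangle\otimes|\chi_n\rangle)-|00\rangle\otimes|\chi_n\rangle\big\|\le\sqrt{2/n}$. 2. For every $n\ge1$, $|\psi_n\rangle$ is a unit vector, all $\{A_s^{(a)}\}_a$ and $\{B_t^{(b)}\}_b$ are projective measurements, and $p_n\in\mathcal C_q^{(4,4,3,3)}$. 3. The sequence $(p_n)$ converges; its limit $p_*$ lies in $\mathcal C_{qa}^{(4,4,3,3)}$ and satisfies (i), (ii) and (iii). 4. No $q\in\mathcal C_{qs}^{(4,4,3,3)}$ satisfies (i), (ii) and (iii). 5. As a result, $\mathcal C_{qs}^{(4,4,3,3)}\ne\mathcal C_{qa}^{(4,4,3,3)}$. -/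

import Mathlib

open scoped TensorProduct Kronecker Matrix

noncomputable section

namespace QuantumCorrelation

/-! ### Correlations and the sets `C_q`, `C_qs`, `C_qa` -/

/-- Tables of numbers `p a b s t`, read as `p(a, b | s, t)`: Alice has `nA` inputs `s` and `mA`
outputs `a`, Bob has `nB` inputs `t` and `mB` outputs `b`. The topology is that of
`ℝ ^ (mA * mB * nA * nB)`. -/
abbrev Corr (nA nB mA mB : ℕ) : Type :=
  Fin mA → Fin mB → Fin nA → Fin nB → ℝ

/-- A projective measurement with outcomes in `Fin m`: mutually orthogonal self-adjoint
idempotents that sum to the identity. Used for bounded operators on a Hilbert space and for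
complex square matrices. -/
structure IsProjectiveMeasurement {R : Type*} [Ring R] [StarRing R] {m : ℕ}
    (P : Fin m → R) : Prop where
  isStarProjection : ∀ a, IsStarProjection (P a)
  orthogonal : ∀ a b, a ≠ b → P a * P b = 0
  sum_eq_one : ∑ a, P a = 1

section Hilbert

variable (HA HB : Type)
  [NormedAddCommGroup HA] [InnerProductSpace ℂ HA] [CompleteSpace HA]
  [NormedAddCommGroup HB] [InnerProductSpace ℂ HB] [CompleteSpace HB]

/-- The Hilbert space tensor product: the completion of the algebraic tensor product for the
inner product `⟪x ⊗ y, x' ⊗ y'⟫ = ⟪x, x'⟫ ⟪y, y'⟫`. -/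
abbrev HilbertTensor : Type := UniformSpace.Completion (HA ⊗[ℂ] HB)

variable {HA HB}

/-- The bounded operator `P ⊗ Q` on the Hilbert space tensor product. -/
def tensorOp (P : HA →L[ℂ] HA) (Q : HB →L[ℂ] HB) :
    HilbertTensor HA HB →L[ℂ] HilbertTensor HA HB :=
  (TensorProduct.mapL P Q).completion

variable (HA HB)

/-- `p` has a quantum representation on the local Hilbert spaces `HA`, `HB`:
`p(a, b | s, t) = ⟨ψ, (P_s^(a) ⊗ Q_t^(b)) ψ⟩` for a unit vector `ψ` of `HA ⊗ HB` and local
projective measurements `P_s`, `Q_t`. -/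
def IsRealizedOn {nA nB mA mB : ℕ} (p : Corr nA nB mA mB) : Prop :=
  ∃ (ψ : HilbertTensor HA HB)
    (P : Fin nA → Fin mA → (HA →L[ℂ] HA)) (Q : Fin nB → Fin mB → (HB →L[ℂ] HB)),
    ‖ψ‖ = 1 ∧
    (∀ s, IsProjectiveMeasurement (P s)) ∧
    (∀ t, IsProjectiveMeasurement (Q t)) ∧
    ∀ a b s t, (p a b s t : ℂ) = inner ℂ ψ (tensorOp (P s a) (Q t b) ψ)

end Hilbert

/-- `C_qs`: quantum correlations on arbitrary separable local Hilbert spaces. -/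
def Cqs (nA nB mA mB : ℕ) : Set (Corr nA nB mA mB) :=
  {p | ∃ (HA HB : Type)
    (_ : NormedAddCommGroup HA) (_ : InnerProductSpace ℂ HA) (_ : CompleteSpace HA)
    (_ : NormedAddCommGroup HB) (_ : InnerProductSpace ℂ HB) (_ : CompleteSpace HB),
    TopologicalSpace.SeparableSpace HA ∧ TopologicalSpace.SeparableSpace HB ∧
    IsRealizedOn HA HB p}

/-- `C_q`: quantum correlations on finite-dimensional local Hilbert spaces. -/
def Cq (nA nB mA mB : ℕ) : Set (Corr nA nB mA mB) :=
  {p | ∃ (HA HB : Type)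
    (_ : NormedAddCommGroup HA) (_ : InnerProductSpace ℂ HA) (_ : CompleteSpace HA)
    (_ : NormedAddCommGroup HB) (_ : InnerProductSpace ℂ HB) (_ : CompleteSpace HB),
    FiniteDimensional ℂ HA ∧ FiniteDimensional ℂ HB ∧
    IsRealizedOn HA HB p}

/-- `C_qa`: the closure of `C_q`. -/
def Cqa (nA nB mA mB : ℕ) : Set (Corr nA nB mA mB) :=
  closure (Cq nA nB mA mB)

/-! ### Correlations given by explicit vectors and matrices

A vector of `ℂ^ι ⊗ ℂ^κ` is the function `ι × κ → ℂ` of its coordinates in the computational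
basis. -/

/-- `p(a, b | s, t) = ⟨ψ, (A_s^(a) ⊗ B_t^(b)) ψ⟩` for a vector `ψ` of `ℂ^ι ⊗ ℂ^κ` and
matrices `A_s^(a)`, `B_t^(b)`. -/
def matrixCorr {ι κ : Type*} [Fintype ι] [Fintype κ] {nA nB mA mB : ℕ}
    (ψ : ι × κ → ℂ) (A : Fin nA → Fin mA → Matrix ι ι ℂ) (B : Fin nB → Fin mB → Matrix κ κ ℂ) :
    Corr nA nB mA mB :=
  fun a b s t => (star ψ ⬝ᵥ ((A s a ⊗ₖ B t b).mulVec ψ)).re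

/-! ### The SATWAP correlation -/

/-- `ω ^ x`, where `ω = exp (2 π i / d)`. -/
def omegaPow (d : ℕ) (x : ℝ) : ℂ :=
  Complex.exp (2 * Real.pi * Complex.I * x / d)

/-- The projection on the eigenspace for the eigenvalue `ω ^ a` of a matrix `A` that is unitary
with `A ^ d = 1`, as `(1 / d) ∑_ℓ ω ^ (-a ℓ) A ^ ℓ`. -/
def eigenProj {ι : Type*} [Fintype ι] [DecidableEq ι] (d : ℕ) (A : Matrix ι ι ℂ) (a : Fin d) :
    Matrix ι ι ℂ :=
  (1 / d : ℂ) • ∑ l ∈ Finset.range d, omegaPow d (-((a : ℝ) * l)) • A ^ l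

/-- The generalized Pauli matrix `Z = ∑_i ω ^ i |i⟩⟨i|`. -/
def matZ (d : ℕ) : Matrix (Fin d) (Fin d) ℂ :=
  Matrix.diagonal fun i => omegaPow d (i : ℝ)

/-- The projection `|J⟩⟨J|`, where `|J⟩ = d ^ (-1/2) ∑_i |i⟩`. -/
def matJ (d : ℕ) : Matrix (Fin d) (Fin d) ℂ :=
  Matrix.of fun _ _ => (1 / d : ℂ)

/-- Alice's two optimal observables: `ω ^ (-1/4) Z (1 - (1 - i) |J⟩⟨J|)` and
`ω ^ (1/4) Z (1 - (1 + i) |J⟩⟨J|)`. -/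
def satwapA (d : ℕ) : Fin 2 → Matrix (Fin d) (Fin d) ℂ :=
  ![omegaPow d (-(1 / 4)) • (matZ d * (1 - (1 - Complex.I) • matJ d)),
    omegaPow d (1 / 4) • (matZ d * (1 - (1 + Complex.I) • matJ d))]

/-- Bob's two optimal observables: `Z` and `ω ^ (1/2) (1 - 2 |J⟩⟨J|) Z`. -/
def satwapB (d : ℕ) : Fin 2 → Matrix (Fin d) (Fin d) ℂ :=
  ![matZ d, omegaPow d (1 / 2) • ((1 - (2 : ℂ) • matJ d) * matZ d)]

/-- The maximally entangled state `Φ_d = d ^ (-1/2) ∑_i |i i⟩`. -/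
def maxEnt (d : ℕ) : Fin d × Fin d → ℂ :=
  fun x => if x.1 = x.2 then ((1 / √(d : ℝ) : ℝ) : ℂ) else 0

/-- The SATWAP correlation with `d` outputs. -/
def satwapCorr (d : ℕ) : Corr 2 2 d d :=
  matrixCorr (maxEnt d) (fun s a => eigenProj d (satwapA d s) a)
    (fun t b => eigenProj d (satwapB d t) b)

/-! ### The tilted CHSH correlation -/

/-- The Pauli matrix `σ_z`. -/
def pauliZ : Matrix (Fin 2) (Fin 2) ℂ := !![1, 0; 0, -1]

/-- The Pauli matrix `σ_x`. -/
def pauliX : Matrix (Fin 2) (Fin 2) ℂ := !![0, 1; 1, 0]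

/-- The angle `μ` with `tan μ = sin (2 θ)`, where `tan θ = α`. -/
def tiltedMu (α : ℝ) : ℝ := Real.arctan (Real.sin (2 * Real.arctan α))

/-- Alice's two observables `σ_z`, `σ_x`. -/
def tiltedA : Fin 2 → Matrix (Fin 2) (Fin 2) ℂ := ![pauliZ, pauliX]

/-- Bob's two observables `cos μ σ_z + sin μ σ_x` and `cos μ σ_z - sin μ σ_x`. -/
def tiltedB (α : ℝ) : Fin 2 → Matrix (Fin 2) (Fin 2) ℂ :=
  ![(Real.cos (tiltedMu α) : ℂ) • pauliZ + (Real.sin (tiltedMu α) : ℂ) • pauliX,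
    (Real.cos (tiltedMu α) : ℂ) • pauliZ - (Real.sin (tiltedMu α) : ℂ) • pauliX]

/-- The projection `(1 + (-1) ^ a σ) / 2` on the eigenspace for the eigenvalue `(-1) ^ a` of a
binary observable `σ`. -/
def binaryProj (σ : Matrix (Fin 2) (Fin 2) ℂ) (a : Fin 2) : Matrix (Fin 2) (Fin 2) ℂ :=
  (1 / 2 : ℂ) • (1 + ((-1 : ℂ) ^ (a : ℕ)) • σ)

/-- The state `(1 + α²) ^ (-1/2) (|00⟩ + α |11⟩)`. -/
def tiltedState (α : ℝ) : Fin 2 × Fin 2 → ℂ :=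
  fun x => if x = (0, 0) then ((1 / √(1 + α ^ 2) : ℝ) : ℂ)
    else if x = (1, 1) then ((α / √(1 + α ^ 2) : ℝ) : ℂ) else 0

/-- The tilted CHSH correlation for the parameter `α`. -/
def tiltedCHSHCorr (α : ℝ) : Corr 2 2 2 2 :=
  matrixCorr (tiltedState α) (fun s a => binaryProj (tiltedA s) a)
    (fun t b => binaryProj (tiltedB α t) b)

/-! ### The three properties -/

/-- For inputs in `{0, 1}` the correlation is the SATWAP correlation for `d = 3`. -/
def PropI (p : Corr 4 4 3 3) : Prop :=
  ∀ (a b : Fin 3) (s t : Fin 2),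
    p a b (Fin.castAdd 2 s) (Fin.castAdd 2 t) = satwapCorr 3 a b s t

/-- For inputs in `{2, 3}` the correlation is the tilted CHSH correlation for `α = 1 / √2`, with
outputs in `{0, 1}`; the output `2` does not occur. -/
def PropII (p : Corr 4 4 3 3) : Prop :=
  ∀ s t : Fin 2,
    (∀ a b : Fin 2, p a.castSucc b.castSucc (Fin.natAdd 2 s) (Fin.natAdd 2 t) =
      tiltedCHSHCorr (1 / √2) a b s t) ∧
    (∀ a : Fin 3, p a 2 (Fin.natAdd 2 s) (Fin.natAdd 2 t) = 0) ∧
    (∀ b : Fin 3, p 2 b (Fin.natAdd 2 s) (Fin.natAdd 2 t) = 0)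

/-- `p(1, 1 | 2, 0) = p(a = 1 | s = 2) = p(b = 1 | t = 0) = 1 / 3`. The marginals are the same
whatever the other party's input is. -/
def PropIII (p : Corr 4 4 3 3) : Prop :=
  p 1 1 2 0 = 1 / 3 ∧ (∀ t : Fin 4, ∑ b, p 1 b 2 t = 1 / 3) ∧
    (∀ s : Fin 4, ∑ a, p a 1 s 0 = 1 / 3)

/-! ### The embezzlement family and the correlations `p_n` -/

/-- The state `|00⟩` of `ℂ³ ⊗ ℂ³`. -/
def ket00 : Fin 3 × Fin 3 → ℂ := fun x => if x = (0, 0) then 1 else 0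

/-- The state `τ = (|00⟩ + |22⟩) / √2` of `ℂ³ ⊗ ℂ³`. -/
def tau : Fin 3 × Fin 3 → ℂ :=
  fun x => if x = (0, 0) ∨ x = (2, 2) then ((1 / √2 : ℝ) : ℂ) else 0

/-- Tensor product of bipartite vectors, with Alice's factors and Bob's factors grouped. -/
def biTensor {ι κ ι' κ' : Type*} (u : ι × κ → ℂ) (v : ι' × κ' → ℂ) :
    (ι × ι') × (κ × κ') → ℂ :=
  fun x => u (x.1.1, x.2.1) * v (x.1.2, x.2.2)

/-- Words `e_1 … e_n` with letters in `{0, 1, 2}`: they index the computational basis of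
`(ℂ³)^{⊗ n}`. The letter `e_{i+1}` is `e i`. -/
abbrev Word (n : ℕ) : Type := Fin n → Fin 3

/-- The unnormalized vector `∑_{j = 1}^n |00⟩^{⊗ j} ⊗ τ^{⊗ (n - j)}`. -/
def chiRaw (n : ℕ) : Word n × Word n → ℂ :=
  fun x => ∑ j ∈ Finset.Icc 1 n, ∏ i : Fin n,
    (if (i : ℕ) < j then ket00 (x.1 i, x.2 i) else tau (x.1 i, x.2 i))

/-- The normalization factor `C_n`. -/
def chiC (n : ℕ) : ℝ := ∑ x, ‖chiRaw n x‖ ^ 2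

/-- The state `χ_n = C_n ^ (-1/2) ∑_{j = 1}^n |00⟩^{⊗ j} ⊗ τ^{⊗ (n - j)}`. -/
def chi (n : ℕ) : Word n × Word n → ℂ :=
  fun x => ((1 / √(chiC n) : ℝ) : ℂ) * chiRaw n x

/-- The shared state `ψ_n = Φ_3 ⊗ χ_n`. -/
def psi (n : ℕ) : (Fin 3 × Word n) × (Fin 3 × Word n) → ℂ :=
  biTensor (maxEnt 3) (chi n)

/-- The map `(e_0, e_1 … e_n) ↦ (e_1, e_2 … e_n e_0)` if all the letters are in `{0, 2}`, and the
identity otherwise. -/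
def shift (n : ℕ) (x : Fin 3 × Word n) : Fin 3 × Word n :=
  let w : Fin (n + 1) → Fin 3 := Fin.cons x.1 x.2
  if ∀ i, w i = 0 ∨ w i = 2 then (w (0 + 1), fun i => w (i.succ + 1)) else x

/-- The unitary `Γ_n = Λ_n` that acts on the computational basis by `shift`. -/
def Gam (n : ℕ) : Matrix (Fin 3 × Word n) (Fin 3 × Word n) ℂ :=
  Matrix.of fun x y => if x = shift n y then 1 else 0

/-- The inclusion of `ℂ²` in `ℂ³` as the span of `|0⟩`, `|1⟩`. -/
def incl : Matrix (Fin 3) (Fin 2) ℂ :=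
  Matrix.of fun i j => if i = j.castSucc then 1 else 0

/-- The measurement on `ℂ³` that measures the binary observable `σ` on the span of `|0⟩`, `|1⟩`
(outcomes `0`, `1`), and has the outcome `2` on `|2⟩`. -/
def qutritProj (σ : Matrix (Fin 2) (Fin 2) ℂ) : Fin 3 → Matrix (Fin 3) (Fin 3) ℂ :=
  ![incl * binaryProj σ 0 * inclᴴ, incl * binaryProj σ 1 * inclᴴ, Matrix.single 2 2 1]

/-- Four measurements on `ℂ³ ⊗ (ℂ³)^{⊗ n}`: for inputs `0`, `1` the `3`-valued observables
`M_s ⊗ 1`, and for inputs `2`, `3` the measurements of `σ_s ⊗ 1` conjugated by `Γ_n`. -/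
def tableMeas (n : ℕ) (M : Fin 2 → Matrix (Fin 3) (Fin 3) ℂ)
    (σ : Fin 2 → Matrix (Fin 2) (Fin 2) ℂ) (s : Fin 4) (a : Fin 3) :
    Matrix (Fin 3 × Word n) (Fin 3 × Word n) ℂ :=
  Fin.addCases (m := 2) (n := 2)
    (fun s => eigenProj 3 (M s ⊗ₖ (1 : Matrix (Word n) (Word n) ℂ)) a)
    (fun s => (Gam n)ᴴ * (qutritProj (σ s) a ⊗ₖ (1 : Matrix (Word n) (Word n) ℂ)) * Gam n) s

/-- Alice's measurements. -/
def measA (n : ℕ) : Fin 4 → Fin 3 → Matrix (Fin 3 × Word n) (Fin 3 × Word n) ℂ :=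
  tableMeas n (satwapA 3) tiltedA

/-- Bob's measurements. -/
def measB (n : ℕ) : Fin 4 → Fin 3 → Matrix (Fin 3 × Word n) (Fin 3 × Word n) ℂ :=
  tableMeas n (satwapB 3) (tiltedB (1 / √2))

/-- The correlation `p_n` of the state `ψ_n` and the measurements `measA n`, `measB n`. -/
def pSeq (n : ℕ) : Corr 4 4 3 3 := matrixCorr (psi n) (measA n) (measB n)

end QuantumCorrelation

end

open scoped TensorProduct Kronecker Matrix

set_option linter.unusedSectionVars false

noncomputable section

namespace QuantumCorrelation


/-! ### Operators on the Hilbert space tensor product -/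

section HilbertTensor

variable {HA HB : Type}
  [NormedAddCommGroup HA] [InnerProductSpace ℂ HA] [CompleteSpace HA]
  [NormedAddCommGroup HB] [InnerProductSpace ℂ HB] [CompleteSpace HB]

/-! The obstruction to a spatial realization is the injective norm of a vector `φ` of the Hilbert
space tensor product, the supremum of `|⟪x ⊗ y, φ⟫|` over unit vectors `x`, `y`, that is, the
largest Schmidt coefficient (`InjLe`). Local operators that act isometrically on `φ` do not increase
it, two summands that are orthogonal on both sides combine to their maximum (`InjLe.add_of_blocks`),
and it vanishes only for `φ = 0`.

Suppose `ψ` realizes a correlation with the three properties. The SATWAP values are extremal: they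
force Bob's two observables to act on `ψ` as fixed combinations of Alice's
(`Realizes.satwapMirror`). Since the operators `X ⊗ 1` commute with Bob's, relations that hold at
`ψ` hold on all vectors `(X ⊗ 1) ψ`, and there they generate a copy of the 3 × 3 matrix units. Hence
the three blocks of `ψ` given by Bob's outcomes for the input `0` are carried to each other by local
partial isometries and have the same injective norm (`SatwapMirror.injLe_block`). The sum of the
blocks `0` and `2` then has no larger norm than the block `1`.

The tilted CHSH values are extremal too. They give local operators that carry the part of `ψ` on
which Alice's first binary observable is `1` to the part on which it is `-1`, up to the factor `1 /
√2` between the Schmidt coefficients of the tilted state (`tilted_relations`,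
`injLe_of_tilted_swap`). Property (iii) identifies these parts with the blocks `0` and `2` together
and with the block `1`. So each bound `k` for the injective norm of the block `1` improves to `k /
√2`; the block is zero, although its squared norm is `1 / 3`.

In the limit the same swap is possible. The cyclic shift of letters turns `τ ⊗ χ_n` into `|00⟩ ⊗
χ_n` up to two of the summands that define `χ_n`, because the sums telescope, and this is small
against `C_n ≥ n`. As `Φ_3 = √(2/3) τ + √(1/3) |11⟩` and the shift fixes words that contain the
letter `1`, it turns `ψ_n` approximately into the tilted state tensored with `χ_n`. The SATWAP block
is exact for each `n ≥ 1`, the tilted block converges, and the mixed blocks converge because the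
only surviving coherence sits on the all-zero word, whose weight tends to `0`. -/

/-- The embedding `y ↦ x ⊗ y`. -/
def tmulLeft (x : HA) : HB →L[ℂ] HilbertTensor HA HB :=
  UniformSpace.Completion.toComplL ∘L TensorProduct.mkL ℂ HA HB x

/-- The embedding `x ↦ x ⊗ y`. -/
def tmulRight (y : HB) : HA →L[ℂ] HilbertTensor HA HB :=
  UniformSpace.Completion.toComplL ∘L (TensorProduct.mkL ℂ HA HB).flip y

lemma tmulRight_apply (x : HA) (y : HB) : tmulRight y x = tmulLeft x y := rfl

lemma tmulLeft_apply (x : HA) (y : HB) :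
    tmulLeft x y = ((x ⊗ₜ[ℂ] y : HA ⊗[ℂ] HB) : HilbertTensor HA HB) := rfl

lemma tensorOp_tmul (P : HA →L[ℂ] HA) (Q : HB →L[ℂ] HB) (x : HA) (y : HB) :
    tensorOp P Q (tmulLeft x y) = tmulLeft (P x) (Q y) := by
  simp [tensorOp, tmulLeft_apply]

lemma inner_tmul_tmul (x x' : HA) (y y' : HB) :
    inner ℂ (tmulLeft x y) (tmulLeft x' y') = inner ℂ x x' * inner ℂ y y' := by
  simp [tmulLeft_apply, UniformSpace.Completion.inner_coe]

lemma ext_tmul {E : Type*} [NormedAddCommGroup E] [NormedSpace ℂ E]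
    {S T : HilbertTensor HA HB →L[ℂ] E}
    (h : ∀ x y, S (tmulLeft x y) = T (tmulLeft x y)) : S = T := by
  have h' : S ∘L UniformSpace.Completion.toComplL = T ∘L UniformSpace.Completion.toComplL := by
    apply ContinuousLinearMap.coe_inj.mp
    exact TensorProduct.ext' h
  ext v
  induction v using UniformSpace.Completion.induction_on with
  | hp => exact isClosed_eq S.continuous T.continuous
  | ih v => exact DFunLike.congr_fun h' v

lemma ext_inner_tmul {φ χ : HilbertTensor HA HB}
    (h : ∀ x y, inner ℂ (tmulLeft x y) φ = inner ℂ (tmulLeft x y) χ) : φ = χ := by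
  refine innerSL_inj (𝕜 := ℂ).mp (ext_tmul fun x y => ?_)
  have := congrArg (starRingEnd ℂ) (h x y)
  simpa [inner_conj_symm] using this

lemma tensorOp_mul (P P' : HA →L[ℂ] HA) (Q Q' : HB →L[ℂ] HB) :
    tensorOp (P * P') (Q * Q') = tensorOp P Q * tensorOp P' Q' :=
  ext_tmul fun x y => by simp [tensorOp_tmul]

lemma tensorOp_one : tensorOp (1 : HA →L[ℂ] HA) (1 : HB →L[ℂ] HB) = 1 :=
  ext_tmul fun x y => by simp [tensorOp_tmul]

lemma tensorOp_add_left (P P' : HA →L[ℂ] HA) (Q : HB →L[ℂ] HB) :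
    tensorOp (P + P') Q = tensorOp P Q + tensorOp P' Q :=
  ext_tmul fun x y => by
    rw [add_apply, tensorOp_tmul, tensorOp_tmul, tensorOp_tmul, add_apply]
    simp only [← tmulRight_apply, map_add]

lemma tensorOp_add_right (P : HA →L[ℂ] HA) (Q Q' : HB →L[ℂ] HB) :
    tensorOp P (Q + Q') = tensorOp P Q + tensorOp P Q' :=
  ext_tmul fun x y => by simp [tensorOp_tmul]

lemma tensorOp_smul_left (c : ℂ) (P : HA →L[ℂ] HA) (Q : HB →L[ℂ] HB) :
    tensorOp (c • P) Q = c • tensorOp P Q :=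
  ext_tmul fun x y => by
    rw [smul_apply, tensorOp_tmul, tensorOp_tmul, smul_apply]
    simp only [← tmulRight_apply, map_smul]

lemma tensorOp_smul_right (c : ℂ) (P : HA →L[ℂ] HA) (Q : HB →L[ℂ] HB) :
    tensorOp P (c • Q) = c • tensorOp P Q :=
  ext_tmul fun x y => by simp [tensorOp_tmul]

lemma tensorOp_star (P : HA →L[ℂ] HA) (Q : HB →L[ℂ] HB) :
    tensorOp (star P) (star Q) = star (tensorOp P Q) := by
  refine ext_tmul fun x y => ext_inner_tmul fun x' y' => ?_
  simp only [ContinuousLinearMap.star_eq_adjoint]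
  rw [ContinuousLinearMap.adjoint_inner_right, tensorOp_tmul, tensorOp_tmul, inner_tmul_tmul,
    inner_tmul_tmul, ContinuousLinearMap.adjoint_inner_right,
    ContinuousLinearMap.adjoint_inner_right]

variable (HB) in
/-- The representation `P ↦ P ⊗ 1` of the operators on the first factor. -/
def leftOp : (HA →L[ℂ] HA) →⋆ₐ[ℂ] (HilbertTensor HA HB →L[ℂ] HilbertTensor HA HB) where
  toFun P := tensorOp P 1
  map_one' := tensorOp_one
  map_mul' P P' := by rw [← tensorOp_mul, one_mul]
  map_zero' := by simpa using tensorOp_smul_left 0 (0 : HA →L[ℂ] HA) (1 : HB →L[ℂ] HB)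
  map_add' P P' := tensorOp_add_left P P' 1
  commutes' c := by
    rw [Algebra.algebraMap_eq_smul_one, tensorOp_smul_left, tensorOp_one,
      Algebra.algebraMap_eq_smul_one]
  map_star' P := by rw [← tensorOp_star, star_one]

variable (HA) in
/-- The representation `Q ↦ 1 ⊗ Q` of the operators on the second factor. -/
def rightOp : (HB →L[ℂ] HB) →⋆ₐ[ℂ] (HilbertTensor HA HB →L[ℂ] HilbertTensor HA HB) where
  toFun Q := tensorOp 1 Q
  map_one' := tensorOp_one
  map_mul' P P' := by rw [← tensorOp_mul, one_mul]
  map_zero' := by simpa using tensorOp_smul_right 0 (1 : HA →L[ℂ] HA) (0 : HB →L[ℂ] HB)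
  map_add' P P' := tensorOp_add_right 1 P P'
  commutes' c := by
    rw [Algebra.algebraMap_eq_smul_one, tensorOp_smul_right, tensorOp_one,
      Algebra.algebraMap_eq_smul_one]
  map_star' P := by rw [← tensorOp_star, star_one]

lemma leftOp_apply (P : HA →L[ℂ] HA) : leftOp HB P = tensorOp P 1 := rfl

lemma rightOp_apply (Q : HB →L[ℂ] HB) : rightOp HA Q = tensorOp 1 Q := rfl

lemma leftOp_mul_rightOp (P : HA →L[ℂ] HA) (Q : HB →L[ℂ] HB) :
    leftOp HB P * rightOp HA Q = tensorOp P Q := by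
  rw [leftOp_apply, rightOp_apply, ← tensorOp_mul, one_mul, mul_one]

lemma rightOp_mul_leftOp (P : HA →L[ℂ] HA) (Q : HB →L[ℂ] HB) :
    rightOp HA Q * leftOp HB P = tensorOp P Q := by
  rw [leftOp_apply, rightOp_apply, ← tensorOp_mul, one_mul, mul_one]

lemma leftOp_rightOp_comm (P : HA →L[ℂ] HA) (Q : HB →L[ℂ] HB) (v : HilbertTensor HA HB) :
    leftOp HB P (rightOp HA Q v) = rightOp HA Q (leftOp HB P v) :=
  DFunLike.congr_fun ((leftOp_mul_rightOp P Q).trans (rightOp_mul_leftOp P Q).symm) v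

/-! ### The injective norm -/

/-- The slice of `φ` at `x` in the first factor: `⟪y, sliceRight x φ⟫ = ⟪x ⊗ y, φ⟫`. -/
def sliceRight (x : HA) : HilbertTensor HA HB →L[ℂ] HB := (tmulLeft x).adjoint

/-- The slice of `φ` at `y` in the second factor: `⟪x, sliceLeft y φ⟫ = ⟪x ⊗ y, φ⟫`. -/
def sliceLeft (y : HB) : HilbertTensor HA HB →L[ℂ] HA := (tmulRight y).adjoint

lemma inner_sliceRight (x : HA) (y : HB) (φ : HilbertTensor HA HB) :
    inner ℂ y (sliceRight x φ) = inner ℂ (tmulLeft x y) φ :=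
  ContinuousLinearMap.adjoint_inner_right _ _ _

lemma inner_sliceLeft (x : HA) (y : HB) (φ : HilbertTensor HA HB) :
    inner ℂ x (sliceLeft y φ) = inner ℂ (tmulLeft x y) φ :=
  ContinuousLinearMap.adjoint_inner_right _ _ _

lemma inner_tmul_rightOp (x : HA) (y : HB) (T : HB →L[ℂ] HB) (φ : HilbertTensor HA HB) :
    inner ℂ (tmulLeft x y) (rightOp HA T φ) = inner ℂ (tmulLeft x (T.adjoint y)) φ := by
  have h : rightOp HA (T.adjoint) (tmulLeft x y) = tmulLeft x (T.adjoint y) := by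
    rw [rightOp_apply, tensorOp_tmul]; rfl
  rw [← h, ← ContinuousLinearMap.star_eq_adjoint, map_star, ContinuousLinearMap.star_eq_adjoint,
    ContinuousLinearMap.adjoint_inner_left]

lemma inner_tmul_leftOp (x : HA) (y : HB) (T : HA →L[ℂ] HA) (φ : HilbertTensor HA HB) :
    inner ℂ (tmulLeft x y) (leftOp HB T φ) = inner ℂ (tmulLeft (T.adjoint x) y) φ := by
  have h : leftOp HB (T.adjoint) (tmulLeft x y) = tmulLeft (T.adjoint x) y := by
    rw [leftOp_apply, tensorOp_tmul]; rfl
  rw [← h, ← ContinuousLinearMap.star_eq_adjoint, map_star, ContinuousLinearMap.star_eq_adjoint,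
    ContinuousLinearMap.adjoint_inner_left]

lemma sliceRight_rightOp (x : HA) (T : HB →L[ℂ] HB) (φ : HilbertTensor HA HB) :
    sliceRight x (rightOp HA T φ) = T (sliceRight x φ) := by
  refine ext_inner_left ℂ fun y => ?_
  rw [inner_sliceRight, inner_tmul_rightOp, ← inner_sliceRight,
    ContinuousLinearMap.adjoint_inner_left]

lemma sliceLeft_leftOp (y : HB) (T : HA →L[ℂ] HA) (φ : HilbertTensor HA HB) :
    sliceLeft y (leftOp HB T φ) = T (sliceLeft y φ) := by
  refine ext_inner_left ℂ fun x => ?_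
  rw [inner_sliceLeft, inner_tmul_leftOp, ← inner_sliceLeft,
    ContinuousLinearMap.adjoint_inner_left]

lemma sliceLeft_rightOp (y : HB) (T : HB →L[ℂ] HB) (φ : HilbertTensor HA HB) :
    sliceLeft y (rightOp HA T φ) = sliceLeft (T.adjoint y) φ := by
  refine ext_inner_left ℂ fun x => ?_
  rw [inner_sliceLeft, inner_tmul_rightOp, ← inner_sliceLeft]

/-- The injective tensor norm of `φ` is at most `c`. -/
def InjLe (φ : HilbertTensor HA HB) (c : ℝ) : Prop :=
  ∀ x y, ‖inner ℂ (tmulLeft x y) φ‖ ≤ c * ‖x‖ * ‖y‖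

/-- The injective norm is the operator norm of the slicing map. For the forward direction the test
vector `y` is the slice itself. -/
lemma injLe_iff_right {φ : HilbertTensor HA HB} {c : ℝ} (hc : 0 ≤ c) :
    InjLe φ c ↔ ∀ x, ‖sliceRight x φ‖ ≤ c * ‖x‖ := by
  constructor
  · intro h x
    have h1 := h x (sliceRight x φ)
    rw [← inner_sliceRight, inner_self_eq_norm_sq_to_K] at h1
    have h2 : ‖sliceRight x φ‖ ^ 2 ≤ c * ‖x‖ * ‖sliceRight x φ‖ := by simpa using h1
    rcases (norm_nonneg (sliceRight x φ)).eq_or_lt with h0 | h0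
    · rw [← h0]; positivity
    · rw [sq] at h2; exact le_of_mul_le_mul_right h2 h0
  · intro h x y
    rw [← inner_sliceRight]
    calc _ ≤ ‖y‖ * ‖sliceRight x φ‖ := norm_inner_le_norm _ _
      _ ≤ ‖y‖ * (c * ‖x‖) := by gcongr; exact h x
      _ = _ := by ring

lemma injLe_iff_left {φ : HilbertTensor HA HB} {c : ℝ} (hc : 0 ≤ c) :
    InjLe φ c ↔ ∀ y, ‖sliceLeft y φ‖ ≤ c * ‖y‖ := by
  constructor
  · intro h y
    have h1 := h (sliceLeft y φ) y
    rw [← inner_sliceLeft, inner_self_eq_norm_sq_to_K] at h1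
    have h2 : ‖sliceLeft y φ‖ ^ 2 ≤ c * ‖sliceLeft y φ‖ * ‖y‖ := by simpa using h1
    rcases (norm_nonneg (sliceLeft y φ)).eq_or_lt with h0 | h0
    · rw [← h0]; positivity
    · rw [sq, mul_right_comm] at h2; exact le_of_mul_le_mul_right h2 h0
  · intro h x y
    rw [← inner_sliceLeft]
    calc _ ≤ ‖x‖ * ‖sliceLeft y φ‖ := norm_inner_le_norm _ _
      _ ≤ ‖x‖ * (c * ‖y‖) := by gcongr; exact h y
      _ = _ := by ring

lemma InjLe.smul {φ : HilbertTensor HA HB} {c : ℝ} (h : InjLe φ c) (r : ℂ) :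
    InjLe (r • φ) (‖r‖ * c) := fun x y => by
  rw [inner_smul_right, norm_mul, mul_assoc, mul_assoc, ← mul_assoc c]
  gcongr
  exact h x y

lemma injLe_norm (φ : HilbertTensor HA HB) : InjLe φ ‖φ‖ := fun x y => by
  refine (norm_inner_le_norm _ _).trans_eq ?_
  rw [tmulLeft_apply, UniformSpace.Completion.norm_coe, TensorProduct.norm_tmul]
  ring

/-- Product vectors are total in the Hilbert space tensor product. -/
lemma eq_zero_of_injLe_zero {φ : HilbertTensor HA HB} (h : InjLe φ 0) : φ = 0 :=
  ext_inner_tmul fun x y => by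
    have := h x y
    rw [zero_mul, zero_mul, norm_le_zero_iff] at this
    rw [this, inner_zero_right]

lemma norm_apply_eq_of_star_mul_self {H : Type*} [NormedAddCommGroup H] [InnerProductSpace ℂ H]
    [CompleteSpace H] {T : H →L[ℂ] H} {v : H} (h : (star T * T) v = v) : ‖T v‖ = ‖v‖ := by
  have h1 : inner ℂ (T v) (T v) = inner ℂ v v := by
    rw [← ContinuousLinearMap.adjoint_inner_right, ← ContinuousLinearMap.star_eq_adjoint,
      ← mul_apply_eq_comp, h]
  rw [inner_self_eq_norm_sq_to_K, inner_self_eq_norm_sq_to_K] at h1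
  have h2 : ‖T v‖ ^ 2 = ‖v‖ ^ 2 := by exact_mod_cast h1
  exact (sq_eq_sq₀ (norm_nonneg _) (norm_nonneg _)).mp h2

/-- `T` need not be an isometry: if `star T * T` fixes `φ`, then it fixes every slice of `φ`, so `T`
preserves the norms of the slices. -/
lemma InjLe.rightOp_apply {φ : HilbertTensor HA HB} {c : ℝ} (hc : 0 ≤ c) (h : InjLe φ c)
    {T : HB →L[ℂ] HB} (hT : rightOp HA (star T * T) φ = φ) : InjLe (rightOp HA T φ) c := by
  rw [injLe_iff_right hc] at h ⊢
  intro x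
  rw [sliceRight_rightOp, norm_apply_eq_of_star_mul_self]
  · exact h x
  · rw [← sliceRight_rightOp, hT]

lemma InjLe.leftOp_apply {φ : HilbertTensor HA HB} {c : ℝ} (hc : 0 ≤ c) (h : InjLe φ c)
    {T : HA →L[ℂ] HA} (hT : leftOp HB (star T * T) φ = φ) : InjLe (leftOp HB T φ) c := by
  rw [injLe_iff_left hc] at h ⊢
  intro y
  rw [sliceLeft_leftOp, norm_apply_eq_of_star_mul_self]
  · exact h y
  · rw [← sliceLeft_leftOp, hT]

/-- The injective norm of a sum of two vectors that are orthogonal block by block is the maximum of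
the two injective norms. -/
lemma InjLe.add_of_blocks {φ χ : HilbertTensor HA HB} {c : ℝ} (hc : 0 ≤ c)
    (hφ : InjLe φ c) (hχ : InjLe χ c) {P P' : HA →L[ℂ] HA} {Q Q' : HB →L[ℂ] HB}
    (hQ : IsStarProjection Q) (hQ' : IsStarProjection Q') (hQQ' : Q * Q' = 0)
    (hQφ : rightOp HA Q φ = φ) (hQχ : rightOp HA Q' χ = χ)
    (hPφ : leftOp HB P φ = φ) (hPχ : leftOp HB P' χ = χ)
    (hPP' : leftOp HB (star P * P') χ = 0) : InjLe (φ + χ) c := by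
  rw [injLe_iff_left hc] at *
  intro y
  -- The slices are orthogonal because of Alice's supports; `hQy` below is the same fact on Bob's
  -- side, and Pythagoras is used on both.
  have hortho : inner ℂ (sliceLeft y φ) (sliceLeft y χ) = 0 := by
    rw [← hPφ, sliceLeft_leftOp, ← hPχ, sliceLeft_leftOp,
      ← ContinuousLinearMap.adjoint_inner_right, ← ContinuousLinearMap.star_eq_adjoint,
      ← mul_apply_eq_comp, ← sliceLeft_leftOp, hPP', map_zero, inner_zero_right]
  have h1 : ‖sliceLeft y φ‖ ≤ c * ‖Q y‖ := by
    rw [← hQφ, sliceLeft_rightOp, ← ContinuousLinearMap.star_eq_adjoint,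
      hQ.isSelfAdjoint.star_eq]
    exact hφ _
  have h2 : ‖sliceLeft y χ‖ ≤ c * ‖Q' y‖ := by
    rw [← hQχ, sliceLeft_rightOp, ← ContinuousLinearMap.star_eq_adjoint,
      hQ'.isSelfAdjoint.star_eq]
    exact hχ _
  have hQy : inner ℂ (Q y) (Q' y) = 0 := by
    rw [← ContinuousLinearMap.adjoint_inner_right, ← ContinuousLinearMap.star_eq_adjoint,
      hQ.isSelfAdjoint.star_eq, ← mul_apply_eq_comp, hQQ']
    simp
  have hE : IsStarProjection (Q + Q') := hQ.add hQ' hQQ'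
  have h3 : ‖(Q + Q') y‖ ≤ ‖y‖ := by
    have h := norm_inner_le_norm (𝕜 := ℂ) y ((Q + Q') y)
    have h' : inner ℂ y ((Q + Q') y) = inner ℂ ((Q + Q') y) ((Q + Q') y) := by
      rw [← ContinuousLinearMap.adjoint_inner_right (Q + Q'),
        ← ContinuousLinearMap.star_eq_adjoint, hE.isSelfAdjoint.star_eq,
        ← mul_apply_eq_comp, hE.isIdempotentElem.eq]
    rw [h', inner_self_eq_norm_sq_to_K] at h
    have h2 : ‖(Q + Q') y‖ ^ 2 ≤ ‖y‖ * ‖(Q + Q') y‖ := by simpa using h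
    rcases (norm_nonneg ((Q + Q') y)).eq_or_lt with h0 | h0
    · rw [← h0]; positivity
    · rw [sq] at h2; exact le_of_mul_le_mul_right h2 h0
  have h4 : ‖(Q + Q') y‖ ^ 2 = ‖Q y‖ ^ 2 + ‖Q' y‖ ^ 2 := by
    have := norm_add_sq (𝕜 := ℂ) (Q y) (Q' y)
    rw [hQy] at this
    simpa using this
  have h5 : ‖sliceLeft y (φ + χ)‖ ^ 2 = ‖sliceLeft y φ‖ ^ 2 + ‖sliceLeft y χ‖ ^ 2 := by
    have := norm_add_sq (𝕜 := ℂ) (sliceLeft y φ) (sliceLeft y χ)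
    rw [hortho] at this
    simpa using this
  refine (sq_le_sq₀ (norm_nonneg _) (by positivity)).mp ?_
  calc _ ≤ (c * ‖Q y‖) ^ 2 + (c * ‖Q' y‖) ^ 2 := by rw [h5]; gcongr
    _ = c ^ 2 * ‖(Q + Q') y‖ ^ 2 := by rw [h4]; ring
    _ ≤ c ^ 2 * ‖y‖ ^ 2 := by gcongr
    _ = _ := by ring

end HilbertTensor


/-! ### The algebra of the SATWAP observables -/

section SatwapAlgebra

variable {R : Type*} [Ring R] [Algebra ℂ R] {z c : R}

/-- The relations that the two unitaries `z` and `c` of order three satisfy on the support of a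
state with the SATWAP correlation. -/
structure SatwapRel (z c : R) : Prop where
  z_cube : z * z * z = 1
  c_cube : c * c * c = -1
  anticomm : z * c + c * z = z * z + c * c
  anticomm_sq : z * z * (c * c) + c * c * (z * z) = c - z

lemma SatwapRel.sq_zero (h : SatwapRel z c) : (z - c) * (z - c) = 0 := by
  have := h.anticomm
  linear_combination (norm := noncomm_ring) (-1 : ℤ) • this

/-- With `n = z - c`, expanding `c³ = -1` shows that `y = n z n` commutes with `z`. The element `z²
+ c²` squares to zero, yet on `y` it acts as multiplication by `2 z²`; since `z` is invertible, `y =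
0`. -/
lemma SatwapRel.sandwich (h : SatwapRel z c) : (z - c) * z * (z - c) = 0 := by
  have hz := h.z_cube
  have hn := h.sq_zero
  have hc := h.c_cube
  -- The square is `z⁴ + (c - z) + c⁴`, with `z⁴ = z` and `c⁴ = -c`.
  have hM : (z * z + c * c) * (z * z + c * c) = 0 := by
    have h1 : (z * z + c * c) * (z * z + c * c) = (z * z * z) * z +
      (z * z * (c * c) + c * c * (z * z)) + (c * c * c) * c := by noncomm_ring
    rw [h1, hz, h.anticomm_sq, hc]; noncomm_ring
  obtain ⟨n, rfl⟩ : ∃ n, c = z - n := ⟨z - c, by abel⟩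
  simp only [sub_sub_cancel] at hn ⊢
  have e1 : z * z * n + z * n * z + n * z * z = 2 + n * z * n := by
    have e : (z - n) * (z - n) * (z - n) = z * z * z - (z * z * n + z * n * z + n * z * z)
      + z * (n * n) + n * z * n + (n * n) * z - (n * n) * n := by noncomm_ring
    rw [e, hn, hz] at hc
    have h2 : (2 : R) = 1 + 1 := one_add_one_eq_two.symm
    rw [h2]
    linear_combination (norm := noncomm_ring) (-1 : ℤ) • hc
  have e2 : n * z * z * n + n * z * n * z = 2 * n := by
    have e := congrArg (n * ·) e1
    have e' : n * (z * z * n + z * n * z + n * z * z) =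
      n * z * z * n + n * z * n * z + n * n * z * z := by noncomm_ring
    have e'' : n * (2 + n * z * n) = 2 * n + n * n * z * n := by noncomm_ring
    simp only [e', e'', hn, zero_mul, add_zero] at e
    exact e
  have e3 : z * (n * z * n) + n * z * z * n = 2 * n := by
    have e := congrArg (· * n) e1
    have e' : (z * z * n + z * n * z + n * z * z) * n =
      z * z * (n * n) + z * (n * z * n) + n * z * z * n := by noncomm_ring
    have e'' : (2 + n * z * n) * n = 2 * n + n * z * (n * n) := by noncomm_ring
    simp only [e', e'', hn, mul_zero, add_zero, zero_add] at e
    exact e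
  obtain ⟨y, hy⟩ : ∃ y, y = n * z * n := ⟨_, rfl⟩
  rw [← hy] at e1 e2 e3 ⊢
  -- `e2` and `e3` are `e1` multiplied by `n` from the left and from the right; they have the same
  -- right-hand side.
  have yz : z * y = y * z := by
    have := e3.trans e2.symm
    rw [add_comm (n * z * z * n)] at this
    exact add_right_cancel this
  have ny : n * y = 0 := by rw [hy, ← mul_assoc, ← mul_assoc, hn, zero_mul, zero_mul]
  have hMy : (z * z + (z - n) * (z - n)) * y = 2 * (y * z * z) := by
    have e : (z * z + (z - n) * (z - n)) * y = 2 * (z * (z * y)) - z * (n * y) - n * (z * y)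
      + n * (n * y) := by noncomm_ring
    rw [e, yz, ← mul_assoc n y, ny, ← mul_assoc z y, yz]; simp
  have h4 : (4 : ℂ) • y = 0 := by
    have e := congrArg (· * y) hM
    simp only [zero_mul] at e
    rw [mul_assoc, hMy] at e
    have e' : (z * z + (z - n) * (z - n)) * (2 * (y * z * z)) =
      2 * ((z * z + (z - n) * (z - n)) * y) * (z * z) := by noncomm_ring
    rw [e', hMy] at e
    have e'' : 2 * (2 * (y * z * z)) * (z * z) = 4 * (y * (z * z * z) * z) := by noncomm_ring
    rw [e'', hz, mul_one] at e
    have e3 := congrArg (· * (z * z)) e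
    have e4 : 4 * (y * z) * (z * z) = 4 * (y * (z * z * z)) := by noncomm_ring
    simp only [e4, hz, zero_mul, mul_one] at e3
    rw [← e3, ← map_ofNat (algebraMap ℂ R) 4, Algebra.smul_def]
  simpa using h4

/-- The projection `J` in terms of the two observables. -/
def satwapJ (z c : R) : R := (1 / 2 : ℂ) • (1 - c * (z * z))

/-- The spectral projection of `z` for the eigenvalue `η⁻¹`. -/
def cubeProj (η : ℂ) (z : R) : R := (1 / 3 : ℂ) • (1 + η • z + η ^ 2 • (z * z))

/-- Expand `(z - n)³ = -1`: each term with two factors `n` or more contains `n²` or `n z n` and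
vanishes. -/
lemma SatwapRel.sum_eq_two (h : SatwapRel z c) :
    z * z * (z - c) + z * (z - c) * z + (z - c) * z * z = 2 := by
  have hz := h.z_cube
  have hn := h.sq_zero
  have hy := h.sandwich
  have hc := h.c_cube
  obtain ⟨n, rfl⟩ : ∃ n, c = z - n := ⟨z - c, by abel⟩
  simp only [sub_sub_cancel] at hn hy ⊢
  have e : (z - n) * (z - n) * (z - n) = z * z * z - (z * z * n + z * n * z + n * z * z)
    + z * (n * n) + n * z * n + (n * n) * z - (n * n) * n := by noncomm_ring
  rw [e, hn, hz, hy] at hc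
  have h2 : (2 : R) = 1 + 1 := one_add_one_eq_two.symm
  rw [h2]
  linear_combination (norm := noncomm_ring) (-1 : ℤ) • hc

lemma SatwapRel.sandwich_sq (h : SatwapRel z c) :
    (z - c) * (z * z) * (z - c) = 2 * (z - c) := by
  have e := congrArg ((z - c) * ·) h.sum_eq_two
  have e' : (z - c) * (z * z * (z - c) + z * (z - c) * z + (z - c) * z * z) =
    (z - c) * (z * z) * (z - c) + ((z - c) * z * (z - c)) * z + ((z - c) * (z - c)) * z * z := by
    generalize z - c = n
    noncomm_ring
  simp only [e', h.sandwich, h.sq_zero, zero_mul, add_zero] at e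
  rw [e, two_mul, mul_two]

lemma SatwapRel.satwapJ_eq (h : SatwapRel z c) :
    satwapJ z c = (1 / 2 : ℂ) • ((z - c) * (z * z)) := by
  rw [satwapJ, sub_mul, ← mul_assoc z, h.z_cube]

/-- For `star z = z²` and `star c = -c²` the left-hand side is the adjoint of `satwapJ z c`; this is
what makes `J` self-adjoint on the orbit of the state. -/
lemma SatwapRel.satwapJ_adjoint (h : SatwapRel z c) :
    (1 / 2 : ℂ) • (1 + z * (c * c)) = satwapJ z c := by
  rw [h.satwapJ_eq]
  congr 1
  have hz := h.z_cube
  have hn := h.sq_zero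
  have hs := h.sum_eq_two
  obtain ⟨n, rfl⟩ : ∃ n, c = z - n := ⟨z - c, by abel⟩
  simp only [sub_sub_cancel] at hn hs ⊢
  have e : z * ((z - n) * (z - n)) = z * z * z - z * z * n - z * n * z + z * (n * n) := by
    noncomm_ring
  have h2 : (2 : R) = 1 + 1 := one_add_one_eq_two.symm
  rw [h2] at hs
  rw [e, hz, hn]
  linear_combination (norm := noncomm_ring) (-1 : ℤ) • hs

lemma SatwapRel.satwapJ_mul_self (h : SatwapRel z c) :
    satwapJ z c * satwapJ z c = satwapJ z c := by
  have e : (z - c) * (z * z) * ((z - c) * (z * z)) = (2 : ℂ) • ((z - c) * (z * z)) := by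
    rw [← mul_assoc, h.sandwich_sq, two_smul, two_mul, add_mul]
  rw [h.satwapJ_eq, smul_mul_smul_comm, e, smul_smul]
  norm_num

/-- Here and in the next lemma `J` is seen to be unbiased with respect to the eigenspaces of `z`: in
`J z^k J` the middle powers of `z` collapse to `n²` or `n z n`. -/
lemma SatwapRel.satwapJ_mul_z_mul (h : SatwapRel z c) :
    satwapJ z c * (z * satwapJ z c) = 0 := by
  have e : (z - c) * (z * z) * (z * ((z - c) * (z * z))) = 0 := by
    rw [show (z - c) * (z * z) * (z * ((z - c) * (z * z))) =
      (z - c) * (z * z * z) * (z - c) * (z * z) by simp only [mul_assoc],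
      h.z_cube, mul_one, h.sq_zero, zero_mul]
  rw [h.satwapJ_eq, mul_smul_comm, smul_mul_smul_comm, e, smul_zero]

lemma SatwapRel.satwapJ_mul_zz_mul (h : SatwapRel z c) :
    satwapJ z c * (z * z * satwapJ z c) = 0 := by
  have e : (z - c) * (z * z) * (z * z * ((z - c) * (z * z))) = 0 := by
    rw [show (z - c) * (z * z) * (z * z * ((z - c) * (z * z))) =
      (z - c) * (z * z * z) * z * (z - c) * (z * z) by simp only [mul_assoc],
      h.z_cube, mul_one, h.sandwich, zero_mul]
  rw [h.satwapJ_eq, mul_smul_comm, smul_mul_smul_comm, e, smul_zero]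

/-- By `z³ = 1` this is `SatwapRel.sum_eq_two`, halved. -/
lemma SatwapRel.satwapJ_twirl (h : SatwapRel z c) :
    satwapJ z c + z * satwapJ z c * (z * z) + z * z * satwapJ z c * z = 1 := by
  have e : (z - c) * (z * z) + z * ((z - c) * (z * z)) * (z * z) + z * z * ((z - c) * (z * z)) * z
      = (2 : ℂ) • 1 := by
    have e1 : (z - c) * (z * z) + z * ((z - c) * (z * z)) * (z * z)
        + z * z * ((z - c) * (z * z)) * z = (z - c) * z * z + z * (z - c) * (z * z * z) * z
        + z * z * (z - c) * (z * z * z) := by simp only [mul_assoc]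
    rw [e1, h.z_cube, mul_one, mul_one, add_assoc, add_comm, add_comm (z * (z - c) * z),
      h.sum_eq_two, two_smul, one_add_one_eq_two]
  rw [h.satwapJ_eq]
  simp only [mul_smul_comm, smul_mul_assoc]
  rw [← smul_add, ← smul_add, e, smul_smul]
  norm_num

lemma SatwapRel.satwapJ_mul_cubeProj_mul (h : SatwapRel z c) (η : ℂ) :
    satwapJ z c * (cubeProj η z * satwapJ z c) = (1 / 3 : ℂ) • satwapJ z c := by
  rw [cubeProj]
  simp only [smul_mul_assoc, mul_smul_comm, add_mul, mul_add, one_mul]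
  rw [h.satwapJ_mul_self, h.satwapJ_mul_z_mul, h.satwapJ_mul_zz_mul]
  simp

lemma mul_cubeProj (hz : z * z * z = 1) {η : ℂ} (hη : η ^ 3 = 1) :
    z * cubeProj η z = η ^ 2 • cubeProj η z := by
  have h4 : η ^ 2 * η ^ 2 = η := by linear_combination η * hη
  have h3 : η ^ 2 * η = 1 := by linear_combination hη
  simp only [cubeProj, mul_smul_comm, mul_add, mul_one, ← mul_assoc, hz]
  rw [smul_comm]
  simp only [smul_add, smul_smul, h3, h4, one_smul]
  abel_nf

lemma cubeProj_mul (hz : z * z * z = 1) {η : ℂ} (hη : η ^ 3 = 1) :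
    cubeProj η z * z = η ^ 2 • cubeProj η z := by
  rw [← mul_cubeProj hz hη, cubeProj]
  simp only [smul_mul_assoc, mul_smul_comm, add_mul, mul_add, one_mul, mul_one, mul_assoc]

lemma cubeProj_mul_self (hz : z * z * z = 1) {η : ℂ} (hη : η ^ 3 = 1) :
    cubeProj η z * cubeProj η z = cubeProj η z := by
  have h4 : η ^ 2 * η ^ 2 = η := by linear_combination η * hη
  have h3 : η * η ^ 2 = 1 := by linear_combination hη
  have h5 : η ^ 2 * η = 1 := by linear_combination hη
  nth_rewrite 1 [cubeProj]
  simp only [smul_mul_assoc, add_mul, one_mul, mul_assoc, mul_cubeProj hz hη, mul_smul_comm,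
    smul_smul, h4, h3, h5, one_smul]
  module

lemma SatwapRel.cubeProj_mul_satwapJ_mul (h : SatwapRel z c) {η : ℂ} (hη : η ^ 3 = 1) :
    cubeProj η z * (satwapJ z c * cubeProj η z) = (1 / 3 : ℂ) • cubeProj η z := by
  have hz := h.z_cube
  have h4 : η ^ 2 * η ^ 2 = η := by linear_combination η * hη
  have h5 : η ^ 2 * η = 1 := by linear_combination hη
  -- Between two copies of the eigenprojection, `z` and `z²` become scalars with product `1`, so the
  -- three conjugates of `J` contribute equally.
  have e := congrArg (fun x => cubeProj η z * (x * cubeProj η z)) h.satwapJ_twirl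
  simp only [one_mul, cubeProj_mul_self hz hη, add_mul, mul_add, mul_assoc, mul_cubeProj hz hη,
    mul_smul_comm] at e
  simp only [← mul_assoc (cubeProj η z), cubeProj_mul hz hη] at e
  simp only [smul_mul_assoc, mul_assoc, smul_smul] at e
  simp only [← mul_assoc (cubeProj η z), cubeProj_mul hz hη] at e
  simp only [smul_mul_assoc, mul_assoc, smul_smul] at e
  rw [h4, h5] at e
  conv_rhs => rw [← e]
  module

/-- In the ideal strategy this says that the operators `3 Q_i J Q_k` are partial isometries between
the eigenspaces of `z`. -/
lemma SatwapRel.cubeProj_swap (h : SatwapRel z c) {η : ℂ} (hη : η ^ 3 = 1) (κ : ℂ) :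
    cubeProj η z * (satwapJ z c * (cubeProj κ z * (satwapJ z c * cubeProj η z))) =
      (1 / 9 : ℂ) • cubeProj η z := by
  have e : satwapJ z c * (cubeProj κ z * (satwapJ z c * cubeProj η z)) =
      (1 / 3 : ℂ) • (satwapJ z c * cubeProj η z) := by
    rw [← mul_assoc (cubeProj κ z), ← mul_assoc, h.satwapJ_mul_cubeProj_mul, smul_mul_assoc]
  rw [e, mul_smul_comm, h.cubeProj_mul_satwapJ_mul hη, smul_smul]
  norm_num

end SatwapAlgebra


/-! ### Mirrored operators -/

section Mirror

variable {HA HB : Type}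
  [NormedAddCommGroup HA] [InnerProductSpace ℂ HA] [CompleteSpace HA]
  [NormedAddCommGroup HB] [InnerProductSpace ℂ HB] [CompleteSpace HB]
  {ψ : HilbertTensor HA HB}

/-- `X` on the first factor and `Y` on the second one act on `ψ` in the same way, and so do their
adjoints. -/
structure Mirror (ψ : HilbertTensor HA HB) (X : HA →L[ℂ] HA) (Y : HB →L[ℂ] HB) : Prop where
  apply_eq : leftOp HB X ψ = rightOp HA Y ψ
  star_apply_eq : leftOp HB (star X) ψ = rightOp HA (star Y) ψ

lemma Mirror.one : Mirror ψ 1 1 := ⟨by simp, by simp⟩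

lemma Mirror.add {X X' : HA →L[ℂ] HA} {Y Y' : HB →L[ℂ] HB} (h : Mirror ψ X Y)
    (h' : Mirror ψ X' Y') : Mirror ψ (X + X') (Y + Y') :=
  ⟨by simp [h.apply_eq, h'.apply_eq], by
    simp only [star_add, map_add, add_apply, h.star_apply_eq, h'.star_apply_eq]⟩

lemma Mirror.smul {X : HA →L[ℂ] HA} {Y : HB →L[ℂ] HB} (h : Mirror ψ X Y) (r : ℂ) :
    Mirror ψ (r • X) (r • Y) :=
  ⟨by simp [h.apply_eq], by simp only [star_smul, map_smul, smul_apply, h.star_apply_eq]⟩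

lemma Mirror.sub {X X' : HA →L[ℂ] HA} {Y Y' : HB →L[ℂ] HB} (h : Mirror ψ X Y)
    (h' : Mirror ψ X' Y') : Mirror ψ (X - X') (Y - Y') := by
  simpa [sub_eq_add_neg] using h.add (h'.smul (-1))

lemma Mirror.mul {X X' : HA →L[ℂ] HA} {Y Y' : HB →L[ℂ] HB} (h : Mirror ψ X Y)
    (h' : Mirror ψ X' Y') : Mirror ψ (X * X') (Y' * Y) :=
  ⟨by rw [map_mul, map_mul, mul_apply_eq_comp, mul_apply_eq_comp, h'.apply_eq,
      leftOp_rightOp_comm, h.apply_eq],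
   by rw [star_mul, star_mul, map_mul, map_mul, mul_apply_eq_comp, mul_apply_eq_comp,
      h.star_apply_eq, leftOp_rightOp_comm, h'.star_apply_eq]⟩

lemma Mirror.star {X : HA →L[ℂ] HA} {Y : HB →L[ℂ] HB} (h : Mirror ψ X Y) :
    Mirror ψ (star X) (star Y) :=
  ⟨h.star_apply_eq, by rw [star_star, star_star, h.apply_eq]⟩

variable (ψ) in
/-- The vectors `(X ⊗ 1) ψ`. -/
def leftOrbit : Submodule ℂ (HilbertTensor HA HB) :=
  LinearMap.range ((ContinuousLinearMap.apply ℂ (HilbertTensor HA HB) ψ).toLinearMap ∘ₗ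
    (leftOp HB (HA := HA)).toAlgHom.toLinearMap)

lemma mem_leftOrbit {v : HilbertTensor HA HB} :
    v ∈ leftOrbit ψ ↔ ∃ X, leftOp HB X ψ = v := Iff.rfl

lemma self_mem_leftOrbit : ψ ∈ leftOrbit ψ := mem_leftOrbit.mpr ⟨1, by simp⟩

/-- The action of `1 ⊗ Y` on the vectors `(X ⊗ 1) ψ`, when `Y` has a mirror image. -/
def Mirror.restrict {X : HA →L[ℂ] HA} {Y : HB →L[ℂ] HB} (h : Mirror ψ X Y) :
    Module.End ℂ (leftOrbit ψ) :=
  (rightOp HA Y).toLinearMap.restrict (p := leftOrbit ψ) (q := leftOrbit ψ) (by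
    rintro _ ⟨W, rfl⟩
    refine mem_leftOrbit.mpr ⟨W * X, ?_⟩
    rw [map_mul, mul_apply_eq_comp, h.apply_eq]
    exact leftOp_rightOp_comm _ _ _)

lemma Mirror.coe_restrict {X : HA →L[ℂ] HA} {Y : HB →L[ℂ] HB} (h : Mirror ψ X Y)
    (v : leftOrbit ψ) : (h.restrict v : HilbertTensor HA HB) = rightOp HA Y v := rfl

/-- An operator on Bob's side commutes with each `W ⊗ 1`, so an identity at `ψ` spreads over the
orbit. -/
lemma rightOp_eq_on_leftOrbit {Y Y' : HB →L[ℂ] HB} (h : rightOp HA Y ψ = rightOp HA Y' ψ)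
    (v : leftOrbit ψ) : rightOp HA Y v = rightOp HA Y' v := by
  obtain ⟨v, W, rfl⟩ := v
  have : ∀ Y'' : HB →L[ℂ] HB, rightOp HA Y'' (leftOp HB W ψ) = leftOp HB W (rightOp HA Y'' ψ) :=
    fun Y'' => (leftOp_rightOp_comm _ _ _).symm
  exact (this Y).trans ((congrArg _ h).trans (this Y').symm)

end Mirror

/-! ### The SATWAP relations on the orbit of the state -/

section Satwap

variable {HA HB : Type}
  [NormedAddCommGroup HA] [InnerProductSpace ℂ HA] [CompleteSpace HA]
  [NormedAddCommGroup HB] [InnerProductSpace ℂ HB] [CompleteSpace HB]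
  {ψ : HilbertTensor HA HB}

/-- The relations between the observables of the two parties that follow from the SATWAP
correlation: `z` and `c` are Bob's observables, up to a phase, and `x`, `y` their mirror images. -/
structure SatwapMirror (ψ : HilbertTensor HA HB) (x y : HA →L[ℂ] HA) (z c : HB →L[ℂ] HB) :
    Prop where
  mirror_z : Mirror ψ x z
  mirror_c : Mirror ψ y c
  z_cube : z * z * z = 1
  c_cube : c * c * c = -1
  star_z : star z = z * z
  star_c : star c = -(c * c)
  anticomm : rightOp HA (z * c + c * z) ψ = rightOp HA (z * z + c * c) ψ
  anticomm_sq : rightOp HA (z * z * (c * c) + c * c * (z * z)) ψ = rightOp HA (c - z) ψ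

variable {x y : HA →L[ℂ] HA} {z c : HB →L[ℂ] HB}

/-- The two mixed relations are known only at `ψ`. They become operator identities after restriction
to `leftOrbit ψ`, which is invariant because both operators have mirror images; this makes the
algebra above applicable. -/
lemma SatwapMirror.satwapRel (h : SatwapMirror ψ x y z c) :
    SatwapRel h.mirror_z.restrict h.mirror_c.restrict where
  z_cube := by
    ext v
    simp only [Module.End.mul_apply, Module.End.one_apply, Mirror.coe_restrict,
      ← mul_apply_eq_comp, ← map_mul, ← mul_assoc]
    simp [h.z_cube]
  c_cube := by
    ext v
    simp only [Module.End.mul_apply, Mirror.coe_restrict,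
      ← mul_apply_eq_comp, ← map_mul, ← mul_assoc]
    simp [h.c_cube]
  anticomm := by
    ext v
    simpa [Mirror.coe_restrict] using rightOp_eq_on_leftOrbit h.anticomm v
  anticomm_sq := by
    ext v
    simpa [Mirror.coe_restrict] using rightOp_eq_on_leftOrbit h.anticomm_sq v

lemma SatwapMirror.coe_cubeProj (h : SatwapMirror ψ x y z c) (η : ℂ) (v : leftOrbit ψ) :
    (cubeProj η h.mirror_z.restrict v : HilbertTensor HA HB) = rightOp HA (cubeProj η z) v := by
  simp [cubeProj, Mirror.coe_restrict]

lemma SatwapMirror.coe_satwapJ (h : SatwapMirror ψ x y z c) (v : leftOrbit ψ) :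
    (satwapJ h.mirror_z.restrict h.mirror_c.restrict v : HilbertTensor HA HB) =
      rightOp HA (satwapJ z c) v := by
  simp [satwapJ, Mirror.coe_restrict]

lemma SatwapMirror.swap (h : SatwapMirror ψ x y z c) {η : ℂ} (hη : η ^ 3 = 1) (κ : ℂ) :
    rightOp HA (cubeProj η z * (satwapJ z c * (cubeProj κ z * (satwapJ z c * cubeProj η z)))) ψ =
      (1 / 9 : ℂ) • rightOp HA (cubeProj η z) ψ := by
  have e := congrArg (fun T => (T ⟨ψ, self_mem_leftOrbit⟩ : HilbertTensor HA HB))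
    (h.satwapRel.cubeProj_swap hη κ)
  simpa only [Module.End.mul_apply, LinearMap.smul_apply, Submodule.coe_smul, h.coe_cubeProj,
    h.coe_satwapJ, ← mul_apply_eq_comp, ← map_mul] using e

lemma SatwapMirror.star_satwapJ (h : SatwapMirror ψ x y z c) (v : leftOrbit ψ) :
    rightOp HA (star (satwapJ z c)) v = rightOp HA (satwapJ z c) v := by
  have e := congrArg (fun T => (T v : HilbertTensor HA HB)) h.satwapRel.satwapJ_adjoint
  have e' : star (satwapJ z c) = (1 / 2 : ℂ) • (1 + z * (c * c)) := by
    have hzz : star (z * z) = z := by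
      rw [star_mul, h.star_z, ← mul_assoc, h.z_cube, one_mul]
    rw [satwapJ, star_smul, star_sub, star_mul, hzz, h.star_c, star_one, mul_neg, sub_neg_eq_add]
    simp
  rw [e', ← h.coe_satwapJ, ← e]
  simp [Mirror.coe_restrict]

lemma star_cubeProj (hz : z * z * z = 1) (hs : star z = z * z) {η : ℂ} (hη : star η = η ^ 2)
    (hη3 : η ^ 3 = 1) : star (cubeProj η z) = cubeProj η z := by
  have hzz : star (z * z) = z := by
    rw [star_mul, hs, ← mul_assoc, hz, one_mul]
  have h1 : star (η ^ 2) = η := by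
    rw [star_pow, hη]; linear_combination η * hη3
  simp only [cubeProj, star_smul, star_add, star_one, hs, hzz, hη, h1]
  simp
  abel

end Satwap


/-! ### Local transport between the three blocks of the state -/

section Satwap

variable {HA HB : Type}
  [NormedAddCommGroup HA] [InnerProductSpace ℂ HA] [CompleteSpace HA]
  [NormedAddCommGroup HB] [InnerProductSpace ℂ HB] [CompleteSpace HB]
  {ψ : HilbertTensor HA HB}
  {x y : HA →L[ℂ] HA} {z c : HB →L[ℂ] HB}

lemma Mirror.mem_leftOrbit {X : HA →L[ℂ] HA} {Y : HB →L[ℂ] HB} (h : Mirror ψ X Y) :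
    rightOp HA Y ψ ∈ leftOrbit ψ := QuantumCorrelation.mem_leftOrbit.mpr ⟨X, h.apply_eq⟩

lemma SatwapMirror.exists_mirror_cubeProj (h : SatwapMirror ψ x y z c) (η : ℂ) :
    ∃ X, Mirror ψ X (cubeProj η z) :=
  ⟨_, ((Mirror.one.add (h.mirror_z.smul η)).add ((h.mirror_z.mul h.mirror_z).smul (η ^ 2))).smul _⟩

lemma SatwapMirror.exists_mirror_satwapJ (h : SatwapMirror ψ x y z c) :
    ∃ X, Mirror ψ X (satwapJ z c) :=
  ⟨_, (Mirror.one.sub ((h.mirror_z.mul h.mirror_z).mul h.mirror_c)).smul _⟩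

/-- `η` is a cube root of unity. -/
structure IsCubeRoot (η : ℂ) : Prop where
  cube : η ^ 3 = 1
  star_eq : star η = η ^ 2

/-- The operator that carries the eigenspace of `η⁻¹` to that of `κ⁻¹`. -/
def cubeSwap (κ η : ℂ) (z c : HB →L[ℂ] HB) : HB →L[ℂ] HB :=
  (3 : ℂ) • (cubeProj κ z * (satwapJ z c * cubeProj η z))

lemma SatwapMirror.exists_mirror_cubeSwap (h : SatwapMirror ψ x y z c) (κ η : ℂ) :
    ∃ X, Mirror ψ X (cubeSwap κ η z c) := by
  obtain ⟨p, hp⟩ := h.exists_mirror_cubeProj κ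
  obtain ⟨q, hq⟩ := h.exists_mirror_cubeProj η
  obtain ⟨j, hj⟩ := h.exists_mirror_satwapJ
  exact ⟨_, ((hq.mul hj).mul hp).smul 3⟩

/-- The eigenprojections are self-adjoint on the whole space, `J` only on the orbit; hence the
restriction to vectors of `leftOrbit ψ`. -/
lemma SatwapMirror.star_cubeSwap_apply (h : SatwapMirror ψ x y z c) {κ η : ℂ}
    (hκ : IsCubeRoot κ) (hη : IsCubeRoot η) (v : leftOrbit ψ) :
    rightOp HA (star (cubeSwap κ η z c)) v = rightOp HA (cubeSwap η κ z c) v := by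
  have hv : rightOp HA (cubeProj κ z) (v : HilbertTensor HA HB) ∈ leftOrbit ψ := by
    rw [← h.coe_cubeProj]; exact Subtype.coe_prop _
  have hJ := h.star_satwapJ ⟨_, hv⟩
  simp only at hJ
  rw [cubeSwap, cubeSwap, star_smul, star_mul, star_mul,
    star_cubeProj h.z_cube h.star_z hκ.star_eq hκ.cube,
    star_cubeProj h.z_cube h.star_z hη.star_eq hη.cube, map_smul, map_smul]
  simp only [mul_assoc, map_mul, smul_apply, mul_apply_eq_comp]
  rw [hJ]
  simp

/-- The factor `3` in `cubeSwap` is the one that cancels the `1 / 9` of `SatwapRel.cubeProj_swap`.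
-/
lemma SatwapMirror.cubeSwap_mul (h : SatwapMirror ψ x y z c) {κ η : ℂ}
    (hκ : IsCubeRoot κ) (hη : IsCubeRoot η) :
    rightOp HA (cubeSwap η κ z c * cubeSwap κ η z c) ψ = rightOp HA (cubeProj η z) ψ := by
  have e : cubeSwap η κ z c * cubeSwap κ η z c = (9 : ℂ) •
      (cubeProj η z * (satwapJ z c * (cubeProj κ z * (satwapJ z c * cubeProj η z)))) := by
    rw [cubeSwap, cubeSwap, smul_mul_smul_comm]
    norm_num
    simp only [mul_assoc]
    rw [← mul_assoc (cubeProj κ z) (cubeProj κ z), cubeProj_mul_self h.z_cube hκ.cube]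
  rw [e, map_smul, smul_apply, h.swap hη.cube, smul_smul]
  norm_num

lemma cubeSwap_mul_cubeProj (hz : z * z * z = 1) (κ : ℂ) {η : ℂ} (hη : IsCubeRoot η) :
    cubeSwap κ η z c * cubeProj η z = cubeSwap κ η z c := by
  rw [cubeSwap, smul_mul_assoc]
  simp only [mul_assoc]
  rw [cubeProj_mul_self hz hη.cube]

/-- All three blocks of the state have the same injective norm. -/
lemma SatwapMirror.injLe_block (h : SatwapMirror ψ x y z c) {κ η : ℂ}
    (hκ : IsCubeRoot κ) (hη : IsCubeRoot η) {r : ℝ} (hr : 0 ≤ r)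
    (hle : InjLe (rightOp HA (cubeProj η z) ψ) r) : InjLe (rightOp HA (cubeProj κ z) ψ) r := by
  have hz := h.z_cube
  obtain ⟨X, hX⟩ := h.exists_mirror_cubeSwap η κ
  obtain ⟨W, hW⟩ := h.exists_mirror_cubeSwap κ η
  -- Bob's half of the block is moved to the eigenspace of `κ⁻¹`; Alice's half is still in the old
  -- place.
  have h1 : InjLe (rightOp HA (cubeSwap κ η z c) (rightOp HA (cubeProj η z) ψ)) r := by
    refine hle.rightOp_apply hr ?_
    have e := h.star_cubeSwap_apply hκ hη ⟨_, hW.mem_leftOrbit⟩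
    simp only at e
    rw [← mul_apply_eq_comp, ← map_mul, mul_assoc, cubeSwap_mul_cubeProj hz κ hη, map_mul,
      mul_apply_eq_comp, e, ← mul_apply_eq_comp, ← map_mul, h.cubeSwap_mul hκ hη]
  rw [← mul_apply_eq_comp, ← map_mul, cubeSwap_mul_cubeProj hz κ hη] at h1
  have h2 : leftOp HB (star X * X) ψ = rightOp HA (cubeProj η z) ψ := by
    have e := h.star_cubeSwap_apply hη hκ ⟨ψ, self_mem_leftOrbit⟩
    simp only at e
    rw [map_mul, mul_apply_eq_comp, hX.apply_eq, leftOp_rightOp_comm, hX.star_apply_eq, e,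
      ← mul_apply_eq_comp, ← map_mul, h.cubeSwap_mul hκ hη]
  -- Alice's half follows by the mirror image `X` of the reverse swap. The result is `cubeSwap κ η *
  -- cubeSwap η κ` on Bob's side, which acts on `ψ` as the eigenprojection for `κ`.
  have h3 : InjLe (leftOp HB X (rightOp HA (cubeSwap κ η z c) ψ)) r := by
    refine h1.leftOp_apply hr ?_
    rw [leftOp_rightOp_comm, h2, ← mul_apply_eq_comp, ← map_mul,
      cubeSwap_mul_cubeProj hz κ hη]
  rwa [leftOp_rightOp_comm, hX.apply_eq, ← mul_apply_eq_comp, ← map_mul,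
    h.cubeSwap_mul hη hκ] at h3

lemma isStarProjection_cubeProj (hz : z * z * z = 1) (hs : star z = z * z) {η : ℂ}
    (hη : IsCubeRoot η) : IsStarProjection (cubeProj η z) :=
  ⟨cubeProj_mul_self hz hη.cube, star_cubeProj hz hs hη.star_eq hη.cube⟩

/-- The sum of two blocks of the state has no larger injective norm than a single block. -/
lemma SatwapMirror.injLe_add (h : SatwapMirror ψ x y z c) {κ κ' η : ℂ}
    (hκ : IsCubeRoot κ) (hκ' : IsCubeRoot κ') (hη : IsCubeRoot η)
    (hne : cubeProj κ z * cubeProj κ' z = 0) {r : ℝ} (hr : 0 ≤ r)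
    (hle : InjLe (rightOp HA (cubeProj η z) ψ) r) :
    InjLe (rightOp HA (cubeProj κ z + cubeProj κ' z) ψ) r := by
  obtain ⟨P, hP⟩ := h.exists_mirror_cubeProj κ
  obtain ⟨P', hP'⟩ := h.exists_mirror_cubeProj κ'
  have hQ := isStarProjection_cubeProj h.z_cube h.star_z hκ
  have hQ' := isStarProjection_cubeProj h.z_cube h.star_z hκ'
  have hne' : cubeProj κ' z * cubeProj κ z = 0 := by
    have := congrArg star hne
    rwa [star_mul, hQ.isSelfAdjoint.star_eq, hQ'.isSelfAdjoint.star_eq, star_zero] at this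
  rw [map_add, add_apply]
  -- The mirror images `P`, `P'` of the two eigenprojections show that the blocks are orthogonal on
  -- Alice's side as well.
  refine (h.injLe_block hκ hη hr hle).add_of_blocks hr (h.injLe_block hκ' hη hr hle) (P := P)
    (P' := P') hQ hQ' hne ?_ ?_ ?_ ?_ ?_
  · rw [← mul_apply_eq_comp, ← map_mul, hQ.isIdempotentElem.eq]
  · rw [← mul_apply_eq_comp, ← map_mul, hQ'.isIdempotentElem.eq]
  · rw [leftOp_rightOp_comm, hP.apply_eq, ← mul_apply_eq_comp, ← map_mul,
      hQ.isIdempotentElem.eq]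
  · rw [leftOp_rightOp_comm, hP'.apply_eq, ← mul_apply_eq_comp, ← map_mul,
      hQ'.isIdempotentElem.eq]
  · rw [leftOp_rightOp_comm, map_mul, mul_apply_eq_comp, hP'.apply_eq, leftOp_rightOp_comm,
      hP.star_apply_eq, hQ.isSelfAdjoint.star_eq, ← mul_apply_eq_comp, ← mul_apply_eq_comp,
      ← map_mul, ← map_mul, mul_assoc, hne', mul_zero]
    simp

/-- Solving for `a₁` shows that it is mirrored by `e (z + i c)`. As `a₁` is unitary of order three,
both `a₁* = a₁²` and `(a₁*)² = a₁` can be mirrored; comparing the two sides gives the two mixed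
relations between `z` and `c`. -/
lemma SatwapMirror.of_mirror {a₀ a₁ : HA →L[ℂ] HA} {e : ℂ} (he0 : e ≠ 0)
    (he : star e = (1 + Complex.I) * e ^ 2)
    (ha : star a₁ = a₁ * a₁) (ha3 : a₁ * a₁ * a₁ = 1)
    (hz : Mirror ψ (e • a₀ + star e • a₁) z)
    (hc : Mirror ψ (Complex.I • (e • a₀ - star e • a₁)) c)
    (z_cube : z * z * z = 1) (c_cube : c * c * c = -1)
    (star_z : star z = z * z) (star_c : star c = -(c * c)) :
    SatwapMirror ψ (e • a₀ + star e • a₁) (Complex.I • (e • a₀ - star e • a₁)) z c := by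
  have hI := Complex.I_mul_I
  have he' : e = (1 - Complex.I) * star e ^ 2 := by
    have := congrArg star he
    simpa [sub_eq_add_neg] using this
  have hee : 2 * (e * star e) = 1 := by
    have h1 : star e ^ 2 = e / (1 - Complex.I) := by
      rw [eq_div_iff, mul_comm, ← he']
      intro h0
      apply he0
      rw [he', h0, zero_mul]
    have h2 : (star e) * star e = (1 + Complex.I) * e * (e * star e) := by
      nth_rewrite 1 [he]; ring
    have h3 : e * (2 * (e * star e) - 1) = 0 := by
      linear_combination -he' - (1 - Complex.I) * h2 + e * (e * star e) * hI
    rcases mul_eq_zero.mp h3 with h | h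
    · exact absurd h he0
    · linear_combination h
  have ha₁ : Mirror ψ a₁ (e • (z + Complex.I • c)) := by
    have h1 := (hz.add (hc.smul Complex.I)).smul e
    convert h1 using 1
    have : e • (e • a₀ + star e • a₁ + Complex.I • (Complex.I • (e • a₀ - star e • a₁))) =
      (e * e * (1 + Complex.I * Complex.I)) • a₀ +
        (e * star e * (1 - Complex.I * Complex.I)) • a₁ := by module
    rw [this, hI]
    have h2 : e * star e * (1 - -1) = 1 := by linear_combination hee
    rw [h2]; simp
  have hstar : star (e • (z + Complex.I • c)) = star e • (z * z + Complex.I • (c * c)) := by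
    simp only [star_smul, star_add, star_z, star_c]
    simp
  have hcccc : c * c * (c * c) = -c := by
    rw [← mul_assoc, c_cube, neg_one_mul]
  have hzzzz : z * z * (z * z) = z := by
    rw [← mul_assoc, z_cube, one_mul]
  have h1 := (ha₁.mul ha₁).apply_eq
  rw [← ha, ha₁.star.apply_eq, hstar] at h1
  have h2 := (ha₁.star.mul ha₁.star).apply_eq
  rw [ha, show a₁ * a₁ * (a₁ * a₁) = a₁ by rw [← mul_assoc, ha3, one_mul], ha₁.apply_eq,
    hstar] at h2
  have hse0 : star e ≠ 0 := by simpa using he0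
  refine ⟨hz, hc, z_cube, c_cube, star_z, star_c, ?_, ?_⟩
  · have e1 : e • (z + Complex.I • c) * e • (z + Complex.I • c) =
        (e ^ 2) • (z * z + Complex.I • (z * c + c * z) - c * c) := by
      rw [smul_mul_smul_comm, ← sq]
      congr 1
      have : (z + Complex.I • c) * (z + Complex.I • c) =
          z * z + Complex.I • (z * c + c * z) + (Complex.I * Complex.I) • (c * c) := by
        simp only [add_mul, mul_add, smul_mul_assoc, mul_smul_comm]
        module
      rw [this, hI]
      module
    have e2 : star e • (z * z + Complex.I • (c * c)) =
        e ^ 2 • ((z * z + Complex.I • (z * z + c * c) - c * c)) := by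
      rw [he]
      have : ((1 + Complex.I) * e ^ 2) • (z * z + Complex.I • (c * c)) =
        e ^ 2 • (z * z + Complex.I • (z * z + c * c) + (Complex.I * Complex.I) • (c * c)) := by
        module
      rw [this, hI]
      module
    rw [e1, e2, map_smul, map_smul, smul_apply, smul_apply] at h1
    have h3 := smul_right_injective _ (pow_ne_zero 2 he0) h1
    simp only [map_add, map_sub, map_smul, add_apply, sub_apply, smul_apply] at h3 ⊢
    have h4 := add_left_cancel (sub_left_inj.mp h3)
    exact (smul_right_injective _ Complex.I_ne_zero h4).symm
  · have e1 : star e • (z * z + Complex.I • (c * c)) * star e • (z * z + Complex.I • (c * c)) =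
        (star e ^ 2) • (z + c + Complex.I • (z * z * (c * c) + c * c * (z * z))) := by
      rw [smul_mul_smul_comm, ← sq]
      congr 1
      have : (z * z + Complex.I • (c * c)) * (z * z + Complex.I • (c * c)) =
          z + Complex.I • (z * z * (c * c) + c * c * (z * z)) -
            (Complex.I * Complex.I) • c := by
        simp only [add_mul, mul_add, smul_mul_assoc, mul_smul_comm, hcccc, hzzzz]
        module
      rw [this, hI]
      module
    have e2 : e • (z + Complex.I • c) =
        star e ^ 2 • (z + c + Complex.I • (c - z)) := by
      nth_rewrite 1 [he']
      have : ((1 - Complex.I) * star e ^ 2) • (z + Complex.I • c) =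
        star e ^ 2 • (z - (Complex.I * Complex.I) • c + Complex.I • (c - z)) := by
        module
      rw [this, hI]
      module
    rw [e1, e2, map_smul, map_smul, smul_apply, smul_apply] at h2
    have h3 := smul_right_injective _ (pow_ne_zero 2 hse0) h2
    simp only [map_add, map_sub, map_smul, add_apply, sub_apply, smul_apply] at h3 ⊢
    have h4 := add_left_cancel h3
    exact (smul_right_injective _ Complex.I_ne_zero h4).symm

end Satwap

/-- The two squared distances add up to `1 - 2 + ‖u₀ + u₁‖² + 1 - 2 + ‖u₀ - u₁‖²`, and this is `0`
by the parallelogram law. This is the extremality of the SATWAP values. -/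
lemma eq_add_of_inner {H : Type*} [NormedAddCommGroup H] [InnerProductSpace ℂ H]
    {v₀ v₁ u₀ u₁ : H} (hv₀ : ‖v₀‖ ^ 2 = 1) (hv₁ : ‖v₁‖ ^ 2 = 1) (hu₀ : ‖u₀‖ ^ 2 = 1 / 2)
    (hu₁ : ‖u₁‖ ^ 2 = 1 / 2) (h00 : (inner ℂ v₀ u₀).re = 1 / 2)
    (h01 : (inner ℂ v₀ u₁).re = 1 / 2) (h10 : (inner ℂ v₁ (Complex.I • u₀)).re = 1 / 2)
    (h11 : (inner ℂ v₁ (-Complex.I • u₁)).re = 1 / 2) :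
    v₀ = u₀ + u₁ ∧ v₁ = Complex.I • (u₀ - u₁) := by
  have h0 := norm_sub_sq (𝕜 := ℂ) v₀ (u₀ + u₁)
  have h1 := norm_sub_sq (𝕜 := ℂ) v₁ (Complex.I • (u₀ - u₁))
  have hp := parallelogram_law_with_norm ℂ u₀ u₁
  rw [norm_smul, Complex.norm_I, one_mul] at h1
  have e1 : Complex.I • (u₀ - u₁) = Complex.I • u₀ + -Complex.I • u₁ := by module
  have h1' : RCLike.re (inner ℂ v₁ (Complex.I • (u₀ - u₁))) = 1 := by
    rw [e1, inner_add_right, map_add]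
    simp only [RCLike.re_eq_complex_re, h10, h11]; norm_num
  have h0' : RCLike.re (inner ℂ v₀ (u₀ + u₁)) = 1 := by
    rw [inner_add_right, map_add]
    simp only [RCLike.re_eq_complex_re, h00, h01]; norm_num
  rw [h0'] at h0
  rw [h1'] at h1
  have hs : ‖v₀ - (u₀ + u₁)‖ ^ 2 + ‖v₁ - Complex.I • (u₀ - u₁)‖ ^ 2 = 0 := by
    rw [h0, h1]; nlinarith
  have n₀ := sq_nonneg ‖v₀ - (u₀ + u₁)‖
  have n₁ := sq_nonneg ‖v₁ - Complex.I • (u₀ - u₁)‖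
  constructor
  · have : ‖v₀ - (u₀ + u₁)‖ ^ 2 = 0 := by linarith
    exact sub_eq_zero.mp (norm_eq_zero.mp (pow_eq_zero_iff two_ne_zero |>.mp this))
  · have : ‖v₁ - Complex.I • (u₀ - u₁)‖ ^ 2 = 0 := by linarith
    exact sub_eq_zero.mp (norm_eq_zero.mp (pow_eq_zero_iff two_ne_zero |>.mp this))


/-! ### The algebra of the tilted CHSH observables -/

section Tilted

/-- A sum-of-squares certificate for the tilted CHSH operator, scaled by `√17`: `144 = 4 + 4 + 68 +
68`, while the terms linear in `s` or `d` and the anticommutator `s d + d s` drop out. -/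
lemma tilted_sum_of_squares {R : Type*} [Ring R] {a₀ a₁ s d : R} (ha₀ : a₀ * a₀ = 1)
    (ha₁ : a₁ * a₁ = 1) (h0s : s * a₀ = a₀ * s) (h1s : s * a₁ = a₁ * s)
    (h0d : d * a₀ = a₀ * d) (h1d : d * a₁ = a₁ * d) (hsd : s * d + d * s = 0)
    (hss : s * s + d * d = 68) :
    (2 * a₀ + a₀ * s + a₁ * d) * (2 * a₀ + a₀ * s + a₁ * d) +
      (2 * a₁ - a₀ * d - a₁ * s) * (2 * a₁ - a₀ * d - a₁ * s) = 144 := by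
  have e : (2 * a₀ + a₀ * s + a₁ * d) * (2 * a₀ + a₀ * s + a₁ * d) +
      (2 * a₁ - a₀ * d - a₁ * s) * (2 * a₁ - a₀ * d - a₁ * s) =
      4 * (a₀ * a₀) + 4 * (a₁ * a₁)
      + 2 * (a₀ * a₀ * s) + 2 * (a₀ * (s * a₀)) - 2 * (a₁ * a₁ * s) - 2 * (a₁ * (s * a₁))
      + 2 * (a₀ * a₁ * d) + 2 * (a₁ * (d * a₀)) - 2 * (a₁ * a₀ * d) - 2 * (a₀ * (d * a₁))
      + a₀ * (s * a₀) * s + a₁ * (d * a₁) * d + a₀ * (d * a₀) * d + a₁ * (s * a₁) * s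
      + a₀ * (s * a₁) * d + a₁ * (d * a₀) * s + a₀ * (d * a₁) * s + a₁ * (s * a₀) * d := by
    noncomm_ring
  have e' : 4 * (a₀ * a₀) + 4 * (a₁ * a₁)
      + 2 * (a₀ * a₀ * s) + 2 * (a₀ * (a₀ * s)) - 2 * (a₁ * a₁ * s) - 2 * (a₁ * (a₁ * s))
      + 2 * (a₀ * a₁ * d) + 2 * (a₁ * (a₀ * d)) - 2 * (a₁ * a₀ * d) - 2 * (a₀ * (a₁ * d))
      + a₀ * (a₀ * s) * s + a₁ * (a₁ * d) * d + a₀ * (a₀ * d) * d + a₁ * (a₁ * s) * s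
      + a₀ * (a₁ * s) * d + a₁ * (a₀ * d) * s + a₀ * (a₁ * d) * s + a₁ * (a₀ * s) * d =
      4 * (a₀ * a₀) + 4 * (a₁ * a₁)
      + 4 * (a₀ * a₀ * s) - 4 * (a₁ * a₁ * s) + (a₀ * a₀) * (s * s + d * d)
      + (a₁ * a₁) * (s * s + d * d) + (a₀ * a₁) * (s * d + d * s)
      + (a₁ * a₀) * (s * d + d * s) := by
    noncomm_ring
  rw [e, h0s, h1s, h0d, h1d, e', ha₀, ha₁, hsd, hss]
  norm_num

variable {H : Type*} [NormedAddCommGroup H] [InnerProductSpace ℂ H] [CompleteSpace H]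

lemma re_inner_mul_self {T : H →L[ℂ] H} (hT : IsSelfAdjoint T) (v : H) :
    (inner ℂ v ((T * T) v)).re = ‖T v‖ ^ 2 := by
  rw [mul_apply_eq_comp, ← hT.star_eq, ContinuousLinearMap.star_eq_adjoint,
    ContinuousLinearMap.adjoint_inner_right, ← ContinuousLinearMap.star_eq_adjoint, hT.star_eq,
    inner_self_eq_norm_sq_to_K]
  norm_cast

lemma norm_apply_of_sq_eq_one {T : H →L[ℂ] H} (hT : IsSelfAdjoint T) (h : T * T = 1) (v : H) :
    ‖T v‖ = ‖v‖ :=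
  norm_apply_eq_of_star_mul_self (by rw [hT.star_eq, h]; rfl)

lemma norm_sub_smul_sq (v w : H) (r : ℝ) {c : ℂ} (hc : (r : ℂ) = c) :
    ‖v - c • w‖ ^ 2 = ‖v‖ ^ 2 - 2 * (r * (inner ℂ w v).re) + r ^ 2 * ‖w‖ ^ 2 := by
  have h := norm_sub_sq (𝕜 := ℂ) v (c • w)
  rw [inner_smul_right, ← inner_conj_symm, norm_smul, ← hc, Complex.norm_real] at h
  rw [← hc, h]
  simp only [RCLike.re_eq_complex_re, Complex.re_ofReal_mul, Complex.conj_re, mul_pow,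
    Real.norm_eq_abs, sq_abs]

/-- A state with the expectation values of the tilted CHSH correlation satisfies the relations of
the ideal strategy. -/
lemma tilted_relations {ψ : H} (hψ : ‖ψ‖ = 1) {a₀ a₁ s d : H →L[ℂ] H}
    (sa₀ : IsSelfAdjoint a₀) (sa₁ : IsSelfAdjoint a₁) (ss : IsSelfAdjoint s)
    (sd : IsSelfAdjoint d) (ha₀ : a₀ * a₀ = 1)
    (ha₁ : a₁ * a₁ = 1) (h0s : s * a₀ = a₀ * s) (h1s : s * a₁ = a₁ * s)
    (h0d : d * a₀ = a₀ * d) (h1d : d * a₁ = a₁ * d) (hsd : s * d + d * s = 0)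
    (hss : s * s + d * d = 68)
    (v0 : (inner ℂ ψ (a₀ ψ)).re = 1 / 3) (vs : (inner ℂ ψ (s ψ)).re = 2)
    (v0s : (inner ℂ ψ (a₀ (s ψ))).re = 6) (v1d : (inner ℂ ψ (a₁ (d ψ))).re = 16 / 3) :
    d (d ψ) = (32 : ℂ) • ψ ∧ a₁ (d (ψ + a₀ ψ)) = (8 : ℂ) • (ψ - a₀ ψ) := by
  have hsum := tilted_sum_of_squares ha₀ ha₁ h0s h1s h0d h1d hsd hss
  have hcomm : ∀ {x y : H →L[ℂ] H} (_ : x * y = y * x) (v : H), x (y v) = y (x v) :=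
    fun h v => DFunLike.congr_fun h v
  set I := 2 * a₀ + a₀ * s + a₁ * d with hI
  set Y := 2 * a₁ - a₀ * d - a₁ * s with hY
  have sI : IsSelfAdjoint I := by
    rw [hI, isSelfAdjoint_iff, two_mul]
    simp only [star_add, star_mul, sa₀.star_eq, sa₁.star_eq, ss.star_eq, sd.star_eq, h0s, h1d]
  have sY : IsSelfAdjoint Y := by
    rw [hY, isSelfAdjoint_iff, two_mul]
    simp only [star_add, star_sub, star_mul, sa₀.star_eq, sa₁.star_eq, ss.star_eq, sd.star_eq,
      h0d, h1s]
  have hIψ : I ψ = (2 : ℂ) • a₀ ψ + a₀ (s ψ) + a₁ (d ψ) := by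
    rw [hI, two_mul, two_smul]; rfl
  have hYψ : Y ψ = (2 : ℂ) • a₁ ψ - a₀ (d ψ) - a₁ (s ψ) := by
    rw [hY, two_mul, two_smul]; rfl
  have n144 : ‖I ψ‖ ^ 2 + ‖Y ψ‖ ^ 2 = 144 := by
    rw [← re_inner_mul_self sI, ← re_inner_mul_self sY, ← Complex.add_re, ← inner_add_right,
      ← add_apply, hsum]
    have : (144 : H →L[ℂ] H) ψ = (144 : ℂ) • ψ := by
      rw [show (144 : H →L[ℂ] H) = (144 : ℂ) • 1 by
        rw [← Algebra.algebraMap_eq_smul_one, map_ofNat]]; rfl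
    rw [this, inner_smul_right, inner_self_eq_norm_sq_to_K, hψ]
    norm_num
  -- `2 / 3 + 6 + 16 / 3 = 12`, the largest value that `I² + Y² = 144` allows; so `ψ` is an
  -- eigenvector of `I` and `Y` kills it.
  have i12 : (inner ℂ ψ (I ψ)).re = 12 := by
    rw [hIψ, inner_add_right, inner_add_right, Complex.add_re, Complex.add_re, inner_smul_right,
      v0s, v1d, Complex.mul_re, v0]
    norm_num
  have hz : ‖I ψ - (12 : ℂ) • ψ‖ ^ 2 + ‖Y ψ‖ ^ 2 = 0 := by
    rw [norm_sub_smul_sq _ _ 12 (by norm_num), i12, hψ]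
    linarith
  have n₀ := sq_nonneg ‖Y ψ‖
  have n₁ := sq_nonneg ‖I ψ - (12 : ℂ) • ψ‖
  have hI12 : I ψ = (12 : ℂ) • ψ := by
    have : ‖I ψ - (12 : ℂ) • ψ‖ ^ 2 = 0 := by linarith
    exact sub_eq_zero.mp (norm_eq_zero.mp (pow_eq_zero_iff two_ne_zero |>.mp this))
  have hY0 : Y ψ = 0 := by
    have : ‖Y ψ‖ ^ 2 = 0 := by linarith
    exact norm_eq_zero.mp (pow_eq_zero_iff two_ne_zero |>.mp this)
  rw [hIψ] at hI12
  rw [hYψ] at hY0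
  have hd : a₀ (d ψ) = a₁ ((2 : ℂ) • ψ - s ψ) := by
    rw [map_sub, map_smul, ← sub_eq_zero, ← neg_eq_zero, ← hY0]; abel
  -- Together with `nsd` below this gives `‖s ψ‖² = 36` and `‖d ψ‖² = 32`; then `⟪a₀ ψ, s ψ⟫` has
  -- real part `6` and Cauchy–Schwarz is saturated, so `s ψ = 6 a₀ ψ`.
  have nd : ‖d ψ‖ ^ 2 = ‖s ψ‖ ^ 2 - 4 := by
    have h1 : ‖d ψ‖ = ‖s ψ - (2 : ℂ) • ψ‖ := by
      rw [← norm_apply_of_sq_eq_one sa₀ ha₀, hd, norm_apply_of_sq_eq_one sa₁ ha₁, norm_sub_rev]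
    rw [h1, norm_sub_smul_sq _ _ 2 (by norm_num), vs, hψ]; ring
  have h68 : ∀ v : H, s (s v) + d (d v) = (68 : ℂ) • v := by
    intro v
    have : (s * s + d * d) v = (68 : ℂ) • v := by
      rw [hss, show (68 : H →L[ℂ] H) = (68 : ℂ) • 1 by
        rw [← Algebra.algebraMap_eq_smul_one, map_ofNat]]; rfl
    exact this
  have nsd : ‖s ψ‖ ^ 2 + ‖d ψ‖ ^ 2 = 68 := by
    rw [← re_inner_mul_self ss, ← re_inner_mul_self sd, ← Complex.add_re, ← inner_add_right,
      mul_apply_eq_comp, mul_apply_eq_comp, h68, inner_smul_right, inner_self_eq_norm_sq_to_K, hψ]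
    norm_num
  have hs6 : s ψ = (6 : ℂ) • a₀ ψ := by
    have h' : inner ℂ (a₀ ψ) (s ψ) = inner ℂ ψ (a₀ (s ψ)) := by
      rw [← ContinuousLinearMap.adjoint_inner_right, ← ContinuousLinearMap.star_eq_adjoint,
        sa₀.star_eq]
    have : ‖s ψ - (6 : ℂ) • a₀ ψ‖ ^ 2 = 0 := by
      rw [norm_sub_smul_sq _ _ 6 (by norm_num), h', v0s, norm_apply_of_sq_eq_one sa₀ ha₀, hψ]
      linarith
    exact sub_eq_zero.mp (norm_eq_zero.mp (pow_eq_zero_iff two_ne_zero |>.mp this))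
  have a00 : ∀ v, a₀ (a₀ v) = v := fun v => DFunLike.congr_fun ha₀ v
  have h1d' : a₁ (d ψ) = (6 : ℂ) • ψ - (2 : ℂ) • a₀ ψ := by
    rw [hs6, map_smul, a00] at hI12
    have : a₁ (d ψ) = (12 : ℂ) • ψ - ((2 : ℂ) • a₀ ψ + (6 : ℂ) • ψ) := by
      rw [← hI12]; abel
    rw [this]; module
  have hss36 : s (s ψ) = (36 : ℂ) • ψ := by
    rw [hs6, map_smul, hcomm h0s, hs6, map_smul, a00, smul_smul]; norm_num
  refine ⟨?_, ?_⟩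
  · have := h68 ψ
    rw [hss36] at this
    have h2 : d (d ψ) = (68 : ℂ) • ψ - (36 : ℂ) • ψ := by rw [← this]; abel
    rw [h2]; module
  -- Since `a₀ ψ` is a multiple of `s ψ` and `d` anticommutes with `s`, the action of `a₁ d` on `a₀
  -- ψ` reduces to its action on `ψ`.
  · have hds : d (s ψ) = -s (d ψ) :=
      eq_neg_of_add_eq_zero_right (DFunLike.congr_fun hsd ψ)
    have ha : a₀ ψ = (1 / 6 : ℂ) • s ψ := by rw [hs6, smul_smul]; norm_num
    have h3 : a₁ (d (a₀ ψ)) = (2 : ℂ) • ψ - (6 : ℂ) • a₀ ψ := by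
      rw [ha, map_smul, hds, map_smul, map_neg, ← hcomm h1s, h1d', map_sub, map_smul, map_smul,
        hcomm h0s, hs6, map_smul, a00]
      module
    rw [map_add, map_add, h1d', h3]
    module

end Tilted

/-! ### The tilted CHSH swap contracts the injective norm -/

section TiltedInjective

variable {HA HB : Type}
  [NormedAddCommGroup HA] [InnerProductSpace ℂ HA] [CompleteSpace HA]
  [NormedAddCommGroup HB] [InnerProductSpace ℂ HB] [CompleteSpace HB]
  {ψ : HilbertTensor HA HB}

/-- After scaling, `d` is isometric on the slices of `ψ + a₀ ψ`, because its square is scalar there,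
and `a₁` is unitary. Their product carries this vector to `√2 (ψ - a₀ ψ)`. -/
lemma injLe_of_tilted_swap {a₀ a₁ : HA →L[ℂ] HA} {d : HB →L[ℂ] HB}
    (sa₁ : IsSelfAdjoint a₁) (sd : IsSelfAdjoint d) (ha₁ : a₁ * a₁ = 1)
    (hdd : rightOp HA d (rightOp HA d ψ) = (32 : ℂ) • ψ)
    (hswap : leftOp HB a₁ (rightOp HA d (ψ + leftOp HB a₀ ψ)) =
      (8 : ℂ) • (ψ - leftOp HB a₀ ψ)) {r : ℝ} (hr : 0 ≤ r)
    (h : InjLe (ψ + leftOp HB a₀ ψ) r) : InjLe (ψ - leftOp HB a₀ ψ) (1 / √2 * r) := by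
  -- `t = 1 / √32`, so that `(t d)²` fixes `ψ`; then `8 t = √2` and `4 t = 1 / √2`.
  obtain ⟨t, ht⟩ : ∃ t : ℂ, t = ((√2 / 8 : ℝ) : ℂ) := ⟨_, rfl⟩
  have ht2 : t * t = 1 / 32 := by
    rw [ht, ← Complex.ofReal_mul, show √2 / 8 * (√2 / 8) = (√2 * √2) / 64 by ring,
      Real.mul_self_sqrt (by norm_num)]
    norm_num
  have hst : star t = t := by rw [ht]; exact Complex.conj_ofReal _
  have h1 : InjLe (rightOp HA (t • d) (ψ + leftOp HB a₀ ψ)) r := by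
    refine h.rightOp_apply hr ?_
    rw [star_smul, sd.star_eq, hst, smul_mul_smul_comm, ht2, map_smul, map_mul, smul_apply,
      mul_apply_eq_comp, map_add, map_add, hdd, ← leftOp_rightOp_comm, ← leftOp_rightOp_comm,
      hdd, map_smul]
    module
  have h2 : InjLe (leftOp HB a₁ (rightOp HA (t • d) (ψ + leftOp HB a₀ ψ))) r := by
    refine h1.leftOp_apply hr ?_
    rw [sa₁.star_eq, ha₁, map_one]; rfl
  have h3 := h2.smul (4 * t)
  rw [map_smul, smul_apply, map_smul, hswap, smul_smul, smul_smul] at h3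
  have e1 : 4 * t * t * 8 = 1 := by linear_combination 32 * ht2
  have e2 : ‖4 * t‖ = 1 / √2 := by
    rw [norm_mul, ht, Complex.norm_real, Real.norm_of_nonneg (by positivity)]
    have := Real.mul_self_sqrt (show (0 : ℝ) ≤ 2 by norm_num)
    field_simp
    norm_num
  rwa [e1, e2, one_smul] at h3

/-- Start from the trivial bound `‖φ‖` and iterate. -/
lemma eq_zero_of_injLe_contract {φ : HilbertTensor HA HB} {r : ℝ} (hr0 : 0 ≤ r) (hr : r < 1)
    (h : ∀ c, 0 ≤ c → InjLe φ c → InjLe φ (r * c)) : φ = 0 := by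
  apply eq_zero_of_injLe_zero
  intro x y
  have hk : ∀ k : ℕ, InjLe φ (r ^ k * ‖φ‖) := by
    intro k
    induction k with
    | zero => simpa using injLe_norm φ
    | succ k ih =>
      rw [pow_succ', mul_assoc]
      exact h _ (by positivity) ih
  have hlim : Filter.Tendsto (fun k : ℕ => r ^ k * ‖φ‖ * ‖x‖ * ‖y‖) Filter.atTop
      (nhds (0 * ‖φ‖ * ‖x‖ * ‖y‖)) :=
    (((tendsto_pow_atTop_nhds_zero_of_lt_one hr0 hr).mul_const _).mul_const _).mul_const _
  rw [zero_mul ‖φ‖] at hlim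
  exact ge_of_tendsto' hlim fun k => hk k x y

end TiltedInjective


/-! ### Unitaries of order three -/

/-- The twelfth root of unity `ω ^ (1 / 4)`, where `ω = exp (2 π i / 3)`. -/
def rootW : ℂ := omegaPow 3 (1 / 4)

/-- `ω = exp (2 π i / 3)`. -/
def om : ℂ := omegaPow 3 1

lemma omegaPow_add (d : ℕ) (x y : ℝ) : omegaPow d (x + y) = omegaPow d x * omegaPow d y := by
  rw [omegaPow, omegaPow, omegaPow, ← Complex.exp_add]
  congr 1
  push_cast
  ring

lemma omegaPow_nat_mul (d n : ℕ) (x : ℝ) : omegaPow d (n * x) = omegaPow d x ^ n := by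
  rw [omegaPow, omegaPow, ← Complex.exp_nat_mul]
  congr 1
  push_cast
  ring

lemma omegaPow_zero (d : ℕ) : omegaPow d 0 = 1 := by simp [omegaPow]

lemma rootW_cube : rootW ^ 3 = Complex.I := by
  have h : ((3 : ℕ) : ℂ) * (2 * Real.pi * Complex.I * ((1 / 4 : ℝ) : ℂ) / (3 : ℕ)) =
      Real.pi / 2 * Complex.I := by push_cast; ring
  rw [rootW, omegaPow, ← Complex.exp_nat_mul, h, Complex.exp_pi_div_two_mul_I]

lemma rootW_re : rootW.re = √3 / 2 := by
  rw [rootW, omegaPow, show (2 * Real.pi * Complex.I * ((1 / 4 : ℝ) : ℂ) / (3 : ℕ) : ℂ) =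
    ((Real.pi / 6 : ℝ) : ℂ) * Complex.I by push_cast; ring, Complex.exp_ofReal_mul_I_re,
    Real.cos_pi_div_six]

lemma rootW_im : rootW.im = 1 / 2 := by
  rw [rootW, omegaPow, show (2 * Real.pi * Complex.I * ((1 / 4 : ℝ) : ℂ) / (3 : ℕ) : ℂ) =
    ((Real.pi / 6 : ℝ) : ℂ) * Complex.I by push_cast; ring, Complex.exp_ofReal_mul_I_im,
    Real.sin_pi_div_six]

/-- The minimal equation of a primitive twelfth root of unity. With `i = w³`, `ω = w² - 1` and
conjugate `w - w³`, the identities for the SATWAP matrices become polynomial identities modulo this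
one. -/
lemma rootW_poly : rootW ^ 4 = rootW ^ 2 - 1 := by
  have h := Real.mul_self_sqrt (show (0 : ℝ) ≤ 3 by norm_num)
  rw [show rootW ^ 4 = rootW ^ 3 * rootW by ring, rootW_cube, sq]
  apply Complex.ext <;> simp [rootW_re, rootW_im]
  · ring_nf; rw [Real.sq_sqrt (by norm_num)]; norm_num
  · ring

lemma conj_rootW : (starRingEnd ℂ) rootW = rootW - rootW ^ 3 := by
  rw [rootW_cube]
  apply Complex.ext <;> simp [rootW_re, rootW_im]
  norm_num

lemma om_eq : om = rootW ^ 2 - 1 := by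
  rw [← rootW_poly, om, rootW, ← omegaPow_nat_mul]; norm_num

lemma om_cube : om ^ 3 = 1 := by
  have := rootW_poly
  rw [om_eq]
  grind

lemma om_sum : 1 + om + om ^ 2 = 0 := by
  have := rootW_poly
  rw [om_eq]
  grind

lemma star_om : star om = om ^ 2 := by
  have := rootW_poly
  have h := conj_rootW
  rw [om_eq, star_sub, star_pow, Complex.star_def, h]
  simp
  grind

lemma omegaPow_neg_nat (n : ℕ) : omegaPow 3 (-n) = om ^ (2 * n) := by
  have h1 : omegaPow 3 (-n) * om ^ n = 1 := by
    rw [om, ← omegaPow_nat_mul, mul_one, ← omegaPow_add, neg_add_cancel, omegaPow_zero]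
  have h2 : om ^ n * om ^ (2 * n) = 1 := by
    rw [← pow_add, show n + 2 * n = 3 * n by ring, pow_mul, om_cube, one_pow]
  calc omegaPow 3 (-n) = omegaPow 3 (-n) * (om ^ n * om ^ (2 * n)) := by rw [h2, mul_one]
    _ = _ := by rw [← mul_assoc, h1, one_mul]

lemma isCubeRoot_om_pow (n : ℕ) : IsCubeRoot (om ^ n) where
  cube := by rw [← pow_mul, mul_comm, pow_mul, om_cube, one_pow]
  star_eq := by rw [star_pow, star_om, ← pow_mul, ← pow_mul, mul_comm]

/-! ### Three-outcome measurements and unitaries of order three -/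

section Spectral

variable {R : Type*} [Ring R] [Algebra ℂ R] [StarRing R] [StarModule ℂ R]

/-- Moving `z` into the left or the right factor gives the scalars `η²` and `κ²`, which differ for
distinct cube roots of unity. -/
lemma cubeProj_mul_cubeProj {z : R} (hz : z * z * z = 1) {η κ : ℂ} (hη : η ^ 3 = 1)
    (hκ : κ ^ 3 = 1) (hne : η ≠ κ) : cubeProj η z * cubeProj κ z = 0 := by
  have h1 : η ^ 2 • (cubeProj η z * cubeProj κ z) = κ ^ 2 • (cubeProj η z * cubeProj κ z) := by
    rw [← smul_mul_assoc, ← cubeProj_mul hz hη, mul_assoc, mul_cubeProj hz hκ, mul_smul_comm]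
  have h2 : η ^ 2 ≠ κ ^ 2 := by
    intro h
    apply hne
    linear_combination (-η) * hη + κ * hκ + (η ^ 2 + κ ^ 2) * h
  rw [← sub_eq_zero, ← sub_smul] at h1
  exact (smul_eq_zero.mp h1).resolve_left (sub_ne_zero.mpr h2)

lemma isProjectiveMeasurement_cubeProj {z : R} (hz : z * z * z = 1) (hs : star z = z * z) :
    IsProjectiveMeasurement fun a : Fin 3 => cubeProj (om ^ (2 * (a : ℕ))) z where
  isStarProjection a := ⟨cubeProj_mul_self hz (isCubeRoot_om_pow _).cube, by
    have hη := isCubeRoot_om_pow (2 * (a : ℕ))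
    have hzz : star (z * z) = z := by rw [star_mul, hs, ← mul_assoc, hz, one_mul]
    rw [isSelfAdjoint_iff]
    generalize om ^ (2 * (a : ℕ)) = η at hη
    have h1 : star (η ^ 2) = η := by rw [star_pow, hη.star_eq]; linear_combination η * hη.cube
    simp only [cubeProj, star_smul, star_add, star_one, hs, hzz, hη.star_eq, h1]
    simp
    abel⟩
  orthogonal a b hab := by
    refine cubeProj_mul_cubeProj hz (isCubeRoot_om_pow _).cube (isCubeRoot_om_pow _).cube ?_
    have h3 := om_cube
    have hs := om_sum
    have h1 : om ≠ 1 := by rintro h; rw [h] at hs; norm_num at hs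
    have h2 : om ^ 2 ≠ 1 := by
      intro h; apply h1; rw [← h3, pow_succ, h, one_mul]
    have h0 : om ≠ 0 := by rintro h; rw [h] at h3; norm_num at h3
    have h4 : om ^ 4 = om := by linear_combination om * h3
    fin_cases a <;> fin_cases b <;> simp [h4, -sq_eq_one_iff] at hab ⊢
    · exact fun h => h2 h.symm
    · exact fun h => h1 h.symm
    · exact h2
    · intro h; apply h1; exact mul_left_cancel₀ h0 (by rw [← sq, h, mul_one])
    · exact h1
    · intro h; apply h1; exact mul_left_cancel₀ h0 (by rw [← sq, ← h, mul_one])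
  sum_eq_one := by
    have hs := om_sum
    have h4 : om ^ 4 = om := by linear_combination om * om_cube
    have h8 : om ^ 8 = om ^ 2 := by linear_combination (om ^ 5 + om ^ 2) * om_cube
    have : ∑ a : Fin 3, cubeProj (om ^ (2 * (a : ℕ))) z = (1 : R) +
        ((1 / 3 : ℂ) * (1 + om + om ^ 2)) • (z + z * z) := by
      simp [Fin.sum_univ_three, cubeProj, ← pow_mul, h4, h8]
      module
    rw [this, hs]; simp

lemma sum_smul_cubeProj (z : R) :
    ∑ a : Fin 3, om ^ (a : ℕ) • cubeProj (om ^ (2 * (a : ℕ))) z = z := by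
  have hs := om_sum
  have h4 : om ^ 4 = om := by linear_combination om * om_cube
  have h8 : om ^ 8 = om ^ 2 := by linear_combination (om ^ 5 + om ^ 2) * om_cube
  have : ∑ a : Fin 3, om ^ (a : ℕ) • cubeProj (om ^ (2 * (a : ℕ))) z =
      ((1 / 3 : ℂ) * (1 + om + om ^ 2)) • (1 : R) + ((1 / 3 : ℂ) * (1 + 2 * om ^ 3)) • z +
        ((1 / 3 : ℂ) * (1 + om ^ 2 + om * om ^ 3)) • (z * z) := by
    simp [Fin.sum_univ_three, cubeProj, ← pow_mul, h4, h8]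
    module
  rw [this, om_cube, mul_one, hs, mul_one, show 1 + om ^ 2 + om = 0 by rw [← hs]; ring]
  norm_num

lemma sum_sq_smul_cubeProj (z : R) :
    ∑ a : Fin 3, om ^ (2 * (a : ℕ)) • cubeProj (om ^ (2 * (a : ℕ))) z = z * z := by
  have hs := om_sum
  have h4 : om ^ 4 = om := by linear_combination om * om_cube
  have h8 : om ^ 8 = om ^ 2 := by linear_combination (om ^ 5 + om ^ 2) * om_cube
  have : ∑ a : Fin 3, om ^ (2 * (a : ℕ)) • cubeProj (om ^ (2 * (a : ℕ))) z =
      ((1 / 3 : ℂ) * (1 + om ^ 2 + om ^ 4)) • (1 : R) + ((1 / 3 : ℂ) * (1 + om ^ 4 + om ^ 8)) • z +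
        ((1 / 3 : ℂ) * (1 + om ^ 6 + om ^ 12)) • (z * z) := by
    simp [Fin.sum_univ_three, cubeProj, ← pow_mul]
    module
  rw [this, h4, h8, hs, show 1 + om ^ 2 + om = 0 by rw [← hs]; ring, show om ^ 12 = 1 by
    rw [show 12 = 3 * 4 by norm_num, pow_mul, om_cube,
    one_pow], show om ^ 6 = 1 by rw [show 6 = 3 * 2 by norm_num, pow_mul, om_cube, one_pow]]
  norm_num

/-- The unitary with the spectral projections `P a` for the eigenvalues `ω ^ a`. -/
def ofSpectral (P : Fin 3 → R) : R := ∑ a : Fin 3, om ^ (a : ℕ) • P a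

lemma sum_smul_mul_sum_smul {P : Fin 3 → R} (hP : IsProjectiveMeasurement P) (f g : Fin 3 → ℂ) :
    (∑ a, f a • P a) * ∑ a, g a • P a = ∑ a, (f a * g a) • P a := by
  simp only [Finset.sum_mul, Finset.mul_sum, smul_mul_smul_comm]
  refine Finset.sum_congr rfl fun a _ => ?_
  rw [Finset.sum_eq_single a]
  · rw [(hP.isStarProjection a).isIdempotentElem.eq]
  · intro b _ hb
    rw [hP.orthogonal b a hb, smul_zero]
  · simp

lemma ofSpectral_sq {P : Fin 3 → R} (hP : IsProjectiveMeasurement P) :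
    ofSpectral P * ofSpectral P = ∑ a : Fin 3, om ^ (2 * (a : ℕ)) • P a := by
  rw [ofSpectral, sum_smul_mul_sum_smul hP]
  simp only [← pow_add, two_mul]

lemma star_ofSpectral {P : Fin 3 → R} (hP : IsProjectiveMeasurement P) :
    star (ofSpectral P) = ofSpectral P * ofSpectral P := by
  rw [ofSpectral_sq hP, ofSpectral, star_sum]
  refine Finset.sum_congr rfl fun a _ => ?_
  rw [star_smul, (hP.isStarProjection a).isSelfAdjoint.star_eq, star_pow, star_om, ← pow_mul]

lemma ofSpectral_cube {P : Fin 3 → R} (hP : IsProjectiveMeasurement P) :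
    ofSpectral P * ofSpectral P * ofSpectral P = 1 := by
  rw [ofSpectral_sq hP, ofSpectral, sum_smul_mul_sum_smul hP, ← hP.sum_eq_one]
  refine Finset.sum_congr rfl fun a _ => ?_
  rw [← pow_add, show 2 * (a : ℕ) + a = 3 * a by ring, pow_mul, om_cube, one_pow, one_smul]

lemma cubeProj_ofSpectral {P : Fin 3 → R} (hP : IsProjectiveMeasurement P) (a : Fin 3) :
    cubeProj (om ^ (2 * (a : ℕ))) (ofSpectral P) = P a := by
  have hs := om_sum
  have h3 := om_cube
  -- Orthogonality of the characters of `ℤ / 3`.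
  have hc : ∀ a b : Fin 3, (1 / 3 : ℂ) * (1 + om ^ (2 * (a : ℕ)) * om ^ (b : ℕ) +
      (om ^ (2 * (a : ℕ))) ^ 2 * om ^ (2 * (b : ℕ))) = if b = a then 1 else 0 := by
    intro a b
    generalize om = w at *
    fin_cases a <;> fin_cases b <;> simp <;> grind
  have : cubeProj (om ^ (2 * (a : ℕ))) (ofSpectral P) = ∑ b : Fin 3, ((1 / 3 : ℂ) *
      (1 + om ^ (2 * (a : ℕ)) * om ^ (b : ℕ) + (om ^ (2 * (a : ℕ))) ^ 2 * om ^ (2 * (b : ℕ)))) •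
        P b := by
    rw [cubeProj, ofSpectral_sq hP, ← hP.sum_eq_one]
    simp only [ofSpectral, Finset.smul_sum, ← Finset.sum_add_distrib]
    exact Finset.sum_congr rfl fun b _ => by module
  rw [this]
  simp only [hc, ite_smul, one_smul, zero_smul, Finset.sum_ite_eq', Finset.mem_univ, if_true]

end Spectral

/-! ### The SATWAP matrices over the twelfth root of unity -/

section Matrices

variable {ι : Type*} [Fintype ι] [DecidableEq ι]

/-- `cubeProj η` belongs to the eigenvalue `η⁻¹`, and `ω ^ (-a) = ω ^ (2 a)`. -/
lemma eigenProj_eq_cubeProj (A : Matrix ι ι ℂ) (a : Fin 3) :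
    eigenProj 3 A a = cubeProj (om ^ (2 * (a : ℕ))) A := by
  have h : ∀ l : ℕ, omegaPow 3 (-((a : ℝ) * l)) = om ^ (2 * ((a : ℕ) * l)) := by
    intro l
    rw [← omegaPow_neg_nat]; push_cast; rfl
  simp only [eigenProj, cubeProj, Finset.sum_range_succ, Finset.sum_range_zero, h]
  simp [pow_mul, sq]

lemma omegaPow_neg_quarter : omegaPow 3 (-(1 / 4)) = rootW - rootW ^ 3 := by
  have h1 : rootW * omegaPow 3 (-(1 / 4)) = 1 := by
    rw [rootW, ← omegaPow_add, add_neg_cancel, omegaPow_zero]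
  have h0 : rootW ≠ 0 := left_ne_zero_of_mul_eq_one h1
  apply mul_left_cancel₀ h0
  rw [h1]
  linear_combination rootW_poly

lemma omegaPow_half : omegaPow 3 (1 / 2) = rootW ^ 2 := by
  rw [rootW, ← omegaPow_nat_mul]; norm_num

lemma matZ_eq : matZ 3 = Matrix.diagonal fun i : Fin 3 => (rootW ^ 2 - 1) ^ (i : ℕ) := by
  rw [matZ]
  congr 1
  ext i
  rw [← om_eq, om, ← omegaPow_nat_mul, mul_one]

/-- The coefficients of Alice's observables. -/
def satwapCoeff (w : ℂ) : Fin 2 → ℂ × ℂ := ![(w - w ^ 3, 1 - w ^ 3), (w, 1 + w ^ 3)]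

lemma satwapA_eq (s : Fin 2) : satwapA 3 s = Matrix.of fun i j : Fin 3 =>
    (satwapCoeff rootW s).1 * (rootW ^ 2 - 1) ^ (i : ℕ) *
      ((if i = j then 1 else 0) - (satwapCoeff rootW s).2 / 3) := by
  have h : omegaPow 3 (1 / 4) = rootW := rfl
  ext i j
  fin_cases s <;>
  · simp [satwapA, omegaPow_neg_quarter, h, matZ_eq, satwapCoeff, Matrix.one_apply, matJ,
      ← rootW_cube, -one_div]
    ring

lemma satwapB_zero_eq : satwapB 3 0 = Matrix.of fun i j : Fin 3 =>
    if i = j then (rootW ^ 2 - 1) ^ (i : ℕ) else 0 := by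
  ext i j
  simp [satwapB, matZ_eq, Matrix.diagonal_apply]

lemma satwapB_one_eq : satwapB 3 1 = Matrix.of fun i j : Fin 3 =>
    rootW ^ 2 * ((if i = j then 1 else 0) - 2 / 3) * (rootW ^ 2 - 1) ^ (j : ℕ) := by
  ext i j
  simp [satwapB, omegaPow_half, matZ_eq, Matrix.one_apply, matJ, -one_div]
  ring

lemma star_satwapA (s : Fin 2) : star (satwapA 3 s) = satwapA 3 s * satwapA 3 s := by
  have h1 := rootW_poly
  have h2 := conj_rootW
  rw [satwapA_eq]
  ext i j
  rw [Matrix.star_apply, Matrix.mul_apply, Fin.sum_univ_three]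
  fin_cases s <;> fin_cases i <;> fin_cases j <;>
  · simp [satwapCoeff, h2]
    generalize rootW = w at *
    clear h2
    grind

lemma satwapA_cube (s : Fin 2) : satwapA 3 s * satwapA 3 s * satwapA 3 s = 1 := by
  have h1 := rootW_poly
  have h2 := conj_rootW
  rw [← star_satwapA, satwapA_eq]
  ext i j
  rw [Matrix.mul_apply, Fin.sum_univ_three]
  fin_cases s <;> fin_cases i <;> fin_cases j <;>
  · simp [satwapCoeff, h2]
    generalize rootW = w at *
    clear h2
    grind

lemma star_satwapB (s : Fin 2) : star (satwapB 3 s) = satwapB 3 s * satwapB 3 s := by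
  have h1 := rootW_poly
  have h2 := conj_rootW
  ext i j
  rw [Matrix.star_apply, Matrix.mul_apply, Fin.sum_univ_three]
  fin_cases s <;> fin_cases i <;> fin_cases j <;>
  · simp [satwapB_zero_eq, satwapB_one_eq, h2]
    try
      generalize rootW = w at *
      clear h2
      grind

lemma satwapB_cube (s : Fin 2) : satwapB 3 s * satwapB 3 s * satwapB 3 s = 1 := by
  have h1 := rootW_poly
  have h2 := conj_rootW
  rw [← star_satwapB]
  ext i j
  rw [Matrix.mul_apply, Fin.sum_univ_three]
  fin_cases s <;> fin_cases i <;> fin_cases j <;>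
  · simp [satwapB_zero_eq, satwapB_one_eq, h2]
    try
      generalize rootW = w at *
      clear h2
      grind

end Matrices


/-! ### Expectation values of the reference correlations -/

section MatrixCorr

variable {ι κ : Type*} [Fintype ι] [Fintype κ] {nA nB mA mB : ℕ}

lemma matrixCorr_coe (ψ : ι × κ → ℂ) {A : Fin nA → Fin mA → Matrix ι ι ℂ}
    {B : Fin nB → Fin mB → Matrix κ κ ℂ} {a : Fin mA} {b : Fin mB} {s : Fin nA} {t : Fin nB}
    (hA : (A s a).IsHermitian) (hB : (B t b).IsHermitian) :
    (matrixCorr ψ A B a b s t : ℂ) = star ψ ⬝ᵥ ((A s a ⊗ₖ B t b).mulVec ψ) := by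
  have h : (A s a ⊗ₖ B t b).IsHermitian := by
    rw [Matrix.IsHermitian, Matrix.conjTranspose_kronecker, hA.eq, hB.eq]
  apply Complex.ext
  · simp [matrixCorr]
  · simpa using (h.im_star_dotProduct_mulVec_self ψ).symm

end MatrixCorr

lemma maxEnt_expect (M N : Matrix (Fin 3) (Fin 3) ℂ) :
    star (maxEnt 3) ⬝ᵥ ((M ⊗ₖ N).mulVec (maxEnt 3)) = (1 / 3 : ℂ) * (M * Nᵀ).trace := by
  have h : ((1 / √(3 : ℝ) : ℝ) : ℂ) * ((1 / √(3 : ℝ) : ℝ) : ℂ) = 1 / 3 := by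
    rw [← Complex.ofReal_mul, div_mul_div_comm, Real.mul_self_sqrt (by norm_num)]
    norm_num
  rw [← h]
  simp [dotProduct, Matrix.mulVec, maxEnt, Fintype.sum_prod_type, Matrix.trace, Matrix.mul_apply,
    Fin.sum_univ_three]
  ring

lemma satwapA_isProjectiveMeasurement (s : Fin 2) :
    IsProjectiveMeasurement fun a => eigenProj 3 (satwapA 3 s) a := by
  simp only [eigenProj_eq_cubeProj]
  exact isProjectiveMeasurement_cubeProj (satwapA_cube s) (star_satwapA s)

lemma satwapB_isProjectiveMeasurement (s : Fin 2) :
    IsProjectiveMeasurement fun a => eigenProj 3 (satwapB 3 s) a := by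
  simp only [eigenProj_eq_cubeProj]
  exact isProjectiveMeasurement_cubeProj (satwapB_cube s) (star_satwapB s)

lemma satwapCorr_coe (a b : Fin 3) (s t : Fin 2) : (satwapCorr 3 a b s t : ℂ) =
    (1 / 3 : ℂ) * (eigenProj 3 (satwapA 3 s) a * (eigenProj 3 (satwapB 3 t) b)ᵀ).trace := by
  rw [satwapCorr, matrixCorr_coe, maxEnt_expect]
  · exact ((satwapA_isProjectiveMeasurement s).isStarProjection a).isSelfAdjoint
  · exact ((satwapB_isProjectiveMeasurement t).isStarProjection b).isSelfAdjoint

/-- The expectation value of `M_s ⊗ N_t†`. -/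
def satwapValue (s t : Fin 2) : ℂ :=
  ∑ a : Fin 3, ∑ b : Fin 3, om ^ (a : ℕ) * om ^ (2 * (b : ℕ)) * (satwapCorr 3 a b s t : ℂ)

/-- The Fourier sum over the outcomes reassembles the observables from their spectral projections;
the weights `ω ^ (2 b)` produce the square, that is, the adjoint, of Bob's one. -/
lemma satwapValue_eq (s t : Fin 2) : satwapValue s t =
    (1 / 3 : ℂ) * (satwapA 3 s * (satwapB 3 t * satwapB 3 t)ᵀ).trace := by
  rw [← sum_sq_smul_cubeProj (satwapB 3 t)]
  conv_rhs => rw [← sum_smul_cubeProj (satwapA 3 s)]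
  simp only [satwapValue, satwapCorr_coe, eigenProj_eq_cubeProj, Matrix.transpose_sum,
    Matrix.transpose_smul, Finset.sum_mul, Finset.mul_sum, Matrix.trace_sum, smul_mul_smul_comm,
    Matrix.trace_smul, smul_eq_mul]
  rw [Finset.sum_comm]
  exact Finset.sum_congr rfl fun a _ => Finset.sum_congr rfl fun b _ => by ring

/-- The coefficient of `M_0` in the expansion of Bob's observable `Z`. -/
def satwapE : ℂ := rootW * (1 - Complex.I) / 2

lemma satwapE_eq : satwapE = rootW * (1 - rootW ^ 3) / 2 := by rw [satwapE, rootW_cube]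

lemma star_satwapE_eq : star satwapE = (rootW - rootW ^ 3) * (1 + rootW ^ 3) / 2 := by
  simp [satwapE, conj_rootW, rootW_cube]

lemma star_satwapE : star satwapE = (1 + Complex.I) * satwapE ^ 2 := by
  have h := rootW_poly
  rw [star_satwapE_eq, satwapE_eq, ← rootW_cube]
  grind

lemma satwapE_ne_zero : satwapE ≠ 0 := by
  intro h
  have h1 := congrArg Complex.im (satwapE_eq.symm.trans h)
  rw [rootW_cube] at h1
  have h2 := congrArg Complex.re (satwapE_eq.symm.trans h)
  rw [rootW_cube] at h2
  simp [rootW_re, rootW_im] at h1 h2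
  linarith

lemma normSq_satwapE : ‖satwapE‖ ^ 2 = 1 / 2 := by
  have h := rootW_poly
  have h1 : (starRingEnd ℂ) satwapE * satwapE = 1 / 2 := by
    rw [show (starRingEnd ℂ) satwapE = star satwapE from rfl, star_satwapE_eq, satwapE_eq]
    grind
  rw [Complex.conj_mul'] at h1
  have h2 : ((‖satwapE‖ ^ 2 : ℝ) : ℂ) = ((1 / 2 : ℝ) : ℂ) := by push_cast; exact h1
  exact_mod_cast h2

/-- For this and the next three values only the real part `1 / 2` matters: it is the hypothesis of
`eq_add_of_inner`. The factor `-om ^ 2` in the last two is the conjugate of the phase `-om` that is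
later put on Bob's second observable. -/
lemma satwapValue_zero_zero : satwapE * satwapValue 0 0 = (3 - Complex.I) / 6 := by
  have h := rootW_poly
  rw [satwapValue_eq, satwapE_eq, satwapA_eq, satwapB_zero_eq, ← rootW_cube]
  simp [Matrix.trace, Matrix.mul_apply, Fin.sum_univ_three, satwapCoeff]
  generalize rootW = w at *
  grind

lemma satwapValue_one_zero : star satwapE * satwapValue 1 0 = (3 + Complex.I) / 6 := by
  have h := rootW_poly
  rw [satwapValue_eq, star_satwapE_eq, satwapA_eq, satwapB_zero_eq, ← rootW_cube]
  simp [Matrix.trace, Matrix.mul_apply, Fin.sum_univ_three, satwapCoeff]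
  generalize rootW = w at *
  grind

lemma satwapValue_zero_one :
    -om ^ 2 * (Complex.I * satwapE * satwapValue 0 1) = (3 + Complex.I) / 6 := by
  have h := rootW_poly
  rw [satwapValue_eq, satwapE_eq, satwapA_eq, satwapB_one_eq, ← rootW_cube, om_eq]
  simp [Matrix.trace, Matrix.mul_apply, Fin.sum_univ_three, satwapCoeff]
  generalize rootW = w at *
  grind

lemma satwapValue_one_one :
    -om ^ 2 * (-Complex.I * star satwapE * satwapValue 1 1) = (3 - Complex.I) / 6 := by
  have h := rootW_poly
  rw [satwapValue_eq, star_satwapE_eq, satwapA_eq, satwapB_one_eq, ← rootW_cube, om_eq]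
  simp [Matrix.trace, Matrix.mul_apply, Fin.sum_univ_three, satwapCoeff]
  generalize rootW = w at *
  grind

/-! The tilted CHSH correlation -/

lemma sin_two_arctan : Real.sin (2 * Real.arctan (1 / √2)) = 2 * √2 / 3 := by
  have h2 : √2 * √2 = (2 : ℝ) := Real.mul_self_sqrt (by norm_num)
  have h : 1 + (1 / √2 : ℝ) ^ 2 = 3 / 2 := by
    rw [div_pow, Real.sq_sqrt (by norm_num)]; norm_num
  have h0 : (√2 : ℝ) ≠ 0 := by positivity
  rw [Real.sin_two_mul, Real.sin_arctan, Real.cos_arctan, h, mul_assoc, div_mul_div_comm,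
    Real.mul_self_sqrt (by norm_num)]
  field_simp
  linarith

lemma one_add_sin_two_arctan_sq :
    √(1 + Real.sin (2 * Real.arctan (1 / √2)) ^ 2) = √17 / 3 := by
  rw [sin_two_arctan, div_pow, mul_pow, Real.sq_sqrt (by norm_num),
    show (1 : ℝ) + 2 ^ 2 * 2 / 3 ^ 2 = 17 / 3 ^ 2 by norm_num, Real.sqrt_div (by norm_num),
    Real.sqrt_sq (by norm_num)]

lemma cos_tiltedMu : Real.cos (tiltedMu (1 / √2)) = 3 / √17 := by
  rw [tiltedMu, Real.cos_arctan, one_add_sin_two_arctan_sq, one_div_div]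

lemma sin_tiltedMu : Real.sin (tiltedMu (1 / √2)) = 2 * √2 / √17 := by
  rw [tiltedMu, Real.sin_arctan, one_add_sin_two_arctan_sq, sin_two_arctan,
    div_div_div_cancel_right₀ (by norm_num)]

/-- Only the four entries between `|00⟩` and `|11⟩` contribute for a Schmidt vector with real
coefficients `r`, `s`. -/
lemma schmidt_expect (r s : ℝ) (M N : Matrix (Fin 2) (Fin 2) ℂ) :
    star (fun x : Fin 2 × Fin 2 => if x = (0, 0) then (r : ℂ) else if x = (1, 1) then (s : ℂ)
      else 0) ⬝ᵥ ((M ⊗ₖ N).mulVec (fun x => if x = (0, 0) then (r : ℂ) else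
        if x = (1, 1) then (s : ℂ) else 0)) =
      (r * r : ℝ) * (M 0 0 * N 0 0) + (r * s : ℝ) * (M 0 1 * N 0 1 + M 1 0 * N 1 0) +
        (s * s : ℝ) * (M 1 1 * N 1 1) := by
  simp [dotProduct, Matrix.mulVec, Fintype.sum_prod_type, Fin.sum_univ_two]
  ring

lemma tiltedState_expect (M N : Matrix (Fin 2) (Fin 2) ℂ) :
    star (tiltedState (1 / √2)) ⬝ᵥ ((M ⊗ₖ N).mulVec (tiltedState (1 / √2))) =
      (2 / 3 : ℝ) * (M 0 0 * N 0 0) + (√2 / 3 : ℝ) * (M 0 1 * N 0 1 + M 1 0 * N 1 0) +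
        (1 / 3 : ℝ) * (M 1 1 * N 1 1) := by
  have h : 1 + (1 / √2 : ℝ) ^ 2 = 3 / 2 := by
    rw [div_pow, Real.sq_sqrt (by norm_num)]; norm_num
  have h2 : √2 * √2 = (2 : ℝ) := Real.mul_self_sqrt (by norm_num)
  have h0 : (√2 : ℝ) ≠ 0 := by positivity
  have h3 : √(3 / 2) * √(3 / 2) = (3 / 2 : ℝ) := Real.mul_self_sqrt (by norm_num)
  rw [show tiltedState (1 / √2) = fun x : Fin 2 × Fin 2 => if x = (0, 0) then
    ((1 / √(1 + (1 / √2) ^ 2) : ℝ) : ℂ) else if x = (1, 1) then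
      ((1 / √2 / √(1 + (1 / √2) ^ 2) : ℝ) : ℂ) else 0 from rfl, schmidt_expect, h,
    div_mul_div_comm, div_mul_div_comm, div_mul_div_comm, h3]
  have e1 : (1 * 1 / (3 / 2) : ℝ) = 2 / 3 := by norm_num
  have e2 : (1 * (1 / √2) / (3 / 2) : ℝ) = √2 / 3 := by
    field_simp
    linarith
  have e3 : (1 / √2 * (1 / √2) / (3 / 2) : ℝ) = 1 / 3 := by
    rw [div_mul_div_comm, h2]
    norm_num
  rw [e1, e2, e3]

lemma tiltedCHSHCorr_zero (a b t : Fin 2) : tiltedCHSHCorr (1 / √2) a b 0 t =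
    (2 / 3 * (1 + (-1) ^ (a : ℕ)) * (1 + (-1) ^ (b : ℕ) * (3 / √17)) +
      1 / 3 * (1 - (-1) ^ (a : ℕ)) * (1 - (-1) ^ (b : ℕ) * (3 / √17))) / 4 := by
  rw [tiltedCHSHCorr, matrixCorr, tiltedState_expect]
  simp only [tiltedB, cos_tiltedMu, sin_tiltedMu]
  generalize 3 / √17 = c
  generalize 2 * √2 / √17 = d
  fin_cases a <;> fin_cases b <;> fin_cases t <;>
    simp [binaryProj, tiltedA, pauliZ, pauliX] <;> ring

lemma tiltedCHSHCorr_one (a b t : Fin 2) : tiltedCHSHCorr (1 / √2) a b 1 t =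
    (2 / 3 * (1 + (-1) ^ (b : ℕ) * (3 / √17)) + 1 / 3 * (1 - (-1) ^ (b : ℕ) * (3 / √17)) +
      (-1) ^ (a : ℕ) * (-1) ^ (b : ℕ) * (-1) ^ (t : ℕ) * (8 / 3 / √17)) / 4 := by
  have h2 : 8 / 3 / √17 = 2 * √2 / 3 * (2 * √2 / √17) := by
    rw [div_mul_div_comm, show 2 * √2 * (2 * √2) = 8 by
      nlinarith [Real.mul_self_sqrt (show (0 : ℝ) ≤ 2 by norm_num)], div_div]
  rw [tiltedCHSHCorr, matrixCorr, tiltedState_expect, h2]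
  simp only [tiltedB, cos_tiltedMu, sin_tiltedMu]
  generalize 3 / √17 = c
  generalize 2 * √2 / √17 = d
  generalize √2 = x
  fin_cases a <;> fin_cases b <;> fin_cases t <;>
    simp [binaryProj, tiltedA, pauliZ, pauliX] <;> ring

lemma tilted_marginal_zero (t : Fin 2) :
    ∑ a : Fin 2, ∑ b : Fin 2, (-1 : ℝ) ^ (a : ℕ) * tiltedCHSHCorr (1 / √2) a b 0 t = 1 / 3 := by
  simp only [tiltedCHSHCorr_zero, Fin.sum_univ_two]
  simp
  ring

lemma tilted_marginal_right (t : Fin 2) :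
    ∑ a : Fin 2, ∑ b : Fin 2, (-1 : ℝ) ^ (b : ℕ) * tiltedCHSHCorr (1 / √2) a b 0 t =
      1 / √17 := by
  simp only [tiltedCHSHCorr_zero, Fin.sum_univ_two]
  simp
  ring

lemma tilted_corr_zero (t : Fin 2) :
    ∑ a : Fin 2, ∑ b : Fin 2, (-1 : ℝ) ^ (a : ℕ) * (-1 : ℝ) ^ (b : ℕ) *
      tiltedCHSHCorr (1 / √2) a b 0 t = 3 / √17 := by
  simp only [tiltedCHSHCorr_zero, Fin.sum_univ_two]
  simp
  ring

lemma tilted_corr_one (t : Fin 2) :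
    ∑ a : Fin 2, ∑ b : Fin 2, (-1 : ℝ) ^ (a : ℕ) * (-1 : ℝ) ^ (b : ℕ) *
      tiltedCHSHCorr (1 / √2) a b 1 t = (-1) ^ (t : ℕ) * (8 / 3 / √17) := by
  simp only [tiltedCHSHCorr_one, Fin.sum_univ_two]
  simp
  ring


/-! ### Spatial realizations of the correlation -/

section Realization

variable {HA HB : Type}
  [NormedAddCommGroup HA] [InnerProductSpace ℂ HA] [CompleteSpace HA]
  [NormedAddCommGroup HB] [InnerProductSpace ℂ HB] [CompleteSpace HB]
  {ψ : HilbertTensor HA HB}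

lemma inner_rightOp_leftOp (X : HA →L[ℂ] HA) (Y : HB →L[ℂ] HB) :
    inner ℂ (rightOp HA Y ψ) (leftOp HB X ψ) =
      inner ℂ ψ (leftOp HB X (rightOp HA (star Y) ψ)) := by
  rw [leftOp_rightOp_comm, map_star, ContinuousLinearMap.star_eq_adjoint,
    ContinuousLinearMap.adjoint_inner_right]

lemma inner_star_rightOp_leftOp (X : HA →L[ℂ] HA) (Y : HB →L[ℂ] HB) :
    inner ℂ (rightOp HA (star Y) ψ) (leftOp HB (star X) ψ) =
      (starRingEnd ℂ) (inner ℂ (rightOp HA Y ψ) (leftOp HB X ψ)) := by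
  rw [inner_rightOp_leftOp, star_star, inner_conj_symm, map_star (leftOp HB) X,
    ContinuousLinearMap.star_eq_adjoint, ContinuousLinearMap.adjoint_inner_right]

lemma norm_leftOp_of_unitary {X : HA →L[ℂ] HA} (hX : star X * X = 1) (v : HilbertTensor HA HB) :
    ‖leftOp HB X v‖ = ‖v‖ :=
  norm_apply_eq_of_star_mul_self (by rw [← map_star, ← map_mul, hX, map_one]; rfl)

lemma norm_rightOp_of_unitary {Y : HB →L[ℂ] HB} (hY : star Y * Y = 1)
    (v : HilbertTensor HA HB) : ‖rightOp HA Y v‖ = ‖v‖ :=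
  norm_apply_eq_of_star_mul_self (by rw [← map_star, ← map_mul, hY, map_one]; rfl)

lemma star_smul_add_smul {R : Type*} [Ring R] [Algebra ℂ R] [StarRing R] [StarModule ℂ R]
    (r k : ℂ) (x y : R) : star (r • x + k • y) = star r • star x + star k • star y := by
  rw [star_add, star_smul, star_smul]

lemma leftOp_smul_add_smul (r k : ℂ) (X Y : HA →L[ℂ] HA) : leftOp HB (r • X + k • Y) ψ =
    r • leftOp HB X ψ + k • leftOp HB Y ψ := by
  simp

set_option maxHeartbeats 800000 in
/-- If the expectation values are maximal then Bob's observables are mirror images of combinations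
of Alice's. -/
lemma mirror_of_inner (hψ : ‖ψ‖ = 1) {a₀ a₁ : HA →L[ℂ] HA} {z c : HB →L[ℂ] HB} {e : ℂ}
    (he : ‖e‖ ^ 2 = 1 / 2) (ha₀ : star a₀ * a₀ = 1) (ha₀' : a₀ * star a₀ = 1)
    (ha₁ : star a₁ * a₁ = 1) (ha₁' : a₁ * star a₁ = 1) (hz : star z * z = 1)
    (hz' : z * star z = 1) (hc : star c * c = 1) (hc' : c * star c = 1)
    (h00 : (e * inner ℂ (rightOp HA z ψ) (leftOp HB a₀ ψ)).re = 1 / 2)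
    (h10 : (star e * inner ℂ (rightOp HA z ψ) (leftOp HB a₁ ψ)).re = 1 / 2)
    (h01 : (Complex.I * e * inner ℂ (rightOp HA c ψ) (leftOp HB a₀ ψ)).re = 1 / 2)
    (h11 : (-Complex.I * star e * inner ℂ (rightOp HA c ψ) (leftOp HB a₁ ψ)).re = 1 / 2) :
    Mirror ψ (e • a₀ + star e • a₁) z ∧
      Mirror ψ (Complex.I • (e • a₀ - star e • a₁)) c := by
  have he' : ‖star e‖ ^ 2 = 1 / 2 := by rw [norm_star, he]
  have nu : ∀ {k : ℂ} {X : HA →L[ℂ] HA}, ‖k‖ ^ 2 = 1 / 2 → star X * X = 1 →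
      ‖k • leftOp HB X ψ‖ ^ 2 = 1 / 2 := by
    intro k X hk hX
    rw [norm_smul, norm_leftOp_of_unitary hX, hψ, mul_one, hk]
  have nv : ∀ {Y : HB →L[ℂ] HB}, star Y * Y = 1 → ‖rightOp HA Y ψ‖ ^ 2 = 1 := by
    intro Y hY
    rw [norm_rightOp_of_unitary hY, hψ, one_pow]
  have hss : ∀ {R : Type _} [Ring R] [StarRing R] {X : R}, X * star X = 1 →
      star (star X) * star X = 1 := fun h => by rwa [star_star]
  obtain ⟨e1, e2⟩ := eq_add_of_inner (v₀ := rightOp HA z ψ) (v₁ := rightOp HA c ψ)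
    (u₀ := e • leftOp HB a₀ ψ) (u₁ := star e • leftOp HB a₁ ψ) (nv hz) (nv hc) (nu he ha₀)
    (nu he' ha₁) (by rwa [inner_smul_right]) (by rwa [inner_smul_right])
    (by rwa [smul_smul, inner_smul_right]) (by rwa [smul_smul, inner_smul_right])
  have hconj : ∀ {r : ℂ}, r.re = 1 / 2 → ((starRingEnd ℂ) r).re = 1 / 2 := fun h => by
    rwa [Complex.conj_re]
  -- The adjoints satisfy the conjugate conditions. The sign in front of `star c` compensates for
  -- the conjugation of the factor `i`.
  obtain ⟨e3, e4⟩ := eq_add_of_inner (v₀ := rightOp HA (star z) ψ)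
    (v₁ := -rightOp HA (star c) ψ)
    (u₀ := star e • leftOp HB (star a₀) ψ) (u₁ := e • leftOp HB (star a₁) ψ) (nv (hss hz'))
    (by rw [norm_neg]; exact nv (hss hc')) (nu he' (hss ha₀')) (nu he (hss ha₁'))
    (by
      rw [inner_smul_right, inner_star_rightOp_leftOp]
      simpa using hconj h00)
    (by
      rw [inner_smul_right, inner_star_rightOp_leftOp]
      simpa using hconj h10)
    (by
      rw [smul_smul, inner_smul_right, inner_neg_left, inner_star_rightOp_leftOp, ← hconj h01,
        map_mul, map_mul, Complex.conj_I, Complex.star_def]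
      ring_nf)
    (by
      rw [smul_smul, inner_smul_right, inner_neg_left, inner_star_rightOp_leftOp, ← hconj h11,
        map_mul, map_mul, map_neg, Complex.conj_I, Complex.star_def, Complex.conj_conj]
      ring_nf)
  refine ⟨⟨?_, ?_⟩, ⟨?_, ?_⟩⟩
  · rw [e1, leftOp_smul_add_smul]
  · rw [e3, star_smul_add_smul, star_star, leftOp_smul_add_smul]
  · rw [e2, map_smul, smul_apply, sub_eq_add_neg (e • a₀), ← neg_smul, leftOp_smul_add_smul,
      neg_smul, sub_eq_add_neg]
  · rw [← neg_neg (rightOp HA (star c) ψ), e4, star_smul, sub_eq_add_neg (e • a₀), ← neg_smul,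
      star_smul_add_smul, map_smul, smul_apply, leftOp_smul_add_smul, star_neg, star_star,
      Complex.star_def, Complex.conj_I, neg_smul, neg_smul, sub_eq_add_neg]

/-- The state `ψ` and the measurements `P`, `Q` realize the correlation `p`. -/
structure Realizes {nA nB mA mB : ℕ} (p : Corr nA nB mA mB) (ψ : HilbertTensor HA HB)
    (P : Fin nA → Fin mA → (HA →L[ℂ] HA)) (Q : Fin nB → Fin mB → (HB →L[ℂ] HB)) : Prop where
  norm_eq : ‖ψ‖ = 1
  projA : ∀ s, IsProjectiveMeasurement (P s)
  projB : ∀ t, IsProjectiveMeasurement (Q t)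
  corr : ∀ a b s t, (p a b s t : ℂ) = inner ℂ ψ (tensorOp (P s a) (Q t b) ψ)

lemma Realizes.expect {nA nB mA mB : ℕ} {p : Corr nA nB mA mB}
    {P : Fin nA → Fin mA → (HA →L[ℂ] HA)} {Q : Fin nB → Fin mB → (HB →L[ℂ] HB)}
    (h : Realizes p ψ P Q) (s : Fin nA) (t : Fin nB) (f : Fin mA → ℂ) (g : Fin mB → ℂ) :
    inner ℂ ψ (leftOp HB (∑ a, f a • P s a) (rightOp HA (∑ b, g b • Q t b) ψ)) =
      ∑ a, ∑ b, f a * g b * (p a b s t : ℂ) := by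
  have e : ∀ a b, inner ℂ ψ (leftOp HB (P s a) (rightOp HA (Q t b) ψ)) = (p a b s t : ℂ) := by
    intro a b
    rw [h.corr, ← leftOp_mul_rightOp]; rfl
  simp only [map_sum, map_smul, sum_apply, smul_apply, inner_sum,
    inner_smul_right, Finset.mul_sum, e, mul_assoc]
  rw [Finset.sum_comm]
  exact Finset.sum_congr rfl fun a _ => Finset.sum_congr rfl fun b _ => by ring

end Realization

/-! ### From the SATWAP values to the mirror relations -/

section Satwap

variable {HA HB : Type}
  [NormedAddCommGroup HA] [InnerProductSpace ℂ HA] [CompleteSpace HA]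
  [NormedAddCommGroup HB] [InnerProductSpace ℂ HB] [CompleteSpace HB]
  {ψ : HilbertTensor HA HB} {p : Corr 4 4 3 3}
  {P : Fin 4 → Fin 3 → (HA →L[ℂ] HA)} {Q : Fin 4 → Fin 3 → (HB →L[ℂ] HB)}

lemma star_ofSpectral_eq_sum {R : Type*} [Ring R] [Algebra ℂ R] [StarRing R] [StarModule ℂ R]
    {P : Fin 3 → R} (hP : IsProjectiveMeasurement P) :
    star (ofSpectral P) = ∑ a : Fin 3, om ^ (2 * (a : ℕ)) • P a := by
  rw [star_ofSpectral hP, ofSpectral_sq hP]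

lemma Realizes.inner_eq_satwapValue (h : Realizes p ψ P Q) (hI : PropI p) (s t : Fin 2) :
    inner ℂ (rightOp HA (ofSpectral (Q (Fin.castAdd 2 t))) ψ)
      (leftOp HB (ofSpectral (P (Fin.castAdd 2 s))) ψ) = satwapValue s t := by
  rw [inner_rightOp_leftOp, star_ofSpectral_eq_sum (h.projB _), ofSpectral, h.expect]
  exact Finset.sum_congr rfl fun a _ => Finset.sum_congr rfl fun b _ => by rw [hI a b s t]

lemma Realizes.satwapMirror (h : Realizes p ψ P Q) (hI : PropI p) :
    ∃ x y c, SatwapMirror ψ x y (ofSpectral (Q 0)) c := by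
  have uni : ∀ {R : Type _} [Ring R] [Algebra ℂ R] [StarRing R] [StarModule ℂ R]
      {P : Fin 3 → R}, IsProjectiveMeasurement P →
      star (ofSpectral P) * ofSpectral P = 1 ∧ ofSpectral P * star (ofSpectral P) = 1 := by
    intro R _ _ _ _ P hP
    rw [star_ofSpectral hP, ← mul_assoc, ofSpectral_cube hP]
    exact ⟨rfl, rfl⟩
  have h3 := om_cube
  have hcc : star (-om) * -om = 1 := by rw [star_neg, star_om]; linear_combination h3
  have hb := uni (h.projB 1)
  have i00 : inner ℂ (rightOp HA (ofSpectral (Q 0)) ψ) (leftOp HB (ofSpectral (P 0)) ψ) =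
      satwapValue 0 0 := h.inner_eq_satwapValue hI 0 0
  have i01 : inner ℂ (rightOp HA (ofSpectral (Q 1)) ψ) (leftOp HB (ofSpectral (P 0)) ψ) =
      satwapValue 0 1 := h.inner_eq_satwapValue hI 0 1
  have i10 : inner ℂ (rightOp HA (ofSpectral (Q 0)) ψ) (leftOp HB (ofSpectral (P 1)) ψ) =
      satwapValue 1 0 := h.inner_eq_satwapValue hI 1 0
  have i11 : inner ℂ (rightOp HA (ofSpectral (Q 1)) ψ) (leftOp HB (ofSpectral (P 1)) ψ) =
      satwapValue 1 1 := h.inner_eq_satwapValue hI 1 1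
  -- The phase `-ω` removes the prefactor `ω ^ (1/2)` of `N_1`, as `ω ^ (3/2) = -1`: ideally `c = (1
  -- - 2 |J⟩⟨J|) Z`, which has `c³ = -1`.
  have hm := mirror_of_inner (ψ := ψ) h.norm_eq (a₀ := ofSpectral (P 0)) (a₁ := ofSpectral (P 1))
    (z := ofSpectral (Q 0)) (c := -om • ofSpectral (Q 1)) (e := satwapE) normSq_satwapE
    (uni (h.projA 0)).1 (uni (h.projA 0)).2 (uni (h.projA 1)).1 (uni (h.projA 1)).2
    (uni (h.projB 0)).1 (uni (h.projB 0)).2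
    (by rw [star_smul, smul_mul_smul_comm, hb.1, hcc, one_smul])
    (by rw [star_smul, smul_mul_smul_comm, hb.2, mul_comm, hcc, one_smul])
    (by
      rw [i00, satwapValue_zero_zero]
      norm_num)
    (by
      rw [i10, satwapValue_one_zero]
      norm_num)
    (by
      rw [map_smul, smul_apply, inner_smul_left,
        i01, mul_left_comm,
        ← Complex.star_def, star_neg, star_om, satwapValue_zero_one]
      norm_num)
    (by
      rw [map_smul, smul_apply, inner_smul_left,
        i11, mul_left_comm,
        ← Complex.star_def, star_neg, star_om, satwapValue_one_one]
      norm_num)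
  refine ⟨_, _, _, SatwapMirror.of_mirror satwapE_ne_zero star_satwapE
    (star_ofSpectral (h.projA 1)) (ofSpectral_cube (h.projA 1)) hm.1 hm.2
    (ofSpectral_cube (h.projB 0)) ?_ (star_ofSpectral (h.projB 0)) ?_⟩
  · rw [smul_mul_smul_comm, smul_mul_smul_comm, ofSpectral_cube (h.projB 1),
      show -om * -om * -om = -1 by linear_combination -h3, neg_one_smul]
  · rw [star_smul, star_ofSpectral (h.projB 1), smul_mul_smul_comm, star_neg, star_om, ← neg_smul]
    congr 1
    ring

end Satwap


/-! ### The correlation has no spatial realization -/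

section SignObs

variable {R : Type*} [Ring R] [Algebra ℂ R] [StarRing R] [StarModule ℂ R]

/-- The signs of the outcomes. -/
def outcomeSign : Fin 3 → ℝ := ![1, -1, 1]

/-- The binary observable of a measurement that gives the outcome `1` the value `-1`. -/
def signObs (P : Fin 3 → R) : R := ∑ a, (outcomeSign a : ℂ) • P a

lemma signObs_mul_self {P : Fin 3 → R} (hP : IsProjectiveMeasurement P) :
    signObs P * signObs P = 1 := by
  rw [signObs, sum_smul_mul_sum_smul hP, ← hP.sum_eq_one]
  refine Finset.sum_congr rfl fun a _ => ?_
  fin_cases a <;> simp [outcomeSign]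

lemma isSelfAdjoint_signObs {P : Fin 3 → R} (hP : IsProjectiveMeasurement P) :
    IsSelfAdjoint (signObs P) := by
  rw [isSelfAdjoint_iff, signObs, star_sum]
  refine Finset.sum_congr rfl fun a _ => ?_
  rw [star_smul, (hP.isStarProjection a).isSelfAdjoint.star_eq, Complex.star_def,
    Complex.conj_ofReal]

/-- The outcome `2` has the sign `+1`, so the eigenspace for `-1` is exactly the range of `P 1`, the
projection that property (iii) ties to Bob's outcome `1`. -/
lemma one_add_signObs {P : Fin 3 → R} (hP : IsProjectiveMeasurement P) :
    1 + signObs P = (2 : ℂ) • (1 - P 1) := by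
  rw [← hP.sum_eq_one, signObs]
  simp [Fin.sum_univ_three, outcomeSign]
  module

lemma one_sub_signObs {P : Fin 3 → R} (hP : IsProjectiveMeasurement P) :
    1 - signObs P = (2 : ℂ) • P 1 := by
  rw [← hP.sum_eq_one, signObs]
  simp [Fin.sum_univ_three, outcomeSign]
  module

end SignObs

/-- The outcome `2` has probability zero for these inputs, so the weight given to it is immaterial.
-/
lemma sum_mul_eq_tilted {p : Corr 4 4 3 3} (h : PropII p) (s t : Fin 2) (f g : Fin 3 → ℝ) :
    ∑ a, ∑ b, f a * g b * p a b (Fin.natAdd 2 s) (Fin.natAdd 2 t) =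
      ∑ a : Fin 2, ∑ b : Fin 2, f a.castSucc * g b.castSucc * tiltedCHSHCorr (1 / √2) a b s t := by
  obtain ⟨h1, h2, h3⟩ := h s t
  rw [Fin.sum_univ_castSucc]
  have h3' : ∑ b, f (Fin.last 2) * g b * p (Fin.last 2) b (Fin.natAdd 2 s) (Fin.natAdd 2 t) = 0 :=
    Finset.sum_eq_zero fun b _ => by rw [show Fin.last 2 = 2 from rfl, h3, mul_zero]
  rw [h3', add_zero]
  refine Finset.sum_congr rfl fun a _ => ?_
  rw [Fin.sum_univ_castSucc, show Fin.last 2 = 2 from rfl, h2, mul_zero, add_zero]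
  exact Finset.sum_congr rfl fun b _ => by rw [h1]

lemma outcomeSign_castSucc (a : Fin 2) : outcomeSign a.castSucc = (-1) ^ (a : ℕ) := by
  fin_cases a <;> simp [outcomeSign]

/-! ### Expectation values of a realization and the contradiction -/

section NoSpatial

variable {HA HB : Type}
  [NormedAddCommGroup HA] [InnerProductSpace ℂ HA] [CompleteSpace HA]
  [NormedAddCommGroup HB] [InnerProductSpace ℂ HB] [CompleteSpace HB]
  {ψ : HilbertTensor HA HB} {p : Corr 4 4 3 3}
  {P : Fin 4 → Fin 3 → (HA →L[ℂ] HA)} {Q : Fin 4 → Fin 3 → (HB →L[ℂ] HB)}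

lemma Realizes.expect_ofReal (h : Realizes p ψ P Q) (s t : Fin 4) (f g : Fin 3 → ℝ) :
    inner ℂ ψ (leftOp HB (∑ a, (f a : ℂ) • P s a) (rightOp HA (∑ b, (g b : ℂ) • Q t b) ψ)) =
      ((∑ a, ∑ b, f a * g b * p a b s t : ℝ) : ℂ) := by
  rw [h.expect]
  push_cast
  rfl

lemma IsProjectiveMeasurement.sum_one_smul {R : Type*} [Ring R] [Algebra ℂ R] [StarRing R]
    {P : Fin 3 → R} (hP : IsProjectiveMeasurement P) : ∑ a, ((1 : ℝ) : ℂ) • P a = 1 := by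
  simpa using hP.sum_eq_one

lemma Realizes.inner_left_signObs (h : Realizes p ψ P Q) (hII : PropII p) :
    inner ℂ ψ (leftOp HB (signObs (P 2)) ψ) = ((1 / 3 : ℝ) : ℂ) := by
  have e := h.expect_ofReal 2 2 outcomeSign fun _ => 1
  rw [(h.projB 2).sum_one_smul, map_one] at e
  refine e.trans (congrArg _ ((sum_mul_eq_tilted hII 0 0 _ _).trans ?_))
  simpa only [outcomeSign_castSucc, mul_one] using tilted_marginal_zero 0

lemma Realizes.inner_right_signObs (h : Realizes p ψ P Q) (hII : PropII p) (t : Fin 2) :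
    inner ℂ ψ (rightOp HA (signObs (Q (Fin.natAdd 2 t))) ψ) = ((1 / √17 : ℝ) : ℂ) := by
  have e := h.expect_ofReal 2 (Fin.natAdd 2 t) (fun _ => 1) outcomeSign
  rw [(h.projA 2).sum_one_smul, map_one] at e
  refine e.trans (congrArg _ ((sum_mul_eq_tilted hII 0 t _ _).trans ?_))
  simpa only [outcomeSign_castSucc, one_mul] using tilted_marginal_right t

lemma Realizes.inner_zero_signObs (h : Realizes p ψ P Q) (hII : PropII p) (t : Fin 2) :
    inner ℂ ψ (leftOp HB (signObs (P 2)) (rightOp HA (signObs (Q (Fin.natAdd 2 t))) ψ)) =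
      ((3 / √17 : ℝ) : ℂ) := by
  refine (h.expect_ofReal 2 (Fin.natAdd 2 t) outcomeSign outcomeSign).trans (congrArg _
    ((sum_mul_eq_tilted hII 0 t _ _).trans ?_))
  simpa only [outcomeSign_castSucc] using tilted_corr_zero t

lemma Realizes.inner_one_signObs (h : Realizes p ψ P Q) (hII : PropII p) (t : Fin 2) :
    inner ℂ ψ (leftOp HB (signObs (P 3)) (rightOp HA (signObs (Q (Fin.natAdd 2 t))) ψ)) =
      (((-1) ^ (t : ℕ) * (8 / 3 / √17) : ℝ) : ℂ) := by
  refine (h.expect_ofReal 3 (Fin.natAdd 2 t) outcomeSign outcomeSign).trans (congrArg _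
    ((sum_mul_eq_tilted hII 1 t _ _).trans ?_))
  simpa only [outcomeSign_castSucc] using tilted_corr_one t

/-- The sum and the difference of Bob's observables, in the units of `tilted_relations`. -/
lemma Realizes.exists_tilted_swap (h : Realizes p ψ P Q) (hII : PropII p) :
    ∃ d : HB →L[ℂ] HB, IsSelfAdjoint d ∧ rightOp HA d (rightOp HA d ψ) = (32 : ℂ) • ψ ∧
      leftOp HB (signObs (P 3)) (rightOp HA d (ψ + leftOp HB (signObs (P 2)) ψ)) =
        (8 : ℂ) • (ψ - leftOp HB (signObs (P 2)) ψ) := by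
  -- The scaling by `√17` clears the denominators of `cos μ = 3 / √17` and `sin μ = 2 √2 / √17`:
  -- ideally `s = 6 σ_z` and `d = 4 √2 σ_x`.
  obtain ⟨r, hr⟩ : ∃ r : ℝ, r = √17 := ⟨_, rfl⟩
  have hr0 : r ≠ 0 := by rw [hr]; positivity
  have hr2 : (r : ℂ) * r = 17 := by
    rw [← Complex.ofReal_mul, hr, Real.mul_self_sqrt (by norm_num)]; norm_num
  have hsr : star (r : ℂ) = r := Complex.conj_ofReal r
  have b0 := signObs_mul_self (h.projB 2)
  have b1 := signObs_mul_self (h.projB 3)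
  have s0 := isSelfAdjoint_signObs (h.projB 2)
  have s1 := isSelfAdjoint_signObs (h.projB 3)
  have r0 := h.inner_right_signObs hII 0
  have r1 := h.inner_right_signObs hII 1
  have c00 := h.inner_zero_signObs hII 0
  have c01 := h.inner_zero_signObs hII 1
  have c10 := h.inner_one_signObs hII 0
  have c11 := h.inner_one_signObs hII 1
  rw [show Fin.natAdd 2 (0 : Fin 2) = 2 from rfl, ← hr] at r0 c00 c10
  rw [show Fin.natAdd 2 (1 : Fin 2) = 3 from rfl, ← hr] at r1 c01 c11
  generalize signObs (Q 2) = B0 at *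
  generalize signObs (Q 3) = B1 at *
  have ss : IsSelfAdjoint ((r : ℂ) • (B0 + B1)) := by
    rw [isSelfAdjoint_iff, star_smul, star_add, s0.star_eq, s1.star_eq, hsr]
  have sd : IsSelfAdjoint ((r : ℂ) • (B0 - B1)) := by
    rw [isSelfAdjoint_iff, star_smul, star_sub, s0.star_eq, s1.star_eq, hsr]
  have comm : ∀ (X : HA →L[ℂ] HA) (Y : HB →L[ℂ] HB),
      rightOp HA Y * leftOp HB X = leftOp HB X * rightOp HA Y := fun X Y => by
    rw [rightOp_mul_leftOp, leftOp_mul_rightOp]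
  have key := tilted_relations (ψ := ψ) h.norm_eq (a₀ := leftOp HB (signObs (P 2)))
    (a₁ := leftOp HB (signObs (P 3))) (s := rightOp HA ((r : ℂ) • (B0 + B1)))
    (d := rightOp HA ((r : ℂ) • (B0 - B1)))
    ((isSelfAdjoint_signObs (h.projA 2)).map _) ((isSelfAdjoint_signObs (h.projA 3)).map _)
    (ss.map _) (sd.map _)
    (by rw [← map_mul, signObs_mul_self (h.projA 2), map_one])
    (by rw [← map_mul, signObs_mul_self (h.projA 3), map_one])
    (comm _ _) (comm _ _) (comm _ _) (comm _ _)
    (by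
      rw [← map_mul, ← map_mul, ← map_add, smul_mul_smul_comm, smul_mul_smul_comm, ← smul_add,
        show (B0 + B1) * (B0 - B1) + (B0 - B1) * (B0 + B1) =
          B0 * B0 + B0 * B0 - B1 * B1 - B1 * B1 by noncomm_ring, b0, b1]
      simp)
    (by
      rw [← map_mul, ← map_mul, ← map_add, smul_mul_smul_comm, smul_mul_smul_comm, ← smul_add,
        show (B0 + B1) * (B0 + B1) + (B0 - B1) * (B0 - B1) =
          B0 * B0 + B0 * B0 + B1 * B1 + B1 * B1 by noncomm_ring, b0, b1, hr2,
        show (17 : ℂ) • (1 + 1 + 1 + 1 : HB →L[ℂ] HB) = (68 : ℂ) • 1 by module, map_smul, map_one,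
        ← Algebra.algebraMap_eq_smul_one, map_ofNat])
    (by rw [h.inner_left_signObs hII, Complex.ofReal_re])
    (by
      rw [map_smul, map_add, smul_apply, add_apply, inner_smul_right, inner_add_right, r0, r1,
        ← Complex.ofReal_add, ← Complex.ofReal_mul, Complex.ofReal_re]
      field_simp
      norm_num)
    (by
      rw [map_smul, map_add, smul_apply, add_apply, map_smul, map_add, inner_smul_right,
        inner_add_right, c00, c01, ← Complex.ofReal_add, ← Complex.ofReal_mul, Complex.ofReal_re]
      field_simp
      norm_num)
    (by
      rw [map_smul, map_sub, smul_apply, sub_apply, map_smul, map_sub, inner_smul_right,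
        inner_sub_right, c10, c11, ← Complex.ofReal_sub, ← Complex.ofReal_mul, Complex.ofReal_re]
      simp
      field_simp
      norm_num)
  exact ⟨_, sd, key.1, key.2⟩

lemma norm_leftOp_sq {X : HA →L[ℂ] HA} (hX : IsStarProjection X) :
    ‖leftOp HB X ψ‖ ^ 2 = (inner ℂ ψ (leftOp HB X ψ)).re := by
  rw [← re_inner_mul_self (hX.isSelfAdjoint.map (leftOp HB)), ← map_mul, hX.isIdempotentElem.eq]

lemma norm_rightOp_sq {Y : HB →L[ℂ] HB} (hY : IsStarProjection Y) :
    ‖rightOp HA Y ψ‖ ^ 2 = (inner ℂ ψ (rightOp HA Y ψ)).re := by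
  rw [← re_inner_mul_self (hY.isSelfAdjoint.map (rightOp HA)), ← map_mul, hY.isIdempotentElem.eq]

lemma Realizes.norm_outcome (h : Realizes p ψ P Q) (hIII : PropIII p) :
    ‖rightOp HA (Q 0 1) ψ‖ ^ 2 = 1 / 3 := by
  have e := h.expect_ofReal 2 0 (fun _ => 1) (Pi.single 1 1)
  rw [(h.projA 2).sum_one_smul, map_one, show ∑ b, ((Pi.single 1 1 : Fin 3 → ℝ) b : ℂ) • Q 0 b =
    Q 0 1 by simp [Pi.single_apply], one_apply_eq_self] at e
  rw [norm_rightOp_sq ((h.projB 0).isStarProjection 1), e,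
    Complex.ofReal_re, ← hIII.2.2 2]
  simp [Pi.single_apply]

/-- Two vectors with squared norms `1 / 3` and with real part `1 / 3` of their inner product
coincide. -/
lemma Realizes.outcome_eq (h : Realizes p ψ P Q) (hIII : PropIII p) :
    leftOp HB (P 2 1) ψ = rightOp HA (Q 0 1) ψ := by
  have hQ := (h.projB 0).isStarProjection 1
  have n1 : ‖leftOp HB (P 2 1) ψ‖ ^ 2 = 1 / 3 := by
    have e := h.expect_ofReal 2 0 (Pi.single 1 1) (fun _ => 1)
    rw [(h.projB 0).sum_one_smul, map_one, show ∑ a, ((Pi.single 1 1 : Fin 3 → ℝ) a : ℂ) • P 2 a =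
      P 2 1 by simp [Pi.single_apply], one_apply_eq_self] at e
    rw [norm_leftOp_sq ((h.projA 2).isStarProjection 1), e,
      Complex.ofReal_re, ← hIII.2.1 0]
    simp [Pi.single_apply, Fin.sum_univ_three]
  have n2 := h.norm_outcome hIII
  have c : (inner ℂ (rightOp HA (Q 0 1) ψ) (leftOp HB (P 2 1) ψ)).re = 1 / 3 := by
    rw [inner_rightOp_leftOp, hQ.isSelfAdjoint.star_eq, ← mul_apply_eq_comp, leftOp_mul_rightOp,
      ← h.corr, Complex.ofReal_re, hIII.1]
  have : ‖leftOp HB (P 2 1) ψ - (1 : ℂ) • rightOp HA (Q 0 1) ψ‖ ^ 2 = 0 := by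
    rw [norm_sub_smul_sq _ _ 1 (by norm_num), n1, n2, c]
    norm_num
  rw [one_smul] at this
  exact sub_eq_zero.mp (norm_eq_zero.mp (pow_eq_zero_iff two_ne_zero |>.mp this))

/-- The three properties are incompatible with a spatial realization: the block of the state on
which Bob obtains `1` would have injective norm `0`. -/
lemma Realizes.false (h : Realizes p ψ P Q) (hI : PropI p) (hII : PropII p) (hIII : PropIII p) :
    False := by
  obtain ⟨x, y, c, hm⟩ := h.satwapMirror hI
  obtain ⟨d, sd, hdd, hswap⟩ := h.exists_tilted_swap hII
  have hout := h.outcome_eq hIII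
  have e0 : cubeProj (om ^ 0) (ofSpectral (Q 0)) = Q 0 0 := cubeProj_ofSpectral (h.projB 0) 0
  have e1 : cubeProj (om ^ 2) (ofSpectral (Q 0)) = Q 0 1 := cubeProj_ofSpectral (h.projB 0) 1
  have e2 : cubeProj (om ^ 4) (ofSpectral (Q 0)) = Q 0 2 := cubeProj_ofSpectral (h.projB 0) 2
  have hsum : (1 : HB →L[ℂ] HB) - Q 0 1 = Q 0 0 + Q 0 2 := by
    rw [← (h.projB 0).sum_eq_one, Fin.sum_univ_three]
    abel
  -- Property (iii) translates Alice's two eigenspaces into Bob's blocks: `+1` into the blocks `0`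
  -- and `2`, `-1` into the block `1`.
  have hplus : ψ + leftOp HB (signObs (P 2)) ψ = (2 : ℂ) • rightOp HA (Q 0 0 + Q 0 2) ψ := by
    have e : leftOp HB (1 + signObs (P 2)) ψ = leftOp HB ((2 : ℂ) • (1 - P 2 1)) ψ := by
      rw [one_add_signObs (h.projA 2)]
    rw [map_add, map_one, map_smul, map_sub, map_one, smul_apply, sub_apply, add_apply,
      one_apply_eq_self, hout] at e
    rw [e, ← hsum, map_sub, map_one, sub_apply, one_apply_eq_self]
  have hminus : ψ - leftOp HB (signObs (P 2)) ψ = (2 : ℂ) • rightOp HA (Q 0 1) ψ := by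
    have e : leftOp HB (1 - signObs (P 2)) ψ = leftOp HB ((2 : ℂ) • P 2 1) ψ := by
      rw [one_sub_signObs (h.projA 2)]
    rwa [map_sub, map_one, map_smul, smul_apply, sub_apply, one_apply_eq_self,
      hout] at e
  have hzero : rightOp HA (Q 0 1) ψ = 0 := by
    refine eq_zero_of_injLe_contract (r := 1 / √2) (by positivity) ?_ fun k hk hle => ?_
    · rw [div_lt_one (by positivity)]
      exact Real.lt_sqrt_of_sq_lt (by norm_num)
    -- A bound for the block `1` is first passed to the blocks `0` and `2` together (SATWAP) and
    -- then comes back to the block `1` with the factor `1 / √2` (tilted CHSH).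
    · have h1 := hm.injLe_add (isCubeRoot_om_pow 0) (isCubeRoot_om_pow 4) (isCubeRoot_om_pow 2)
        (by rw [e0, e2]; exact (h.projB 0).orthogonal 0 2 (by decide)) hk (by rwa [e1])
      rw [e0, e2] at h1
      have h2 := h1.smul 2
      rw [← hplus] at h2
      have h3 := (injLe_of_tilted_swap (isSelfAdjoint_signObs (h.projA 3)) sd
        (signObs_mul_self (h.projA 3)) hdd hswap (by positivity) h2).smul (1 / 2)
      rw [hminus, smul_smul] at h3
      have e3 : (1 / 2 : ℂ) * 2 = 1 := by norm_num
      have e4 : ‖(1 / 2 : ℂ)‖ * (1 / √2 * (‖(2 : ℂ)‖ * k)) = 1 / √2 * k := by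
        norm_num
        ring
      rwa [e3, e4, one_smul] at h3
  have n2 := h.norm_outcome hIII
  rw [hzero] at n2
  norm_num at n2

end NoSpatial

lemma not_exists_mem_Cqs :
    ¬ ∃ q : Corr 4 4 3 3, q ∈ Cqs 4 4 3 3 ∧ PropI q ∧ PropII q ∧ PropIII q := by
  rintro ⟨q, ⟨HA, HB, _, _, _, _, _, _, -, -, ψ, P, Q, h1, h2, h3, h4⟩, hI, hII, hIII⟩
  exact Realizes.false ⟨h1, h2, h3, h4⟩ hI hII hIII


/-! ### Embezzlement -/

section DiagVec

variable {ι κ : Type*} [Fintype ι] [Fintype κ] [DecidableEq ι] [DecidableEq κ]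

/-- The vector `∑ d(i) |i i⟩`. -/
def diagVec (d : ι → ℝ) : ι × ι → ℂ := fun x => if x.1 = x.2 then (d x.1 : ℂ) else 0

lemma biTensor_diagVec (u : ι → ℝ) (v : κ → ℝ) :
    biTensor (diagVec u) (diagVec v) = diagVec fun x => u x.1 * v x.2 := by
  ext ⟨⟨a, b⟩, ⟨c, d⟩⟩
  by_cases h1 : a = c <;> by_cases h2 : b = d <;> simp [biTensor, diagVec, h1, h2]

lemma smul_diagVec (r : ℝ) (d : ι → ℝ) : (r : ℂ) • diagVec d = diagVec fun i => r * d i := by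
  ext ⟨i, j⟩
  by_cases h : i = j <;> simp [diagVec, h]

lemma diagVec_sub (d d' : ι → ℝ) : diagVec d - diagVec d' = diagVec fun i => d i - d' i := by
  ext ⟨i, j⟩
  by_cases h : i = j <;> simp [diagVec, h]

lemma sum_norm_diagVec_sq (d : ι → ℝ) : ∑ x, ‖diagVec d x‖ ^ 2 = ∑ i, d i ^ 2 := by
  rw [Fintype.sum_prod_type]
  refine Finset.sum_congr rfl fun i _ => ?_
  rw [Finset.sum_eq_single i]
  · simp [diagVec]
  · intro j _ hj
    simp [diagVec, hj.symm]
  · simp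

lemma norm_toLp_diagVec (d : ι → ℝ) : ‖WithLp.toLp 2 (diagVec d)‖ = √(∑ i, d i ^ 2) := by
  rw [EuclideanSpace.norm_eq]
  exact congrArg _ (sum_norm_diagVec_sq d)

end DiagVec

/-! ### Schmidt coefficients of the states -/

lemma maxEnt_eq_diagVec : maxEnt 3 = diagVec fun _ => 1 / √3 := by
  ext x
  simp [maxEnt, diagVec]

/-- The Schmidt coefficients of `|00⟩`. -/
def ketCoeff (e : Fin 3) : ℝ := if e = 0 then 1 else 0

/-- The Schmidt coefficients of `τ`. -/
def tauCoeff (e : Fin 3) : ℝ := if e = 1 then 0 else 1 / √2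

lemma ket00_eq_diagVec : ket00 = diagVec ketCoeff := by
  ext ⟨i, j⟩
  fin_cases i <;> fin_cases j <;> simp [ket00, diagVec, ketCoeff]

lemma tau_eq_diagVec : tau = diagVec tauCoeff := by
  ext ⟨i, j⟩
  fin_cases i <;> fin_cases j <;> simp [tau, diagVec, tauCoeff]

lemma ketCoeff_nonneg (e : Fin 3) : 0 ≤ ketCoeff e := by
  unfold ketCoeff; split_ifs <;> norm_num

lemma tauCoeff_nonneg (e : Fin 3) : 0 ≤ tauCoeff e := by
  unfold tauCoeff; split_ifs <;> positivity

lemma sum_ketCoeff_sq : ∑ e, ketCoeff e ^ 2 = 1 := by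
  simp [ketCoeff]

lemma sum_tauCoeff_sq : ∑ e, tauCoeff e ^ 2 = 1 := by
  simp [Fin.sum_univ_three, tauCoeff]
  norm_num

/-- The Schmidt coefficients of `|00⟩^{⊗ j} ⊗ τ^{⊗ (n - j)}`. -/
def wordCoeff (n j : ℕ) (w : Word n) : ℝ :=
  ∏ i : Fin n, if (i : ℕ) < j then ketCoeff (w i) else tauCoeff (w i)

lemma wordCoeff_nonneg (n j : ℕ) (w : Word n) : 0 ≤ wordCoeff n j w := by
  refine Finset.prod_nonneg fun i _ => ?_
  split_ifs
  exacts [ketCoeff_nonneg _, tauCoeff_nonneg _]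

lemma sum_wordCoeff_sq (n j : ℕ) : ∑ w, wordCoeff n j w ^ 2 = 1 := by
  have h : ∀ i : Fin n, ∑ e : Fin 3,
      (if (i : ℕ) < j then ketCoeff e else tauCoeff e) ^ 2 = 1 := by
    intro i
    split_ifs
    exacts [sum_ketCoeff_sq, sum_tauCoeff_sq]
  calc ∑ w, wordCoeff n j w ^ 2
      = ∑ w : Word n, ∏ i : Fin n,
          (if (i : ℕ) < j then ketCoeff (w i) else tauCoeff (w i)) ^ 2 := by
        simp only [wordCoeff, Finset.prod_pow]
    _ = ∏ i : Fin n, ∑ e : Fin 3,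
          (if (i : ℕ) < j then ketCoeff e else tauCoeff e) ^ 2 := by
        rw [Finset.prod_univ_sum, Fintype.piFinset_univ]
    _ = 1 := by simp only [h, Finset.prod_const_one]

lemma wordCoeff_eq_zero {n j : ℕ} {w : Word n} {i : Fin n} (h : w i = 1) :
    wordCoeff n j w = 0 := by
  refine Finset.prod_eq_zero (Finset.mem_univ i) ?_
  simp [h, ketCoeff, tauCoeff]

/-- The Schmidt coefficients of `χ_n` up to normalization. -/
def chiSum (n : ℕ) (w : Word n) : ℝ := ∑ j ∈ Finset.Icc 1 n, wordCoeff n j w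

lemma chiSum_nonneg (n : ℕ) (w : Word n) : 0 ≤ chiSum n w :=
  Finset.sum_nonneg fun j _ => wordCoeff_nonneg n j w

lemma chiRaw_eq_diagVec (n : ℕ) : chiRaw n = diagVec (chiSum n) := by
  ext ⟨v, w⟩
  simp only [chiRaw, ket00_eq_diagVec, tau_eq_diagVec, diagVec]
  by_cases h : v = w
  · subst h
    simp only [if_true, chiSum, wordCoeff, Complex.ofReal_sum, Complex.ofReal_prod]
    exact Finset.sum_congr rfl fun j _ => Finset.prod_congr rfl fun i _ => by split_ifs <;> rfl
  · rw [if_neg h]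
    obtain ⟨i, hi⟩ := Function.ne_iff.mp h
    refine Finset.sum_eq_zero fun j _ => Finset.prod_eq_zero (Finset.mem_univ i) ?_
    simp [hi]

lemma chiC_eq (n : ℕ) : chiC n = ∑ w, chiSum n w ^ 2 := by
  rw [chiC, chiRaw_eq_diagVec, sum_norm_diagVec_sq]

/-- The `n` summands are unit vectors with nonnegative coefficients, so the cross terms can only
increase the squared norm of the sum. -/
lemma le_chiC (n : ℕ) : (n : ℝ) ≤ chiC n := by
  have h : ∀ w, ∑ j ∈ Finset.Icc 1 n, wordCoeff n j w ^ 2 ≤ chiSum n w ^ 2 := fun w =>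
    Finset.sum_sq_le_sq_sum_of_nonneg fun j _ => wordCoeff_nonneg n j w
  calc (n : ℝ) = ∑ j ∈ Finset.Icc 1 n, ∑ w, wordCoeff n j w ^ 2 := by
        simp [sum_wordCoeff_sq]
    _ = ∑ w, ∑ j ∈ Finset.Icc 1 n, wordCoeff n j w ^ 2 := Finset.sum_comm
    _ ≤ chiC n := by
        rw [chiC_eq]
        exact Finset.sum_le_sum fun w _ => h w

lemma chiC_pos {n : ℕ} (hn : 1 ≤ n) : 0 < chiC n :=
  lt_of_lt_of_le (by exact_mod_cast hn) (le_chiC n)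

/-- The Schmidt coefficients of `χ_n`. -/
def chiCoeff (n : ℕ) (w : Word n) : ℝ := 1 / √(chiC n) * chiSum n w

lemma chi_eq_diagVec (n : ℕ) : chi n = diagVec (chiCoeff n) := by
  have h : chi n = ((1 / √(chiC n) : ℝ) : ℂ) • chiRaw n := rfl
  rw [h, chiRaw_eq_diagVec, smul_diagVec]
  rfl

lemma sum_chiCoeff_sq {n : ℕ} (hn : 1 ≤ n) : ∑ w, chiCoeff n w ^ 2 = 1 := by
  have h := chiC_pos hn
  simp only [chiCoeff, mul_pow, ← Finset.mul_sum, ← chiC_eq]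
  rw [div_pow, Real.sq_sqrt h.le, one_pow, one_div_mul_cancel h.ne']

lemma norm_chi {n : ℕ} (hn : 1 ≤ n) : ‖WithLp.toLp 2 (chi n)‖ = 1 := by
  rw [chi_eq_diagVec, norm_toLp_diagVec, sum_chiCoeff_sq hn, Real.sqrt_one]

/-! The permutation `shift` -/

/-- Addition in `Fin (n + 1)` wraps around, so the shift moves the first letter to the end. -/
lemma cons_add_one {n : ℕ} (e : Fin 3) (w : Word n) (i : Fin (n + 1)) :
    (Fin.cons e w : Fin (n + 1) → Fin 3) (i + 1) = (Fin.snoc w e : Fin (n + 1) → Fin 3) i := by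
  refine Fin.lastCases ?_ (fun i => ?_) i
  · rw [Fin.last_add_one, Fin.cons_zero, Fin.snoc_last]
  · rw [Fin.coeSucc_eq_succ, Fin.cons_succ, Fin.snoc_castSucc]

/-- The letters of `x` are all in `{0, 2}`. -/
def IsBinary {n : ℕ} (x : Fin 3 × Word n) : Prop := x.1 ≠ 1 ∧ ∀ i, x.2 i ≠ 1

instance {n : ℕ} (x : Fin 3 × Word n) : Decidable (IsBinary x) := by
  unfold IsBinary; infer_instance

lemma ne_one_iff (e : Fin 3) : e = 0 ∨ e = 2 ↔ e ≠ 1 := by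
  fin_cases e <;> simp

lemma shift_eq {n : ℕ} (x : Fin 3 × Word n) : shift n x =
    if IsBinary x then ((Fin.snoc x.2 x.1 : Fin (n + 1) → Fin 3) 0,
      Fin.tail (Fin.snoc x.2 x.1 : Fin (n + 1) → Fin 3)) else x := by
  simp only [shift, cons_add_one, ne_one_iff, Fin.forall_fin_succ, Fin.cons_zero, Fin.cons_succ]
  rfl

lemma isBinary_iff_snoc {n : ℕ} (x : Fin 3 × Word n) :
    IsBinary x ↔ ∀ i, (Fin.snoc x.2 x.1 : Fin (n + 1) → Fin 3) i ≠ 1 := by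
  simp only [Fin.forall_fin_succ', Fin.snoc_castSucc, Fin.snoc_last, IsBinary]
  tauto

lemma isBinary_zero_tail {n : ℕ} (u : Fin (n + 1) → Fin 3) :
    IsBinary (u 0, Fin.tail u) ↔ ∀ i, u i ≠ 1 := by
  simp only [Fin.forall_fin_succ, IsBinary]
  rfl

lemma isBinary_shift {n : ℕ} (x : Fin 3 × Word n) : IsBinary (shift n x) ↔ IsBinary x := by
  rw [shift_eq]
  by_cases h : IsBinary x
  · rw [if_pos h, isBinary_zero_tail, ← isBinary_iff_snoc]
  · rw [if_neg h]

lemma shift_injective (n : ℕ) : Function.Injective (shift n) := by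
  intro x y h
  have hb : IsBinary x ↔ IsBinary y := by rw [← isBinary_shift x, h, isBinary_shift]
  rw [shift_eq, shift_eq] at h
  by_cases hx : IsBinary x
  · rw [if_pos hx, if_pos (hb.mp hx), Prod.mk.injEq] at h
    have e : (Fin.snoc x.2 x.1 : Fin (n + 1) → Fin 3) = Fin.snoc y.2 y.1 := by
      rw [← Fin.cons_self_tail (Fin.snoc x.2 x.1 : Fin (n + 1) → Fin 3), h.1, h.2,
        Fin.cons_self_tail]
    have e' := Fin.snoc_injective2 e
    exact Prod.ext e'.2 e'.1
  · rwa [if_neg hx, if_neg (fun hy => hx (hb.mpr hy))] at h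

/-- `shift` as a permutation. -/
def shiftEquiv (n : ℕ) : Equiv.Perm (Fin 3 × Word n) :=
  Equiv.ofBijective (shift n) (Finite.injective_iff_bijective.mp (shift_injective n))

lemma shiftEquiv_apply (n : ℕ) (x : Fin 3 × Word n) : shiftEquiv n x = shift n x := rfl

/-- Both parties apply the same permutation of the basis, so a vector in Schmidt form stays in
Schmidt form. -/
lemma Gam_mulVec_diagVec (n : ℕ) (d : Fin 3 × Word n → ℝ) :
    (Gam n ⊗ₖ Gam n).mulVec (diagVec d) = diagVec (d ∘ (shiftEquiv n).symm) := by
  have h : ∀ x y, Gam n x y = if y = (shiftEquiv n).symm x then 1 else 0 := by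
    intro x y
    simp only [Gam, Matrix.of_apply, Equiv.eq_symm_apply, shiftEquiv_apply, eq_comm]
  ext ⟨x, y⟩
  rw [Matrix.mulVec, dotProduct, Fintype.sum_prod_type]
  simp only [Matrix.kroneckerMap_apply, h]
  by_cases hxy : x = y
  · simp [diagVec, hxy]
  · simp [diagVec, hxy, Ne.symm hxy]

/-! The embezzlement estimate -/

/-- A factor `τ` appended at the end leaves `j` unchanged; in the next lemma a factor `|00⟩` put in
front raises `j` by one. This offset makes the sums telescope. -/
lemma wordCoeff_snoc {n j : ℕ} (hj : j ≤ n) (x : Fin 3 × Word n) :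
    wordCoeff (n + 1) j (Fin.snoc x.2 x.1) = tauCoeff x.1 * wordCoeff n j x.2 := by
  rw [wordCoeff, Fin.prod_univ_castSucc, mul_comm]
  simp [wordCoeff, hj.not_gt]

lemma wordCoeff_cons {n : ℕ} (j : ℕ) (u : Word (n + 1)) :
    ketCoeff (u 0) * wordCoeff n j (Fin.tail u) = wordCoeff (n + 1) (j + 1) u := by
  rw [wordCoeff, wordCoeff, Fin.prod_univ_succ]
  simp [Fin.tail]

/-- Read on the rotated word, the first sum runs over `j = 1, …, n` and the second over `j = 2, …, n
+ 1`, so only the two end terms survive. On words that contain the letter `1` everything vanishes.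
-/
lemma embezzle_diff {n : ℕ} (x : Fin 3 × Word n) :
    tauCoeff x.1 * chiSum n x.2 - ketCoeff (shift n x).1 * chiSum n (shift n x).2 =
      wordCoeff (n + 1) 1 (Fin.snoc x.2 x.1) - wordCoeff (n + 1) (n + 1) (Fin.snoc x.2 x.1) := by
  have h1 : tauCoeff x.1 * chiSum n x.2 =
      ∑ j ∈ Finset.Ico 1 (n + 1), wordCoeff (n + 1) j (Fin.snoc x.2 x.1) := by
    rw [chiSum, Finset.mul_sum]
    exact Finset.sum_congr rfl fun j hj => (wordCoeff_snoc (Finset.mem_Icc.mp hj).2 x).symm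
  by_cases hb : IsBinary x
  · have h2 : ketCoeff (shift n x).1 * chiSum n (shift n x).2 =
        ∑ j ∈ Finset.Ico 1 (n + 1), wordCoeff (n + 1) (j + 1) (Fin.snoc x.2 x.1) := by
      rw [shift_eq, if_pos hb, chiSum, Finset.mul_sum]
      exact Finset.sum_congr rfl fun j _ =>
        wordCoeff_cons j (Fin.snoc x.2 x.1 : Fin (n + 1) → Fin 3)
    rw [h1, h2, ← Finset.sum_sub_distrib]
    rcases n with _ | n
    · simp
    · rw [← neg_inj, ← Finset.sum_neg_distrib]
      simp only [neg_sub]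
      exact Finset.sum_Ico_sub (fun j => wordCoeff (n + 1 + 1) j (Fin.snoc x.2 x.1)) (by lia)
  · obtain ⟨i, hi⟩ : ∃ i, (Fin.snoc x.2 x.1 : Fin (n + 1) → Fin 3) i = 1 := by
      by_contra hc
      exact hb ((isBinary_iff_snoc x).mpr (not_exists.mp hc))
    have h0 : ∀ j, wordCoeff (n + 1) j (Fin.snoc x.2 x.1) = 0 := fun j => wordCoeff_eq_zero hi
    have h2 : ketCoeff (shift n x).1 * chiSum n (shift n x).2 = 0 := by
      rw [shift_eq, if_neg hb]
      rw [IsBinary, not_and_or] at hb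
      rcases hb with hb | hb
      · simp [ketCoeff, not_not.mp hb]
      · obtain ⟨k, hk⟩ := not_forall.mp hb
        rw [chiSum, Finset.sum_eq_zero fun j _ => wordCoeff_eq_zero (not_not.mp hk), mul_zero]
    rw [h1, h2, h0, h0, Finset.sum_eq_zero fun j _ => h0 j]

lemma sum_embezzle_diff_sq {n : ℕ} (hn : 1 ≤ n) :
    ∑ x : Fin 3 × Word n, (tauCoeff x.1 * chiCoeff n x.2 -
      ketCoeff (shift n x).1 * chiCoeff n (shift n x).2) ^ 2 ≤ 2 / n := by
  have hC := chiC_pos hn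
  have h1 : ∀ x : Fin 3 × Word n, (tauCoeff x.1 * chiCoeff n x.2 -
      ketCoeff (shift n x).1 * chiCoeff n (shift n x).2) ^ 2 =
      1 / chiC n * (wordCoeff (n + 1) 1 (Fin.snoc x.2 x.1) -
        wordCoeff (n + 1) (n + 1) (Fin.snoc x.2 x.1)) ^ 2 := by
    intro x
    rw [← embezzle_diff, chiCoeff, chiCoeff,
      show 1 / chiC n = (1 / √(chiC n)) ^ 2 by rw [div_pow, Real.sq_sqrt hC.le, one_pow]]
    ring
  -- The end terms are unit vectors with nonnegative coefficients; dropping the cross term bounds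
  -- the squared norm of their difference by `2`.
  have h2 : ∑ u : Word (n + 1), (wordCoeff (n + 1) 1 u - wordCoeff (n + 1) (n + 1) u) ^ 2 ≤ 2 := by
    calc _ ≤ ∑ u : Word (n + 1), (wordCoeff (n + 1) 1 u ^ 2 + wordCoeff (n + 1) (n + 1) u ^ 2) :=
          Finset.sum_le_sum fun u _ => by
            nlinarith [mul_nonneg (wordCoeff_nonneg (n + 1) 1 u)
              (wordCoeff_nonneg (n + 1) (n + 1) u)]
      _ = 2 := by
          rw [Finset.sum_add_distrib, sum_wordCoeff_sq, sum_wordCoeff_sq]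
          norm_num
  have h3 : ∑ x : Fin 3 × Word n, (wordCoeff (n + 1) 1 (Fin.snoc x.2 x.1) -
      wordCoeff (n + 1) (n + 1) (Fin.snoc x.2 x.1)) ^ 2 =
      ∑ u : Word (n + 1), (wordCoeff (n + 1) 1 u - wordCoeff (n + 1) (n + 1) u) ^ 2 :=
    (Fin.snocEquiv fun _ : Fin (n + 1) => Fin 3).sum_comp
      fun u => (wordCoeff (n + 1) 1 u - wordCoeff (n + 1) (n + 1) u) ^ 2
  rw [Finset.sum_congr rfl fun x _ => h1 x, ← Finset.mul_sum, h3]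
  calc _ ≤ 1 / (n : ℝ) * 2 := by
        have : (0 : ℝ) < n := by exact_mod_cast hn
        gcongr
        exact le_chiC n
    _ = 2 / n := by ring

/-- The state `χ_n` embezzles `τ`. -/
lemma norm_embezzle_le {n : ℕ} (hn : 1 ≤ n) :
    ‖WithLp.toLp 2 ((Gam n ⊗ₖ Gam n).mulVec (biTensor tau (chi n)) - biTensor ket00 (chi n))‖ ≤
      √(2 / (n : ℝ)) := by
  rw [tau_eq_diagVec, ket00_eq_diagVec, chi_eq_diagVec, biTensor_diagVec, biTensor_diagVec,
    Gam_mulVec_diagVec, diagVec_sub, norm_toLp_diagVec]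
  refine Real.sqrt_le_sqrt (le_of_eq_of_le ?_ (sum_embezzle_diff_sq hn))
  rw [← Equiv.sum_comp (shiftEquiv n)]
  simp only [Function.comp_apply, Equiv.symm_apply_apply]
  rfl


/-! ### Finite-dimensional strategies -/

lemma IsProjectiveMeasurement.map {R S : Type*} [Ring R] [StarRing R] [Ring S] [StarRing S]
    {m : ℕ} {P : Fin m → R} (h : IsProjectiveMeasurement P) {F : Type*} [FunLike F R S]
    [RingHomClass F R S] [StarHomClass F R S] (f : F) :
    IsProjectiveMeasurement fun a => f (P a) where
  isStarProjection a := (h.isStarProjection a).map f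
  orthogonal a b hab := by rw [← map_mul, h.orthogonal a b hab, map_zero]
  sum_eq_one := by rw [← map_sum, h.sum_eq_one, map_one]

/-! ### Matrix strategies as strategies on Hilbert spaces -/

section MatrixStrategy

variable {ι κ : Type} [Fintype ι] [Fintype κ] [DecidableEq ι] [DecidableEq κ]

/-- The vector with the given coordinates in the Hilbert space tensor product. -/
def tensorVec (ψ : ι × κ → ℂ) : HilbertTensor (EuclideanSpace ℂ ι) (EuclideanSpace ℂ κ) :=
  ∑ x, ψ x • tmulLeft (EuclideanSpace.single x.1 (1 : ℂ)) (EuclideanSpace.single x.2 (1 : ℂ))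

lemma inner_single_toEuclideanCLM (A : Matrix ι ι ℂ) (i j : ι) :
    inner ℂ (EuclideanSpace.single i (1 : ℂ))
      (Matrix.toEuclideanCLM (𝕜 := ℂ) A (EuclideanSpace.single j (1 : ℂ))) = A i j := by
  rw [EuclideanSpace.inner_single_left, Matrix.ofLp_toEuclideanCLM]
  simp

lemma inner_tensorVec (ψ : ι × κ → ℂ) (A : Matrix ι ι ℂ) (B : Matrix κ κ ℂ) :
    inner ℂ (tensorVec ψ) (tensorOp (Matrix.toEuclideanCLM (𝕜 := ℂ) A)
      (Matrix.toEuclideanCLM (𝕜 := ℂ) B) (tensorVec ψ)) =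
      star ψ ⬝ᵥ ((A ⊗ₖ B).mulVec ψ) := by
  simp only [tensorVec, map_sum, map_smul, sum_inner, inner_sum, inner_smul_left, inner_smul_right,
    tensorOp_tmul, inner_tmul_tmul, inner_single_toEuclideanCLM, dotProduct, Matrix.mulVec,
    Matrix.kroneckerMap_apply, Finset.mul_sum, Pi.star_apply]
  rw [Finset.sum_comm]
  refine Finset.sum_congr rfl fun x _ => Finset.sum_congr rfl fun y _ => ?_
  rw [Complex.star_def]
  ring

lemma norm_tensorVec (ψ : ι × κ → ℂ) : ‖tensorVec ψ‖ = ‖WithLp.toLp 2 ψ‖ := by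
  have h := inner_tensorVec ψ 1 1
  rw [map_one, map_one, tensorOp_one, one_apply_eq_self, Matrix.one_kronecker_one,
    Matrix.one_mulVec, inner_self_eq_norm_sq_to_K] at h
  have h2 : star ψ ⬝ᵥ ψ = ((‖WithLp.toLp 2 ψ‖ : ℂ)) ^ 2 := by
    rw [← Complex.ofReal_pow, EuclideanSpace.norm_sq_eq, dotProduct]
    push_cast
    exact Finset.sum_congr rfl fun x _ => Complex.conj_mul' _
  rw [h2] at h
  have h3 : ‖tensorVec ψ‖ ^ 2 = ‖WithLp.toLp 2 ψ‖ ^ 2 := by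
    apply Complex.ofReal_injective
    push_cast
    exact h
  exact (sq_eq_sq₀ (norm_nonneg _) (norm_nonneg _)).mp h3

lemma matrixCorr_mem_Cq {nA nB mA mB : ℕ} {ψ : ι × κ → ℂ} (hψ : ‖WithLp.toLp 2 ψ‖ = 1)
    {A : Fin nA → Fin mA → Matrix ι ι ℂ} {B : Fin nB → Fin mB → Matrix κ κ ℂ}
    (hA : ∀ s, IsProjectiveMeasurement (A s)) (hB : ∀ t, IsProjectiveMeasurement (B t)) :
    matrixCorr ψ A B ∈ Cq nA nB mA mB := by
  refine ⟨EuclideanSpace ℂ ι, EuclideanSpace ℂ κ, inferInstance, inferInstance, inferInstance,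
    inferInstance, inferInstance, inferInstance, inferInstance, inferInstance, tensorVec ψ,
    fun s a => Matrix.toEuclideanCLM (𝕜 := ℂ) (A s a),
    fun t b => Matrix.toEuclideanCLM (𝕜 := ℂ) (B t b), (norm_tensorVec ψ).trans hψ,
    fun s => (hA s).map _, fun t => (hB t).map _, fun a b s t => ?_⟩
  rw [inner_tensorVec, matrixCorr_coe]
  exacts [((hA s).isStarProjection a).isSelfAdjoint, ((hB t).isStarProjection b).isSelfAdjoint]

lemma IsProjectiveMeasurement.kronecker_one {m : ℕ} {P : Fin m → Matrix ι ι ℂ}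
    (h : IsProjectiveMeasurement P) :
    IsProjectiveMeasurement fun a => P a ⊗ₖ (1 : Matrix κ κ ℂ) where
  isStarProjection a := by
    refine ⟨?_, ?_⟩
    · rw [IsIdempotentElem, ← Matrix.mul_kronecker_mul, (h.isStarProjection a).isIdempotentElem.eq,
        one_mul]
    · rw [isSelfAdjoint_iff, Matrix.star_eq_conjTranspose, Matrix.conjTranspose_kronecker,
        Matrix.conjTranspose_one, ← Matrix.star_eq_conjTranspose,
        (h.isStarProjection a).isSelfAdjoint.star_eq]
  orthogonal a b hab := by
    rw [← Matrix.mul_kronecker_mul, h.orthogonal a b hab, Matrix.zero_kronecker]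
  sum_eq_one := by
    rw [← Matrix.one_kronecker_one, ← h.sum_eq_one]
    ext x y
    simp [Matrix.sum_apply, Finset.sum_mul]

end MatrixStrategy

lemma IsProjectiveMeasurement.conj {R : Type*} [Ring R] [StarRing R] {m : ℕ} {P : Fin m → R}
    (h : IsProjectiveMeasurement P) {U : R} (hU : star U * U = 1) (hU' : U * star U = 1) :
    IsProjectiveMeasurement fun a => star U * P a * U := by
  have e : ∀ x y : R, star U * x * U * (star U * y * U) = star U * (x * y) * U := by
    intro x y
    calc _ = star U * x * (U * star U) * y * U := by noncomm_ring
      _ = _ := by rw [hU']; noncomm_ring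
  refine ⟨fun a => ⟨?_, ?_⟩, fun a b hab => ?_, ?_⟩
  · rw [IsIdempotentElem, e, (h.isStarProjection a).isIdempotentElem.eq]
  · exact (h.isStarProjection a).isSelfAdjoint.conjugate' U
  · rw [e, h.orthogonal a b hab, mul_zero, zero_mul]
  · rw [← Finset.sum_mul, ← Finset.mul_sum, h.sum_eq_one, mul_one, hU]

lemma Gam_star_mul (n : ℕ) : star (Gam n) * Gam n = 1 := by
  ext x y
  simp [Matrix.star_eq_conjTranspose, Matrix.mul_apply, Gam, Matrix.one_apply,
    (shift_injective n).eq_iff, eq_comm]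

lemma Gam_mul_star (n : ℕ) : Gam n * star (Gam n) = 1 := mul_eq_one_comm.mp (Gam_star_mul n)

lemma incl_star_mul : inclᴴ * incl = 1 := by
  ext i j
  fin_cases i <;> fin_cases j <;> simp [incl, Matrix.mul_apply]

lemma qutritProj_isProjectiveMeasurement {σ : Matrix (Fin 2) (Fin 2) ℂ} (hσ : σ * σ = 1)
    (hs : σᴴ = σ) : IsProjectiveMeasurement (qutritProj σ) := by
  have hmul : ∀ X Y : Matrix (Fin 2) (Fin 2) ℂ,
      incl * X * inclᴴ * (incl * Y * inclᴴ) = incl * (X * Y) * inclᴴ := by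
    intro X Y
    calc _ = incl * X * (inclᴴ * incl) * Y * inclᴴ := by simp only [Matrix.mul_assoc]
      _ = _ := by rw [incl_star_mul, Matrix.mul_one]; simp only [Matrix.mul_assoc]
  have hbin : ∀ a : Fin 2, binaryProj σ a * binaryProj σ a = binaryProj σ a := by
    intro a
    have h1 : ((-1 : ℂ) ^ (a : ℕ)) * (-1) ^ (a : ℕ) = 1 := by
      rw [← mul_pow]; norm_num
    rw [binaryProj, smul_mul_smul_comm, mul_add, add_mul, add_mul, smul_mul_smul_comm, hσ, h1]
    simp only [one_mul, mul_one]
    module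
  have hbin' : binaryProj σ 0 * binaryProj σ 1 = 0 := by
    rw [binaryProj, binaryProj, smul_mul_smul_comm, mul_add, add_mul, add_mul, smul_mul_smul_comm,
      hσ]
    simp
  have hbin'' : binaryProj σ 1 * binaryProj σ 0 = 0 := by
    rw [binaryProj, binaryProj, smul_mul_smul_comm, mul_add, add_mul, add_mul, smul_mul_smul_comm,
      hσ]
    simp
  have hstar : ∀ a : Fin 2, (binaryProj σ a)ᴴ = binaryProj σ a := by
    intro a
    simp [binaryProj, Matrix.conjTranspose_smul, hs]
  have hsum : binaryProj σ 0 + binaryProj σ 1 = 1 := by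
    simp only [binaryProj]
    simp
    module
  have hz : (Matrix.single 2 2 1 : Matrix (Fin 3) (Fin 3) ℂ) * incl = 0 := by
    ext i j
    fin_cases i <;> fin_cases j <;> simp [incl, Matrix.mul_apply]
  have hz' : inclᴴ * (Matrix.single 2 2 1 : Matrix (Fin 3) (Fin 3) ℂ) = 0 := by
    ext i j
    fin_cases i <;> fin_cases j <;> simp [incl, Matrix.mul_apply]
  have hsa : ∀ a : Fin 2, IsSelfAdjoint (incl * binaryProj σ a * inclᴴ) := by
    intro a
    rw [isSelfAdjoint_iff, Matrix.star_eq_conjTranspose, Matrix.conjTranspose_mul,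
      Matrix.conjTranspose_mul, Matrix.conjTranspose_conjTranspose, hstar, Matrix.mul_assoc]
  have ho : ∀ X : Matrix (Fin 2) (Fin 2) ℂ,
      (Matrix.single 2 2 1 : Matrix (Fin 3) (Fin 3) ℂ) * (incl * X * inclᴴ) = 0 := by
    intro X
    rw [← Matrix.mul_assoc, ← Matrix.mul_assoc, hz, Matrix.zero_mul, Matrix.zero_mul]
  have ho' : ∀ X : Matrix (Fin 2) (Fin 2) ℂ,
      incl * X * inclᴴ * (Matrix.single 2 2 1 : Matrix (Fin 3) (Fin 3) ℂ) = 0 := by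
    intro X
    rw [Matrix.mul_assoc, hz', Matrix.mul_zero]
  refine ⟨fun a => ?_, fun a b hab => ?_, ?_⟩
  · fin_cases a
    · exact ⟨(hmul _ _).trans (by rw [hbin]; rfl), hsa 0⟩
    · exact ⟨(hmul _ _).trans (by rw [hbin]; rfl), hsa 1⟩
    · refine ⟨?_, ?_⟩
      · simp [qutritProj, IsIdempotentElem]
      · simp [qutritProj, isSelfAdjoint_iff, Matrix.star_eq_conjTranspose]
  · fin_cases a <;> fin_cases b <;> first | exact absurd rfl hab | skip
    · exact (hmul _ _).trans (by rw [hbin']; simp)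
    · exact ho' _
    · exact (hmul _ _).trans (by rw [hbin'']; simp)
    · exact ho' _
    · exact ho _
    · exact ho _
  · rw [Fin.sum_univ_three]
    simp only [qutritProj, Matrix.cons_val_zero, Matrix.cons_val_one, Matrix.cons_val]
    rw [← Matrix.add_mul, ← Matrix.mul_add, hsum]
    ext i j
    fin_cases i <;> fin_cases j <;> simp [incl, Matrix.mul_apply, Fin.sum_univ_two]

/-! ### The measurements and the states of the strategies -/

lemma eigenProj_kronecker_one {κ : Type*} [Fintype κ] [DecidableEq κ]
    (M : Matrix (Fin 3) (Fin 3) ℂ) (a : Fin 3) :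
    eigenProj 3 (M ⊗ₖ (1 : Matrix κ κ ℂ)) a = eigenProj 3 M a ⊗ₖ (1 : Matrix κ κ ℂ) := by
  rw [eigenProj_eq_cubeProj, eigenProj_eq_cubeProj, cubeProj, cubeProj,
    ← Matrix.mul_kronecker_mul, one_mul, ← Matrix.one_kronecker_one (m := Fin 3) (n := κ)]
  ext x y
  simp only [Matrix.smul_apply, Matrix.add_apply, Matrix.kroneckerMap_apply, smul_eq_mul]
  ring

lemma tableMeas_castAdd (n : ℕ) (M : Fin 2 → Matrix (Fin 3) (Fin 3) ℂ)
    (σ : Fin 2 → Matrix (Fin 2) (Fin 2) ℂ) (s : Fin 2) (a : Fin 3) :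
    tableMeas n M σ (Fin.castAdd 2 s) a =
      eigenProj 3 (M s) a ⊗ₖ (1 : Matrix (Word n) (Word n) ℂ) := by
  rw [tableMeas, Fin.addCases_left, eigenProj_kronecker_one]

lemma tableMeas_natAdd (n : ℕ) (M : Fin 2 → Matrix (Fin 3) (Fin 3) ℂ)
    (σ : Fin 2 → Matrix (Fin 2) (Fin 2) ℂ) (s : Fin 2) (a : Fin 3) :
    tableMeas n M σ (Fin.natAdd 2 s) a =
      (Gam n)ᴴ * (qutritProj (σ s) a ⊗ₖ (1 : Matrix (Word n) (Word n) ℂ)) * Gam n := by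
  rw [tableMeas, Fin.addCases_right]

lemma tableMeas_isProjectiveMeasurement (n : ℕ) {M : Fin 2 → Matrix (Fin 3) (Fin 3) ℂ}
    {σ : Fin 2 → Matrix (Fin 2) (Fin 2) ℂ}
    (hM : ∀ s, IsProjectiveMeasurement fun a => eigenProj 3 (M s) a)
    (hσ : ∀ s, IsProjectiveMeasurement (qutritProj (σ s))) (s : Fin 4) :
    IsProjectiveMeasurement (tableMeas n M σ s) := by
  refine Fin.addCases (m := 2) (n := 2) (fun s => ?_) (fun s => ?_) s
  · rw [show tableMeas n M σ (Fin.castAdd 2 s) = _ from funext (tableMeas_castAdd n M σ s)]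
    exact (hM s).kronecker_one
  · rw [show tableMeas n M σ (Fin.natAdd 2 s) = _ from funext (tableMeas_natAdd n M σ s)]
    exact (hσ s).kronecker_one.conj (Gam_star_mul n) (Gam_mul_star n)

lemma tiltedA_qutrit (s : Fin 2) : IsProjectiveMeasurement (qutritProj (tiltedA s)) := by
  apply qutritProj_isProjectiveMeasurement <;> fin_cases s <;> ext i j <;>
    fin_cases i <;> fin_cases j <;> simp [tiltedA, pauliZ, pauliX]

lemma tiltedB_qutrit (α : ℝ) (t : Fin 2) :
    IsProjectiveMeasurement (qutritProj (tiltedB α t)) := by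
  have h : (Real.cos (tiltedMu α) : ℂ) * Real.cos (tiltedMu α) +
      Real.sin (tiltedMu α) * Real.sin (tiltedMu α) = 1 := by
    have := Real.cos_sq_add_sin_sq (tiltedMu α)
    rw [sq, sq] at this
    exact_mod_cast this
  apply qutritProj_isProjectiveMeasurement
  · simp only [tiltedB]
    generalize (Real.cos (tiltedMu α) : ℂ) = c at *
    generalize (Real.sin (tiltedMu α) : ℂ) = d at *
    fin_cases t <;> ext i j <;> fin_cases i <;> fin_cases j <;>
      simp [pauliZ, pauliX] <;> grind
  · simp only [tiltedB]
    generalize Real.cos (tiltedMu α) = c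
    generalize Real.sin (tiltedMu α) = d
    fin_cases t <;> ext i j <;> fin_cases i <;> fin_cases j <;>
      simp [pauliZ, pauliX]

lemma measA_isProjectiveMeasurement (n : ℕ) (s : Fin 4) : IsProjectiveMeasurement (measA n s) :=
  tableMeas_isProjectiveMeasurement n satwapA_isProjectiveMeasurement tiltedA_qutrit s

lemma measB_isProjectiveMeasurement (n : ℕ) (t : Fin 4) : IsProjectiveMeasurement (measB n t) :=
  tableMeas_isProjectiveMeasurement n satwapB_isProjectiveMeasurement (tiltedB_qutrit _) t

/-- The Schmidt coefficients of `ψ_n`. -/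
def psiCoeff (n : ℕ) (x : Fin 3 × Word n) : ℝ := 1 / √3 * chiCoeff n x.2

lemma psi_eq_diagVec (n : ℕ) : psi n = diagVec (psiCoeff n) := by
  rw [psi, maxEnt_eq_diagVec, chi_eq_diagVec, biTensor_diagVec]
  rfl

lemma norm_psi {n : ℕ} (hn : 1 ≤ n) : ‖WithLp.toLp 2 (psi n)‖ = 1 := by
  have h : ∑ x : Fin 3 × Word n, psiCoeff n x ^ 2 = 1 := by
    rw [Fintype.sum_prod_type]
    simp only [psiCoeff, mul_pow, ← Finset.mul_sum, sum_chiCoeff_sq hn]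
    simp
  rw [psi_eq_diagVec, norm_toLp_diagVec, h, Real.sqrt_one]

lemma pSeq_mem_Cq {n : ℕ} (hn : 1 ≤ n) : pSeq n ∈ Cq 4 4 3 3 :=
  matrixCorr_mem_Cq (norm_psi hn) (measA_isProjectiveMeasurement n)
    (measB_isProjectiveMeasurement n)


/-! ### The limit of the correlations -/

lemma matrixCorr_diagVec {ι : Type*} [Fintype ι] [DecidableEq ι] {nA nB mA mB : ℕ} (d : ι → ℝ)
    (A : Fin nA → Fin mA → Matrix ι ι ℂ) (B : Fin nB → Fin mB → Matrix ι ι ℂ) (a : Fin mA)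
    (b : Fin mB) (s : Fin nA) (t : Fin nB) : matrixCorr (diagVec d) A B a b s t =
      (∑ x, ∑ y, A s a x y * B t b x y * (d x * d y : ℝ)).re := by
  rw [matrixCorr, dotProduct, Fintype.sum_prod_type]
  congr 1
  refine Finset.sum_congr rfl fun x _ => ?_
  rw [Finset.sum_eq_single x]
  · rw [Matrix.mulVec, dotProduct, Fintype.sum_prod_type, Finset.mul_sum]
    refine Finset.sum_congr rfl fun y _ => ?_
    rw [Finset.sum_eq_single y]
    · simp [diagVec]
      ring
    · intro z _ hz
      simp [diagVec, hz.symm]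
    · simp
  · intro z _ hz
    simp [diagVec, hz.symm]
  · simp

lemma sum_matrixCorr_right {ι κ : Type*} [Fintype ι] [Fintype κ] [DecidableEq κ] {nA nB mA mB : ℕ}
    (ψ : ι × κ → ℂ) (A : Fin nA → Fin mA → Matrix ι ι ℂ) {B : Fin nB → Fin mB → Matrix κ κ ℂ}
    (hB : ∀ t, IsProjectiveMeasurement (B t)) (a : Fin mA) (s : Fin nA) (t : Fin nB) :
    ∑ b, matrixCorr ψ A B a b s t =
      (star ψ ⬝ᵥ ((A s a ⊗ₖ (1 : Matrix κ κ ℂ)).mulVec ψ)).re := by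
  simp only [matrixCorr, ← Complex.re_sum, ← dotProduct_sum, ← Matrix.sum_mulVec]
  congr 4
  rw [← (hB t).sum_eq_one]
  ext x y
  simp [Matrix.sum_apply, Finset.mul_sum]

lemma sum_matrixCorr_left {ι κ : Type*} [Fintype ι] [Fintype κ] [DecidableEq ι] {nA nB mA mB : ℕ}
    (ψ : ι × κ → ℂ) {A : Fin nA → Fin mA → Matrix ι ι ℂ} (B : Fin nB → Fin mB → Matrix κ κ ℂ)
    (hA : ∀ s, IsProjectiveMeasurement (A s)) (b : Fin mB) (s : Fin nA) (t : Fin nB) :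
    ∑ a, matrixCorr ψ A B a b s t =
      (star ψ ⬝ᵥ (((1 : Matrix ι ι ℂ) ⊗ₖ B t b).mulVec ψ)).re := by
  simp only [matrixCorr, ← Complex.re_sum, ← dotProduct_sum, ← Matrix.sum_mulVec]
  congr 4
  rw [← (hA s).sum_eq_one]
  ext x y
  simp [Matrix.sum_apply, Finset.sum_mul]

lemma Gam_conj_apply (n : ℕ) (X : Matrix (Fin 3 × Word n) (Fin 3 × Word n) ℂ)
    (x y : Fin 3 × Word n) : ((Gam n)ᴴ * X * Gam n) x y = X (shift n x) (shift n y) := by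
  simp [Matrix.mul_apply, Gam]

lemma sum_kronecker_one {n : ℕ} (S T : Matrix (Fin 3) (Fin 3) ℂ) (d : Fin 3 × Word n → ℝ) :
    ∑ x, ∑ y, (S ⊗ₖ (1 : Matrix (Word n) (Word n) ℂ)) x y *
      (T ⊗ₖ (1 : Matrix (Word n) (Word n) ℂ)) x y * (d x * d y : ℝ) =
      ∑ e, ∑ e', S e e' * T e e' * ((∑ w, d (e, w) * d (e', w) : ℝ) : ℂ) := by
  simp only [Fintype.sum_prod_type, Matrix.kroneckerMap_apply, Matrix.one_apply]
  refine Finset.sum_congr rfl fun e _ => ?_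
  rw [Finset.sum_comm]
  refine Finset.sum_congr rfl fun e' _ => ?_
  push_cast
  rw [Finset.mul_sum]
  refine Finset.sum_congr rfl fun w _ => ?_
  simp

/-! The SATWAP block -/

lemma sum_psiCoeff_mul {n : ℕ} (hn : 1 ≤ n) (e e' : Fin 3) :
    ∑ w, psiCoeff n (e, w) * psiCoeff n (e', w) = 1 / 3 := by
  have h : ∀ w, psiCoeff n (e, w) * psiCoeff n (e', w) = 1 / 3 * chiCoeff n w ^ 2 := by
    intro w
    rw [psiCoeff, psiCoeff, show (1 / 3 : ℝ) = 1 / √3 * (1 / √3) by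
      rw [div_mul_div_comm, Real.mul_self_sqrt (by norm_num), one_mul]]
    ring
  rw [Finset.sum_congr rfl fun w _ => h w, ← Finset.mul_sum, sum_chiCoeff_sq hn, mul_one]

/-- These measurements act on the factor `Φ_3` alone, and the unit vector `χ_n` drops out; so the
block does not depend on `n`. -/
lemma pSeq_castAdd {n : ℕ} (hn : 1 ≤ n) (a b : Fin 3) (s t : Fin 2) :
    pSeq n a b (Fin.castAdd 2 s) (Fin.castAdd 2 t) = satwapCorr 3 a b s t := by
  rw [pSeq, psi_eq_diagVec, matrixCorr_diagVec]
  simp only [measA, measB, tableMeas_castAdd]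
  rw [sum_kronecker_one, ← Complex.ofReal_re (satwapCorr 3 a b s t), satwapCorr_coe]
  simp only [sum_psiCoeff_mul hn, Matrix.trace, Matrix.diag, Matrix.mul_apply,
    Matrix.transpose_apply, ← Finset.sum_mul]
  push_cast
  rw [mul_comm]

/-! The tilted CHSH block -/

/-- The Schmidt coefficients of the tilted state, extended by zero. -/
def tiltedCoeff : Fin 3 → ℝ := ![√2 / √3, 1 / √3, 0]

lemma tiltedCoeff_sq_le (e : Fin 3) : tiltedCoeff e ^ 2 ≤ 1 := by
  fin_cases e <;> simp [tiltedCoeff, div_pow] <;> norm_num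

lemma tiltedCoeff_eq (e : Fin 3) :
    tiltedCoeff e = √2 / √3 * ketCoeff e + 1 / √3 * (if e = 1 then 1 else 0) := by
  fin_cases e <;> simp [tiltedCoeff, ketCoeff]

lemma psiCoeff_eq (n : ℕ) (x : Fin 3 × Word n) : psiCoeff n x =
    √2 / √3 * (tauCoeff x.1 * chiCoeff n x.2) +
      1 / √3 * ((if x.1 = 1 then 1 else 0) * chiCoeff n x.2) := by
  rw [psiCoeff, tauCoeff]
  split_ifs
  · ring
  · field_simp
    ring

/-- Words with leading letter `1` are fixed by the shift and cancel, so the deviation from the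
tilted state is the embezzlement error of `τ`, times `√(2/3)`. -/
lemma psiCoeff_sub (n : ℕ) (x : Fin 3 × Word n) :
    psiCoeff n x - tiltedCoeff (shift n x).1 * chiCoeff n (shift n x).2 =
      √2 / √3 * (tauCoeff x.1 * chiCoeff n x.2 -
        ketCoeff (shift n x).1 * chiCoeff n (shift n x).2) := by
  have h : (if x.1 = 1 then (1 : ℝ) else 0) * chiCoeff n x.2 =
      (if (shift n x).1 = 1 then 1 else 0) * chiCoeff n (shift n x).2 := by
    by_cases hb : IsBinary x
    · rw [if_neg hb.1, if_neg ((isBinary_shift x).mpr hb).1, zero_mul, zero_mul]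
    · rw [shift_eq, if_neg hb]
  rw [psiCoeff_eq, tiltedCoeff_eq]
  linear_combination 1 / √3 * h

/-- The Schmidt coefficients of `(Γ ⊗ Γ) ψ_n`. -/
def swappedCoeff (n : ℕ) : Fin 3 × Word n → ℝ := psiCoeff n ∘ (shiftEquiv n).symm

lemma swappedCoeff_shift (n : ℕ) (x : Fin 3 × Word n) :
    swappedCoeff n (shift n x) = psiCoeff n x := by
  rw [swappedCoeff, Function.comp_apply, ← shiftEquiv_apply, Equiv.symm_apply_apply]

lemma sum_swappedCoeff_sub_sq {n : ℕ} (hn : 1 ≤ n) :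
    ∑ x, (swappedCoeff n x - tiltedCoeff x.1 * chiCoeff n x.2) ^ 2 ≤ 2 / n := by
  rw [← Equiv.sum_comp (shiftEquiv n)]
  simp only [shiftEquiv_apply, swappedCoeff_shift, psiCoeff_sub, mul_pow, ← Finset.mul_sum]
  have h := sum_embezzle_diff_sq hn
  have h0 : (√2 / √3 : ℝ) ^ 2 ≤ 1 := by
    rw [div_pow, Real.sq_sqrt (by norm_num), Real.sq_sqrt (by norm_num)]
    norm_num
  exact (mul_le_of_le_one_left (Finset.sum_nonneg fun _ _ => sq_nonneg _) h0).trans h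

lemma sum_swappedCoeff_sq {n : ℕ} (hn : 1 ≤ n) : ∑ x, swappedCoeff n x ^ 2 = 1 := by
  rw [← Equiv.sum_comp (shiftEquiv n)]
  simp only [shiftEquiv_apply, swappedCoeff_shift]
  rw [Fintype.sum_prod_type]
  simp only [psiCoeff, mul_pow, ← Finset.mul_sum, sum_chiCoeff_sq hn]
  simp

lemma sum_section_le {n : ℕ} {f : Fin 3 × Word n → ℝ} (hf : ∀ x, 0 ≤ f x) (e : Fin 3) :
    ∑ w, f (e, w) ≤ ∑ x, f x := by
  rw [Fintype.sum_prod_type]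
  exact Finset.single_le_sum (f := fun e => ∑ w, f (e, w))
    (fun e _ => Finset.sum_nonneg fun w _ => hf _) (Finset.mem_univ e)

lemma tendsto_zero_of_sq_le {f : ℕ → ℝ} {c : ℝ} (h : ∀ n, 1 ≤ n → f n ^ 2 ≤ c / n) :
    Filter.Tendsto f Filter.atTop (nhds 0) := by
  have h1 : Filter.Tendsto (fun n => f n ^ 2) Filter.atTop (nhds 0) :=
    squeeze_zero' (Filter.Eventually.of_forall fun n => sq_nonneg _)
      (Filter.eventually_atTop.mpr ⟨1, h⟩) (tendsto_const_div_atTop_nhds_zero_nat c)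
  have h2 := (Real.continuous_sqrt.tendsto 0).comp h1
  rw [Real.sqrt_zero] at h2
  refine (tendsto_zero_iff_abs_tendsto_zero _).mpr (h2.congr fun n => ?_)
  simp [Real.sqrt_sq_eq_abs]

lemma tendsto_sum_swappedCoeff (e e' : Fin 3) :
    Filter.Tendsto (fun n => ∑ w, swappedCoeff n (e, w) * swappedCoeff n (e', w)) Filter.atTop
      (nhds (tiltedCoeff e * tiltedCoeff e')) := by
  -- `h1` and `h2` replace one factor of the product at a time by its ideal value, with
  -- Cauchy–Schwarz bounding the error.
  have h1 : ∀ n, 1 ≤ n → (∑ w, (swappedCoeff n (e, w) - tiltedCoeff e * chiCoeff n w) *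
      swappedCoeff n (e', w)) ^ 2 ≤ 2 / n := by
    intro n hn
    have hn' : (0 : ℝ) < n := by exact_mod_cast hn
    refine (Finset.sum_mul_sq_le_sq_mul_sq _ _ _).trans ?_
    have k1 := (sum_section_le (fun x => sq_nonneg (swappedCoeff n x -
      tiltedCoeff x.1 * chiCoeff n x.2)) e).trans (sum_swappedCoeff_sub_sq hn)
    have k2 := (sum_section_le (fun x => sq_nonneg (swappedCoeff n x)) e').trans
      (sum_swappedCoeff_sq hn).le
    calc _ ≤ 2 / (n : ℝ) * 1 :=
          mul_le_mul k1 k2 (Finset.sum_nonneg fun _ _ => sq_nonneg _) (by positivity)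
      _ = _ := mul_one _
  have h2 : ∀ n, 1 ≤ n → (∑ w, (swappedCoeff n (e', w) - tiltedCoeff e' * chiCoeff n w) *
      (tiltedCoeff e * chiCoeff n w)) ^ 2 ≤ 2 / n := by
    intro n hn
    have hn' : (0 : ℝ) < n := by exact_mod_cast hn
    refine (Finset.sum_mul_sq_le_sq_mul_sq _ _ _).trans ?_
    have k1 := (sum_section_le (fun x => sq_nonneg (swappedCoeff n x -
      tiltedCoeff x.1 * chiCoeff n x.2)) e').trans (sum_swappedCoeff_sub_sq hn)
    have k2 : ∑ w, (tiltedCoeff e * chiCoeff n w) ^ 2 ≤ 1 := by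
      simp only [mul_pow, ← Finset.mul_sum, sum_chiCoeff_sq hn, mul_one]
      exact tiltedCoeff_sq_le e
    calc _ ≤ 2 / (n : ℝ) * 1 :=
          mul_le_mul k1 k2 (Finset.sum_nonneg fun _ _ => sq_nonneg _) (by positivity)
      _ = _ := mul_one _
  have h3 := ((tendsto_zero_of_sq_le h1).add (tendsto_zero_of_sq_le h2)).add_const
    (tiltedCoeff e * tiltedCoeff e')
  rw [add_zero, zero_add] at h3
  refine h3.congr' (Filter.eventually_atTop.mpr ⟨1, fun n hn => ?_⟩)
  have h4 : tiltedCoeff e * tiltedCoeff e' =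
      ∑ w, tiltedCoeff e * tiltedCoeff e' * chiCoeff n w ^ 2 := by
    rw [← Finset.mul_sum, sum_chiCoeff_sq hn, mul_one]
  rw [h4, ← Finset.sum_add_distrib, ← Finset.sum_add_distrib]
  exact Finset.sum_congr rfl fun w _ => by ring

lemma pSeq_natAdd (n : ℕ) (a b : Fin 3) (s t : Fin 2) :
    pSeq n a b (Fin.natAdd 2 s) (Fin.natAdd 2 t) = (∑ e, ∑ e', qutritProj (tiltedA s) a e e' *
      qutritProj (tiltedB (1 / √2) t) b e e' *
        ((∑ w, swappedCoeff n (e, w) * swappedCoeff n (e', w) : ℝ) : ℂ)).re := by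
  rw [pSeq, psi_eq_diagVec, matrixCorr_diagVec]
  simp only [measA, measB, tableMeas_natAdd]
  rw [← sum_kronecker_one]
  congr 1
  conv_rhs => rw [← Equiv.sum_comp (shiftEquiv n)]
  refine Finset.sum_congr rfl fun x _ => ?_
  conv_rhs => rw [← Equiv.sum_comp (shiftEquiv n)]
  refine Finset.sum_congr rfl fun y _ => ?_
  rw [Gam_conj_apply, Gam_conj_apply, shiftEquiv_apply, shiftEquiv_apply, swappedCoeff_shift,
    swappedCoeff_shift]

lemma tendsto_pSeq_natAdd (a b : Fin 3) (s t : Fin 2) :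
    Filter.Tendsto (fun n => pSeq n a b (Fin.natAdd 2 s) (Fin.natAdd 2 t)) Filter.atTop
      (nhds (∑ e, ∑ e', qutritProj (tiltedA s) a e e' * qutritProj (tiltedB (1 / √2) t) b e e' *
        ((tiltedCoeff e * tiltedCoeff e' : ℝ) : ℂ)).re) := by
  simp only [pSeq_natAdd]
  refine (Complex.continuous_re.tendsto _).comp ?_
  refine tendsto_finsetSum _ fun e _ => tendsto_finsetSum _ fun e' _ => ?_
  exact ((Complex.continuous_ofReal.tendsto _).comp (tendsto_sum_swappedCoeff e e')).const_mul _

lemma incl_conj_apply (X : Matrix (Fin 2) (Fin 2) ℂ) : incl * X * inclᴴ =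
    !![X 0 0, X 0 1, 0; X 1 0, X 1 1, 0; 0, 0, 0] := by
  ext i j
  fin_cases i <;> fin_cases j <;> simp [incl, Matrix.mul_apply, Fin.sum_univ_two]

lemma tilted_limit_eq (a b s t : Fin 2) :
    (∑ e, ∑ e', qutritProj (tiltedA s) a.castSucc e e' *
      qutritProj (tiltedB (1 / √2) t) b.castSucc e e' *
        ((tiltedCoeff e * tiltedCoeff e' : ℝ) : ℂ)).re = tiltedCHSHCorr (1 / √2) a b s t := by
  have h : ∀ (σ : Matrix (Fin 2) (Fin 2) ℂ) (a : Fin 2),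
      qutritProj σ a.castSucc = incl * binaryProj σ a * inclᴴ := by
    intro σ a
    fin_cases a <;> rfl
  have h3 := Real.mul_self_sqrt (show (0 : ℝ) ≤ 3 by norm_num)
  have h2 := Real.mul_self_sqrt (show (0 : ℝ) ≤ 2 by norm_num)
  have c00 : tiltedCoeff 0 * tiltedCoeff 0 = 2 / 3 := by
    simp only [tiltedCoeff, Matrix.cons_val_zero]
    rw [div_mul_div_comm, h2, h3]
  have c01 : tiltedCoeff 0 * tiltedCoeff 1 = √2 / 3 := by
    simp only [tiltedCoeff, Matrix.cons_val_zero, Matrix.cons_val_one]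
    rw [div_mul_div_comm, h3, mul_one]
  have c11 : tiltedCoeff 1 * tiltedCoeff 1 = 1 / 3 := by
    change 1 / √3 * (1 / √3) = 1 / 3
    rw [div_mul_div_comm, h3, mul_one]
  rw [tiltedCHSHCorr, matrixCorr, tiltedState_expect, h, h, incl_conj_apply, incl_conj_apply,
    ← c00, ← c01, ← c11]
  congr 1
  simp [Fin.sum_univ_three]
  ring

lemma tilted_limit_two_left (T : Matrix (Fin 3) (Fin 3) ℂ) (σ : Matrix (Fin 2) (Fin 2) ℂ) :
    (∑ e, ∑ e', qutritProj σ 2 e e' * T e e' * ((tiltedCoeff e * tiltedCoeff e' : ℝ) : ℂ)).re =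
      0 := by
  simp [Fin.sum_univ_three, qutritProj, tiltedCoeff, Matrix.single]

/-! The mixed blocks -/

/-- The coefficient of `N e e' / 3` in the mixed blocks. -/
def mixedCoeff (n : ℕ) (S : Matrix (Fin 3) (Fin 3) ℂ) (e e' : Fin 3) : ℂ :=
  ∑ w, (S ⊗ₖ (1 : Matrix (Word n) (Word n) ℂ)) (shift n (e, w)) (shift n (e', w)) *
    (chiCoeff n w ^ 2 : ℝ)

lemma mixedCoeff_transpose (n : ℕ) (S : Matrix (Fin 3) (Fin 3) ℂ) (e e' : Fin 3) :
    mixedCoeff n Sᵀ e e' = mixedCoeff n S e' e := by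
  simp only [mixedCoeff, Matrix.kroneckerMap_apply, Matrix.transpose_apply, Matrix.one_apply,
    eq_comm]

/-- The factor `1` in `N ⊗ 1` forces both indices to carry the same word; the shift acts on the side
of `S` only. -/
lemma sum_mixed (n : ℕ) (S N : Matrix (Fin 3) (Fin 3) ℂ) :
    ∑ x, ∑ y, ((Gam n)ᴴ * (S ⊗ₖ (1 : Matrix (Word n) (Word n) ℂ)) * Gam n) x y *
      (N ⊗ₖ (1 : Matrix (Word n) (Word n) ℂ)) x y * (psiCoeff n x * psiCoeff n y : ℝ) =
      ∑ e, ∑ e', (1 / 3 : ℂ) * N e e' * mixedCoeff n S e e' := by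
  simp only [Gam_conj_apply, Fintype.sum_prod_type]
  refine Finset.sum_congr rfl fun e _ => ?_
  rw [Finset.sum_comm]
  refine Finset.sum_congr rfl fun e' _ => ?_
  rw [mixedCoeff, Finset.mul_sum]
  refine Finset.sum_congr rfl fun w _ => ?_
  rw [Finset.sum_eq_single w]
  · rw [Matrix.kroneckerMap_apply (A := N), Matrix.one_apply_eq, psiCoeff, psiCoeff,
      show 1 / √3 * chiCoeff n w * (1 / √3 * chiCoeff n w) = 1 / 3 * chiCoeff n w ^ 2 by
        rw [mul_mul_mul_comm, div_mul_div_comm, Real.mul_self_sqrt (by norm_num)]; ring]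
    push_cast
    ring
  · intro v _ hv
    rw [Matrix.kroneckerMap_apply (A := N), Matrix.one_apply_ne hv.symm]
    ring
  · simp

lemma chiCoeff_eq_zero_of_zero {n : ℕ} {w : Word (n + 1)} (h : w 0 ≠ 0) :
    chiCoeff (n + 1) w = 0 := by
  have : chiSum (n + 1) w = 0 := by
    refine Finset.sum_eq_zero fun j hj => Finset.prod_eq_zero (Finset.mem_univ 0) ?_
    have : 0 < j := (Finset.mem_Icc.mp hj).1
    simp [this, ketCoeff, h]
  rw [chiCoeff, this, mul_zero]

lemma chiCoeff_eq_zero_of_one {n : ℕ} {w : Word n} {i : Fin n} (h : w i = 1) :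
    chiCoeff n w = 0 := by
  rw [chiCoeff, chiSum, Finset.sum_eq_zero fun j _ => wordCoeff_eq_zero h, mul_zero]

lemma shift_one {n : ℕ} (w : Word n) : shift n (1, w) = (1, w) := by
  rw [shift_eq, if_neg fun h => h.1 rfl]

/-- `χ_n` lives on words without the letter `1` that begin with `0`, since the sum starts at `j =
1`. The rotation brings this `0` to the front, whatever `e` was. -/
lemma shift_of_support {n : ℕ} {e : Fin 3} (he : e ≠ 1) {w : Word (n + 1)}
    (hw : chiCoeff (n + 1) w ≠ 0) : shift (n + 1) (e, w) =
      (0, Fin.tail (Fin.snoc w e : Fin (n + 1 + 1) → Fin 3)) := by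
  have h0 : w 0 = 0 := by
    by_contra h
    exact hw (chiCoeff_eq_zero_of_zero h)
  rw [shift_eq, if_pos ⟨he, fun i hi => hw (chiCoeff_eq_zero_of_one hi)⟩]
  simp only [Fin.snoc_apply_zero, h0]

lemma mixedCoeff_one_one {n : ℕ} (hn : 1 ≤ n) (S : Matrix (Fin 3) (Fin 3) ℂ) :
    mixedCoeff n S 1 1 = S 1 1 := by
  simp only [mixedCoeff, shift_one, Matrix.kroneckerMap_apply, Matrix.one_apply_eq, mul_one,
    ← Finset.mul_sum, ← Complex.ofReal_sum, sum_chiCoeff_sq hn, Complex.ofReal_one]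

lemma mixedCoeff_self {n : ℕ} (S : Matrix (Fin 3) (Fin 3) ℂ) {e : Fin 3} (he : e ≠ 1) :
    mixedCoeff (n + 1) S e e = S 0 0 := by
  have h : ∀ w, (S ⊗ₖ (1 : Matrix (Word (n + 1)) (Word (n + 1)) ℂ)) (shift (n + 1) (e, w))
      (shift (n + 1) (e, w)) * (chiCoeff (n + 1) w ^ 2 : ℝ) =
      S 0 0 * (chiCoeff (n + 1) w ^ 2 : ℝ) := by
    intro w
    by_cases hw : chiCoeff (n + 1) w = 0
    · simp [hw]
    · rw [shift_of_support he hw, Matrix.kroneckerMap_apply, Matrix.one_apply_eq, mul_one]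
  rw [mixedCoeff, Finset.sum_congr rfl fun w _ => h w, ← Finset.mul_sum, ← Complex.ofReal_sum,
    sum_chiCoeff_sq (by lia), Complex.ofReal_one, mul_one]

/-- The letters `e` and `e'` become the last letters of the rotated words, which are therefore
different. -/
lemma mixedCoeff_ne {n : ℕ} (S : Matrix (Fin 3) (Fin 3) ℂ) {e e' : Fin 3} (he : e ≠ 1)
    (he' : e' ≠ 1) (hne : e ≠ e') : mixedCoeff (n + 1) S e e' = 0 := by
  refine Finset.sum_eq_zero fun w _ => ?_
  by_cases hw : chiCoeff (n + 1) w = 0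
  · simp [hw]
  · rw [shift_of_support he hw, shift_of_support he' hw, Matrix.kroneckerMap_apply,
      Matrix.one_apply_ne, mul_zero, zero_mul]
    intro h
    have h1 : (Fin.snoc w e : Fin (n + 1 + 1) → Fin 3) (Fin.last n).succ =
      (Fin.snoc w e' : Fin (n + 1 + 1) → Fin 3) (Fin.last n).succ := congrFun h (Fin.last n)
    rw [Fin.succ_last, Fin.snoc_last, Fin.snoc_last] at h1
    exact hne h1

/-- Each letter equals the next one, so the word is constant. -/
lemma eq_zero_of_eq_tail {n : ℕ} {e : Fin 3} {w : Word (n + 1)} (h0 : w 0 = 0)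
    (h : w = Fin.tail (Fin.snoc w e : Fin (n + 1 + 1) → Fin 3)) : w = 0 := by
  funext i
  induction i using Fin.induction with
  | zero => exact h0
  | succ i ih =>
    have h1 : w i.castSucc = (Fin.snoc w e : Fin (n + 1 + 1) → Fin 3) i.castSucc.succ :=
      congrFun h i.castSucc
    rw [Fin.succ_castSucc, Fin.snoc_castSucc, ih] at h1
    exact h1.symm

/-- A word after `1` stays in place while a word after `e` is rotated; on the support of `χ_n` the
two can agree only for the all-zero word. -/
lemma norm_mixedCoeff_le {n : ℕ} (S : Matrix (Fin 3) (Fin 3) ℂ) {e : Fin 3} (he : e ≠ 1) :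
    ‖mixedCoeff (n + 1) S 1 e‖ ≤ ‖S 1 0‖ * chiCoeff (n + 1) 0 ^ 2 := by
  rw [mixedCoeff, Finset.sum_eq_single 0]
  · by_cases hw : chiCoeff (n + 1) 0 = 0
    · simp [hw]
    · rw [shift_one, shift_of_support he hw, Matrix.kroneckerMap_apply, norm_mul, norm_mul,
        Complex.norm_real, Real.norm_of_nonneg (sq_nonneg _)]
      refine mul_le_mul_of_nonneg_right (mul_le_of_le_one_right (norm_nonneg _) ?_) (sq_nonneg _)
      rw [Matrix.one_apply]
      split_ifs <;> simp
  · intro w _ hw0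
    by_cases hw : chiCoeff (n + 1) w = 0
    · simp [hw]
    · rw [shift_one, shift_of_support he hw, Matrix.kroneckerMap_apply, Matrix.one_apply_ne,
        mul_zero, zero_mul]
      intro h
      refine hw0 (eq_zero_of_eq_tail ?_ h)
      by_contra h0
      exact hw (chiCoeff_eq_zero_of_zero h0)
  · simp

/-- On the all-zero word each factor `τ` contributes `1 / √2`, so `chiSum n 0` is a partial sum of a
geometric series. The new term `1` comes from `|00⟩^{⊗ (n + 1)}`. -/
lemma chiSum_succ_zero (n : ℕ) : chiSum (n + 1) 0 = 1 / √2 * chiSum n 0 + 1 := by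
  have h1 : ∀ j ∈ Finset.Icc 1 n, wordCoeff (n + 1) j 0 = 1 / √2 * wordCoeff n j 0 := by
    intro j hj
    have hj' : ¬ n < j := (Finset.mem_Icc.mp hj).2.not_gt
    rw [wordCoeff, Fin.prod_univ_castSucc, mul_comm]
    simp [wordCoeff, hj', tauCoeff]
  have h2 : wordCoeff (n + 1) (n + 1) 0 = 1 := by
    refine Finset.prod_eq_one fun i _ => ?_
    simp [i.isLt, ketCoeff]
  rw [chiSum, Finset.sum_Icc_succ_top (by lia), h2, Finset.sum_congr rfl h1, ← Finset.mul_sum]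
  rfl

lemma chiSum_zero_le (n : ℕ) : chiSum n 0 ≤ 4 := by
  induction n with
  | zero => simp [chiSum]
  | succ n ih =>
    -- The bound `4` is the fixed point of `x ↦ (3 / 4) x + 1`.
    have h : 1 / √2 ≤ 3 / 4 := by
      rw [div_le_div_iff₀ (by positivity) (by norm_num), one_mul, ← div_le_iff₀' (by norm_num)]
      exact Real.le_sqrt_of_sq_le (by norm_num)
    rw [chiSum_succ_zero]
    have h' : 1 / √2 * chiSum n 0 ≤ 3 / 4 * 4 :=
      mul_le_mul h ih (chiSum_nonneg _ _) (by norm_num)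
    linarith

lemma tendsto_chiCoeff_zero :
    Filter.Tendsto (fun n => chiCoeff n 0 ^ 2) Filter.atTop (nhds 0) := by
  have h : Filter.Tendsto (fun n => chiCoeff n 0) Filter.atTop (nhds 0) := by
    refine tendsto_zero_of_sq_le (c := 16) fun n hn => ?_
    have hn' : (0 : ℝ) < n := by exact_mod_cast hn
    rw [chiCoeff, mul_pow, div_pow, Real.sq_sqrt (chiC_pos hn).le, one_pow, div_mul_eq_mul_div,
      one_mul]
    have h1 := chiSum_zero_le n
    have h2 := chiSum_nonneg n 0
    -- The squared weight is at most `4² / C_n`, with `C_n ≥ n`.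
    exact div_le_div₀ (by norm_num) (by nlinarith) hn' (le_chiC n)
  simpa using h.pow 2

lemma tendsto_mixedCoeff_one (S : Matrix (Fin 3) (Fin 3) ℂ) {e : Fin 3} (he : e ≠ 1) :
    Filter.Tendsto (fun n => mixedCoeff n S 1 e) Filter.atTop (nhds 0) := by
  have h := tendsto_chiCoeff_zero.const_mul ‖S 1 0‖
  rw [mul_zero] at h
  refine squeeze_zero_norm' (Filter.eventually_atTop.mpr ⟨1, fun n hn => ?_⟩) h
  obtain ⟨n, rfl⟩ := Nat.exists_eq_add_of_le' hn
  exact norm_mixedCoeff_le S he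

/-- The limits of the coefficients in the mixed blocks. -/
def mixedLimit (S : Matrix (Fin 3) (Fin 3) ℂ) (e e' : Fin 3) : ℂ :=
  if e = e' then if e = 1 then S 1 1 else S 0 0 else 0

lemma tendsto_mixedCoeff (S : Matrix (Fin 3) (Fin 3) ℂ) (e e' : Fin 3) :
    Filter.Tendsto (fun n => mixedCoeff n S e e') Filter.atTop (nhds (mixedLimit S e e')) := by
  have hev : ∀ {c : ℂ}, (∀ n, mixedCoeff (n + 1) S e e' = c) →
      Filter.Tendsto (fun n => mixedCoeff n S e e') Filter.atTop (nhds c) := fun h =>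
    tendsto_const_nhds.congr' (Filter.eventually_atTop.mpr ⟨1, fun n hn => by
      obtain ⟨n, rfl⟩ := Nat.exists_eq_add_of_le' hn
      exact (h n).symm⟩)
  unfold mixedLimit
  split_ifs with h1 h2
  · subst h1 h2
    exact hev fun n => mixedCoeff_one_one (by lia) S
  · subst h1
    exact hev fun n => mixedCoeff_self S h2
  · by_cases he : e = 1
    · subst he
      exact tendsto_mixedCoeff_one S (Ne.symm h1)
    · by_cases he' : e' = 1
      · subst he'
        exact (tendsto_mixedCoeff_one Sᵀ he).congr fun n => mixedCoeff_transpose n S 1 e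
      · exact hev fun n => mixedCoeff_ne S he he' h1

lemma tendsto_mixed (S N : Matrix (Fin 3) (Fin 3) ℂ) :
    Filter.Tendsto (fun n => (∑ e, ∑ e', (1 / 3 : ℂ) * N e e' * mixedCoeff n S e e').re)
      Filter.atTop (nhds ((1 / 3 : ℂ) * ((N 0 0 + N 2 2) * S 0 0 + N 1 1 * S 1 1)).re) := by
  have h : (1 / 3 : ℂ) * ((N 0 0 + N 2 2) * S 0 0 + N 1 1 * S 1 1) =
      ∑ e, ∑ e', (1 / 3 : ℂ) * N e e' * mixedLimit S e e' := by
    simp [Fin.sum_univ_three, mixedLimit]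
    ring
  rw [h]
  refine (Complex.continuous_re.tendsto _).comp ?_
  exact tendsto_finsetSum _ fun e _ => tendsto_finsetSum _ fun e' _ =>
    (tendsto_mixedCoeff S e e').const_mul _

lemma tendsto_pSeq_natAdd_castAdd (a b : Fin 3) (s t : Fin 2) :
    Filter.Tendsto (fun n => pSeq n a b (Fin.natAdd 2 s) (Fin.castAdd 2 t)) Filter.atTop
      (nhds ((1 / 3 : ℂ) * ((eigenProj 3 (satwapB 3 t) b 0 0 + eigenProj 3 (satwapB 3 t) b 2 2) *
        qutritProj (tiltedA s) a 0 0 +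
          eigenProj 3 (satwapB 3 t) b 1 1 * qutritProj (tiltedA s) a 1 1)).re) := by
  refine (tendsto_mixed _ _).congr fun n => ?_
  rw [pSeq, psi_eq_diagVec, matrixCorr_diagVec]
  simp only [measA, measB, tableMeas_natAdd, tableMeas_castAdd]
  rw [sum_mixed]

lemma tendsto_pSeq_castAdd_natAdd (a b : Fin 3) (s t : Fin 2) :
    ∃ l, Filter.Tendsto (fun n => pSeq n a b (Fin.castAdd 2 s) (Fin.natAdd 2 t)) Filter.atTop
      (nhds l) := by
  refine ⟨_, (tendsto_mixed (qutritProj (tiltedB (1 / √2) t) b)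
    (eigenProj 3 (satwapA 3 s) a)).congr fun n => ?_⟩
  rw [pSeq, psi_eq_diagVec, matrixCorr_diagVec]
  simp only [measA, measB, tableMeas_natAdd, tableMeas_castAdd]
  rw [← sum_mixed]
  simp only [mul_comm ((eigenProj 3 (satwapA 3 s) a ⊗ₖ _) _ _)]

/-! ### Existence of the limit and its three properties -/

lemma exists_tendsto_pSeq : ∃ p : Corr 4 4 3 3, Filter.Tendsto pSeq Filter.atTop (nhds p) := by
  have h : ∀ a b s t, ∃ l, Filter.Tendsto (fun n => pSeq n a b s t) Filter.atTop (nhds l) := by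
    intro a b s t
    refine Fin.addCases (m := 2) (n := 2) (fun s => ?_) (fun s => ?_) s <;>
      refine Fin.addCases (m := 2) (n := 2) (fun t => ?_) (fun t => ?_) t
    · exact ⟨_, tendsto_const_nhds.congr' (Filter.eventually_atTop.mpr
        ⟨1, fun n hn => (pSeq_castAdd hn a b s t).symm⟩)⟩
    · exact tendsto_pSeq_castAdd_natAdd a b s t
    · exact ⟨_, tendsto_pSeq_natAdd_castAdd a b s t⟩
    · exact ⟨_, tendsto_pSeq_natAdd a b s t⟩
  choose p hp using h
  exact ⟨p, tendsto_pi_nhds.mpr fun a => tendsto_pi_nhds.mpr fun b => tendsto_pi_nhds.mpr fun s =>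
    tendsto_pi_nhds.mpr fun t => hp a b s t⟩

lemma tendsto_pSeq_apply {p : Corr 4 4 3 3} (hp : Filter.Tendsto pSeq Filter.atTop (nhds p))
    (a b : Fin 3) (s t : Fin 4) :
    Filter.Tendsto (fun n => pSeq n a b s t) Filter.atTop (nhds (p a b s t)) :=
  (((hp.apply_nhds a).apply_nhds b).apply_nhds s).apply_nhds t

lemma propI_of_tendsto {p : Corr 4 4 3 3} (hp : Filter.Tendsto pSeq Filter.atTop (nhds p)) :
    PropI p := fun a b s t =>
  tendsto_nhds_unique (tendsto_pSeq_apply hp a b _ _) (tendsto_const_nhds.congr'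
    (Filter.eventually_atTop.mpr ⟨1, fun _ hn => (pSeq_castAdd hn a b s t).symm⟩))

lemma propII_of_tendsto {p : Corr 4 4 3 3} (hp : Filter.Tendsto pSeq Filter.atTop (nhds p)) :
    PropII p := by
  have h : ∀ (a b : Fin 3) (s t : Fin 2), p a b (Fin.natAdd 2 s) (Fin.natAdd 2 t) = _ :=
    fun a b s t => tendsto_nhds_unique (tendsto_pSeq_apply hp a b _ _) (tendsto_pSeq_natAdd a b s t)
  refine fun s t => ⟨fun a b => ?_, fun a => ?_, fun b => ?_⟩
  · rw [h, tilted_limit_eq]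
  · rw [h]
    simp only [mul_comm (qutritProj (tiltedA s) a _ _)]
    exact tilted_limit_two_left _ _
  · rw [h, tilted_limit_two_left]

lemma eigenProj_satwapB_diag (i : Fin 3) :
    eigenProj 3 (satwapB 3 0) 1 i i = if i = 1 then 1 else 0 := by
  have h := rootW_poly
  rw [eigenProj_eq_cubeProj, satwapB_zero_eq, cubeProj, om_eq]
  fin_cases i <;> simp [Matrix.mul_apply] <;>
    generalize rootW = w at * <;> grind

lemma qutritProj_pauliZ_diag (a : Fin 3) : qutritProj pauliZ a 0 0 = (if a = 0 then 1 else 0) ∧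
    qutritProj pauliZ a 1 1 = if a = 1 then 1 else 0 := by
  fin_cases a <;> simp [qutritProj, incl_conj_apply, binaryProj, pauliZ, Matrix.single] <;>
    norm_num

lemma propIII_of_tendsto {p : Corr 4 4 3 3} (hp : Filter.Tendsto pSeq Filter.atTop (nhds p)) :
    PropIII p := by
  have h : ∀ (a b : Fin 3) (s t : Fin 2), p a b (Fin.natAdd 2 s) (Fin.castAdd 2 t) = _ :=
    fun a b s t => tendsto_nhds_unique (tendsto_pSeq_apply hp a b _ _)
      (tendsto_pSeq_natAdd_castAdd a b s t)
  have hA : tiltedA 0 = pauliZ := rfl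
  have h1 : ∀ b : Fin 3, p 1 b 2 0 = ((1 / 3 : ℂ) * eigenProj 3 (satwapB 3 0) b 1 1).re := by
    intro b
    refine (h 1 b 0 0).trans ?_
    rw [hA, (qutritProj_pauliZ_diag 1).1, (qutritProj_pauliZ_diag 1).2]
    simp
  have h2 : ∀ a : Fin 3, p a 1 2 0 = if a = 1 then 1 / 3 else 0 := by
    intro a
    refine (h a 1 0 0).trans ?_
    rw [hA, (qutritProj_pauliZ_diag a).2, eigenProj_satwapB_diag, eigenProj_satwapB_diag,
      eigenProj_satwapB_diag, if_neg (by decide), if_neg (by decide), if_pos rfl]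
    split_ifs <;> simp
  have hB := (satwapB_isProjectiveMeasurement 0).sum_eq_one
  -- No-signalling holds for each `p_n` and passes to the limit; so the marginals need to be
  -- computed only for the inputs `2` and `0`.
  have hr : ∀ t, ∑ b, p 1 b 2 t = ∑ b, p 1 b 2 0 := fun t =>
    tendsto_nhds_unique (tendsto_finsetSum _ fun b _ => tendsto_pSeq_apply hp 1 b 2 t)
      ((tendsto_finsetSum _ fun b _ => tendsto_pSeq_apply hp 1 b 2 0).congr fun n => by
        rw [pSeq, sum_matrixCorr_right _ _ (measB_isProjectiveMeasurement n),
          sum_matrixCorr_right _ _ (measB_isProjectiveMeasurement n)])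
  have hl : ∀ s, ∑ a, p a 1 s 0 = ∑ a, p a 1 2 0 := fun s =>
    tendsto_nhds_unique (tendsto_finsetSum _ fun a _ => tendsto_pSeq_apply hp a 1 s 0)
      ((tendsto_finsetSum _ fun a _ => tendsto_pSeq_apply hp a 1 2 0).congr fun n => by
        rw [pSeq, sum_matrixCorr_left _ _ (measA_isProjectiveMeasurement n),
          sum_matrixCorr_left _ _ (measA_isProjectiveMeasurement n)])
  refine ⟨?_, fun t => ?_, fun s => ?_⟩
  · rw [h2, if_pos rfl]
  · rw [hr t]
    simp only [h1, ← Complex.re_sum, ← Finset.mul_sum]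
    have h3 := congrArg (fun M : Matrix (Fin 3) (Fin 3) ℂ => M 1 1) hB
    simp only [Matrix.sum_apply, Matrix.one_apply_eq] at h3
    rw [h3]
    norm_num
  · rw [hl s]
    simp only [h2, Finset.sum_ite_eq', Finset.mem_univ, if_true]

lemma mem_Cqa_of_tendsto {p : Corr 4 4 3 3} (hp : Filter.Tendsto pSeq Filter.atTop (nhds p)) :
    p ∈ Cqa 4 4 3 3 :=
  mem_closure_of_tendsto hp (Filter.eventually_atTop.mpr ⟨1, fun _ hn => pSeq_mem_Cq hn⟩)

end QuantumCorrelation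

end

open QuantumCorrelation in
open scoped Kronecker in
theorem theorem7 :
    -- the states `χ_n` are unit vectors and embezzle: they turn `τ` into `|00⟩` up to `√(2 / n)`
    (∀ n : ℕ, 1 ≤ n →
      ‖WithLp.toLp 2 (chi n)‖ = 1 ∧
      ‖WithLp.toLp 2 ((Gam n ⊗ₖ Gam n).mulVec (biTensor tau (chi n)) -
          biTensor ket00 (chi n))‖ ≤ √(2 / (n : ℝ))) ∧
    -- the states `ψ_n` and the measurements are a quantum strategy, so that `p_n` is in `C_q`
    (∀ n : ℕ, 1 ≤ n →
      ‖WithLp.toLp 2 (psi n)‖ = 1 ∧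
      (∀ s, IsProjectiveMeasurement (measA n s)) ∧
      (∀ t, IsProjectiveMeasurement (measB n t)) ∧
      pSeq n ∈ Cq 4 4 3 3) ∧
    -- the limit exists, lies in `C_qa` and has the three properties
    (∃ pStar : Corr 4 4 3 3,
      Filter.Tendsto pSeq Filter.atTop (nhds pStar) ∧
      pStar ∈ Cqa 4 4 3 3 ∧ PropI pStar ∧ PropII pStar ∧ PropIII pStar) ∧
    -- no spatial quantum correlation has the three properties
    (¬ ∃ q : Corr 4 4 3 3, q ∈ Cqs 4 4 3 3 ∧ PropI q ∧ PropII q ∧ PropIII q) ∧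
    Cqs 4 4 3 3 ≠ Cqa 4 4 3 3 := by
  obtain ⟨p, hp⟩ := exists_tendsto_pSeq
  have hI := propI_of_tendsto hp
  have hII := propII_of_tendsto hp
  have hIII := propIII_of_tendsto hp
  refine ⟨fun n hn => ⟨norm_chi hn, norm_embezzle_le hn⟩, fun n hn => ⟨norm_psi hn,
    measA_isProjectiveMeasurement n, measB_isProjectiveMeasurement n, pSeq_mem_Cq hn⟩,
    ⟨p, hp, mem_Cqa_of_tendsto hp, hI, hII, hIII⟩, not_exists_mem_Cqs, fun h => ?_⟩
  exact not_exists_mem_Cqs ⟨p, h ▸ mem_Cqa_of_tendsto hp, hI, hII, hIII⟩
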